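/- A cache over a set of memory blocks is a deterministic transition system: accessing a block $a$ (a hit if $a$ is cached, a miss otherwise) changes the cache state according to one of the following replacement policies, for associativity (number of ways) $N\ge 1$. * LRU and FIFO: a state is a word of at most $N$ pairwise distinct blocks, the empty cache being the empty word. On a miss, $a$ is appended to the word, after the first letter has been discarded if the word already has length $N$. On a hit, FIFO changes nothing, while LRU moves $a$ to the end of the word. * Pseudo-RR, with a fixed number $k$ of cache sets: a block is a pair (set number, name), each set is an array of $N$ lines, and one index in $\{0,\dots,N-1\}$ (initially $0$) is shared by all sets. A hit changes nothing; on a miss the line at the shared index in the set of $a$ receives $a$, and the index advances by one modulo $N$. * PLRU, $N=2^h$: the lines are the leaves of a full binary tree whose internal nodes carry an arrow to the left or to the right. On a hit, the arrows on the path from the root to the line of $a$ are turned away from that path. On a miss, $a$ is put into the leftmost empty line, or, if there is none, into the line to which the arrows lead from the root, and then the arrows are turned away from its path. * NMRU: a state is a sequence of at most $N$ distinct blocks, each with an MRU-bit. On a miss, $a$ is appended if there are fewer than $N$ blocks, and otherwise replaces the leftmost block with MRU-bit $0$ (the only block, if $N=1$). After any access the MRU-bit of $a$ is set to $1$, and if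 $N-1$ other MRU-bits equal $1$, all other MRU-bits are set to $0$. Let $k=1$ for all policies other than pseudo-RR. An input consists of a finite directed multigraph $G=(V,E)$ whose edges are labelled with memory blocks (or carry no access), nodes $S,F\in V$ and a block $a$; put $|G|=|V|+|E|$. The exist-hit (exist-miss) problem asks whether there is a path from $S$ to $F$ whose execution, starting with an empty cache, ends in a cache state that contains (does not contain) $a$. In the variant with arbitrary initial contents, the path may be executed from any legal initial cache state: no block is cached twice in a set, lines may be empty, and tags, MRU-bits and the shared index are arbitrary, except that an NMRU state with $N$ blocks must have an MRU-bit equal to $0$. **Theorem.** Fix one of these policies and an associativity $N$. Then exist-hit and exist-miss, with an empty initial cache as well as with arbitrary initial contents, are decidable in time $O(|G|^{kN+1})$ on a random access machine on which every assignment, addition, subtraction, indirect load or store and test of a register takes one step. In particular, for a single cache set ($k=1$) the time is $O(|G|^{N+1})$. The program and the constant depend only on the policy, $N$, and the problem. -/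

import Mathlib

namespace CacheAnalysis

/-! ### Caches and replacement policies -/

/-- The operational description of a cache over the memory blocks `β`: its states, the empty
state, the legal states, the effect of an access, and the set of blocks that are cached. -/
structure Cache (β : Type) where
  State : Type
  empty : State
  Legal : State → Prop
  access : State → β → State
  contents : State → Set β

section Policies

variable {β : Type} [DecidableEq β]

/-- Access to the block `a` in an `N`-way LRU cache. The state is a word, oldest block first. -/
def lruAccess (N : ℕ) (w : List β) (a : β) : List β :=
  if a ∈ w then w.erase a ++ [a]
  else if w.length < N then w ++ [a]
  else w.tail ++ [a]

/-- The `N`-way LRU (least recently used) cache. -/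
def lruCache (β : Type) [DecidableEq β] (N : ℕ) : Cache β where
  State := List β
  empty := []
  Legal w := w.Nodup ∧ w.length ≤ N
  access := lruAccess N
  contents w := {a | a ∈ w}

/-- Access to the block `a` in an `N`-way FIFO cache. The state is a word, oldest block first. -/
def fifoAccess (N : ℕ) (w : List β) (a : β) : List β :=
  if a ∈ w then w
  else if w.length < N then w ++ [a]
  else w.tail ++ [a]

/-- The `N`-way FIFO (first in, first out) cache. -/
def fifoCache (β : Type) [DecidableEq β] (N : ℕ) : Cache β where
  State := List β
  empty := []
  Legal w := w.Nodup ∧ w.length ≤ N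
  access := fifoAccess N
  contents w := {a | a ∈ w}

/-- A pseudo-RR (pseudo round-robin) cache with `k` cache sets: each set is an array of lines
(`none` is an empty line), and all sets share one index `next` of the line to be replaced. -/
structure PseudoRRState (k : ℕ) where
  lines : Fin k → List (Option ℕ)
  next : ℕ

/-- Access to the block named `a.2` of the cache set number `a.1`. A hit changes nothing; on a
miss the line at the shared index, in the set of the block, is replaced and the index advances
cyclically. -/
def pseudoRRAccess {k : ℕ} (N : ℕ) (σ : PseudoRRState k) (a : Fin k × ℕ) : PseudoRRState k :=
  if some a.2 ∈ σ.lines a.1 then σ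
  else
    { lines := Function.update σ.lines a.1 ((σ.lines a.1).set σ.next (some a.2))
      next := (σ.next + 1) % N }

/-- The pseudo-RR cache with `k` cache sets of `N` ways each. -/
def pseudoRRCache (k N : ℕ) : Cache (Fin k × ℕ) where
  State := PseudoRRState k
  empty := { lines := fun _ => List.replicate N none, next := 0 }
  Legal σ := σ.next < N ∧
    ∀ s, (σ.lines s).length = N ∧ ((σ.lines s).filterMap id).Nodup
  access := pseudoRRAccess N
  contents σ := {a | some a.2 ∈ σ.lines a.1}

/-- States of a PLRU (tree-based pseudo-LRU) cache with `2 ^ h` ways: a full binary tree of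
height `h`. The leaves are the cache lines (`none` is an empty line); each internal node has a tag
bit, `false` for an arrow to the left and `true` for an arrow to the right. -/
inductive PLRUTree (β : Type) : ℕ → Type
  | line (b : Option β) : PLRUTree β 0
  | node {h : ℕ} (tag : Bool) (l r : PLRUTree β h) : PLRUTree β (h + 1)

namespace PLRUTree

/-- The cached blocks, from left to right. -/
def blocks : {h : ℕ} → PLRUTree β h → List β
  | _, line b => b.toList
  | _, node _ l r => l.blocks ++ r.blocks

/-- Some line is empty. -/
def hasEmpty : {h : ℕ} → PLRUTree β h → Bool
  | _, line b => b.isNone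
  | _, node _ l r => l.hasEmpty || r.hasEmpty

/-- Adjust the tags away from the line that contains `a`. -/
def touch (a : β) : {h : ℕ} → PLRUTree β h → PLRUTree β h
  | _, line b => line b
  | _, node _ l r =>
    if a ∈ l.blocks then node true (l.touch a) r else node false l (r.touch a)

/-- Put `a` into the leftmost empty line and adjust the tags away from it. -/
def fill (a : β) : {h : ℕ} → PLRUTree β h → PLRUTree β h
  | _, line _ => line (some a)
  | _, node _ l r => if l.hasEmpty then node true (l.fill a) r else node false l (r.fill a)

/-- Put `a` into the line pointed at by the tags and adjust the tags away from it. -/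
def replace (a : β) : {h : ℕ} → PLRUTree β h → PLRUTree β h
  | _, line _ => line (some a)
  | _, node false l r => node true (l.replace a) r
  | _, node true l r => node false l (r.replace a)

/-- The tree with all lines empty. The initial tags are immaterial: by the time that all lines
are full, every tag has been adjusted. -/
def emptyTree (β : Type) : (h : ℕ) → PLRUTree β h
  | 0 => line none
  | h + 1 => node false (emptyTree β h) (emptyTree β h)

/-- Access to the block `a`. -/
def access {h : ℕ} (t : PLRUTree β h) (a : β) : PLRUTree β h :=
  if a ∈ t.blocks then t.touch a
  else if t.hasEmpty then t.fill a
  else t.replace a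

end PLRUTree

/-- The PLRU cache with `2 ^ h` ways. -/
def plruCache (β : Type) [DecidableEq β] (h : ℕ) : Cache β where
  State := PLRUTree β h
  empty := PLRUTree.emptyTree β h
  Legal t := t.blocks.Nodup
  access := PLRUTree.access
  contents t := {a | a ∈ t.blocks}

/-- Set the MRU-bit of the cached block `a` to `1`; if `N - 1` other MRU-bits are equal to `1`,
these are all set to `0`. -/
def nmruMark (N : ℕ) (w : List (β × Bool)) (a : β) : List (β × Bool) :=
  if w.countP (fun p => p.1 ≠ a ∧ p.2 = true) + 1 = N then
    w.map fun p => (p.1, decide (p.1 = a))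
  else
    w.map fun p => if p.1 = a then (a, true) else p

/-- The leftmost position with MRU-bit `0`. (A full cache without such a position occurs only for
`N = 1`; then its only line is meant.) -/
def nmruVictim (w : List (β × Bool)) : ℕ :=
  (w.findIdx? fun p => !p.2).getD 0

/-- Access to the block `a` in an `N`-way NMRU cache. The state is the sequence of the cached
blocks with their MRU-bits. -/
def nmruAccess (N : ℕ) (w : List (β × Bool)) (a : β) : List (β × Bool) :=
  if a ∈ w.map Prod.fst then nmruMark N w a
  else if w.length < N then nmruMark N (w ++ [(a, true)]) a
  else nmruMark N (w.set (nmruVictim w) (a, true)) a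

/-- The `N`-way NMRU (not most recently used) cache. -/
def nmruCache (β : Type) [DecidableEq β] (N : ℕ) : Cache β where
  State := List (β × Bool)
  empty := []
  Legal w := (w.map Prod.fst).Nodup ∧ w.length ≤ N ∧ (w.length = N → ∃ p ∈ w, p.2 = false)
  access := nmruAccess N
  contents w := {a | a ∈ w.map Prod.fst}

end Policies

/-- The replacement policies. Pseudo-RR is the only one for which the cache sets of a cache
interact; it is taken with any fixed number `sets` of cache sets. -/
inductive Policy
  | lru
  | fifo
  | pseudoRR (sets : ℕ)
  | plru
  | nmru

namespace Policy

/-- The number of cache sets. -/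
def sets : Policy → ℕ
  | pseudoRR k => k
  | _ => 1

/-- A memory block is given by the number of its cache set and its name. -/
abbrev Block (P : Policy) : Type := Fin P.sets × ℕ

/-- `N` is a possible associativity: it is positive, and a power of two for PLRU. -/
def Admissible : Policy → ℕ → Prop
  | plru, N => ∃ h, N = 2 ^ h
  | _, N => 1 ≤ N

/-- The cache with the given policy and associativity `N`. -/
def cache : (P : Policy) → (N : ℕ) → Cache P.Block
  | lru, N => lruCache _ N
  | fifo, N => fifoCache _ N
  | pseudoRR k, N => pseudoRRCache k N
  | plru, N => plruCache _ (Nat.log 2 N)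
  | nmru, N => nmruCache _ N

end Policy

/-! ### The exist-hit and exist-miss problems -/

/-- An edge of a control-flow graph on the nodes `0, …, n - 1`, with the block that it accesses
(`none` for an edge without memory access). -/
structure Edge (β : Type) (n : ℕ) where
  src : Fin n
  label : Option β
  dst : Fin n

/-- An input of the analysis problems: a control-flow graph (a directed multigraph) with edges
adorned with blocks, a starting node, a final node and a block. -/
structure Input (β : Type) where
  numNodes : ℕ
  edges : List (Edge β numNodes)
  start : Fin numNodes
  final : Fin numNodes
  target : β

namespace Input

variable {β : Type} (I : Input β)

/-- The size `|G| = |V| + |E|` of the control-flow graph. -/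
def size : ℕ := I.numNodes + I.edges.length

/-- `π` is a path from `p` to `q` in the control-flow graph. -/
def IsPath : List (Edge β I.numNodes) → Fin I.numNodes → Fin I.numNodes → Prop
  | [], p, q => p = q
  | e :: π, p, q => e ∈ I.edges ∧ e.src = p ∧ IsPath π e.dst q

end Input

/-- The effect of an edge on the cache state. -/
def Cache.step {β : Type} {n : ℕ} (c : Cache β) (σ : c.State) (e : Edge β n) : c.State :=
  match e.label with
  | none => σ
  | some b => c.access σ b

/-- The cache state after the execution of a path. -/
def Cache.run {β : Type} {n : ℕ} (c : Cache β) (σ : c.State) (π : List (Edge β n)) : c.State :=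
  π.foldl c.step σ

/-- The initial cache is empty, or its contents are arbitrary. -/
inductive InitialCache
  | empty
  | arbitrary

/-- The possible initial states. -/
def Cache.IsInitial {β : Type} (c : Cache β) : InitialCache → c.State → Prop
  | .empty, σ => σ = c.empty
  | .arbitrary, σ => c.Legal σ

/-- There is an execution from the starting node to the final node that ends with a cache
containing the target block. -/
def ExistHit {β : Type} (c : Cache β) (i : InitialCache) (I : Input β) : Prop :=
  ∃ σ, c.IsInitial i σ ∧ ∃ π, I.IsPath π I.start I.final ∧ I.target ∈ c.contents (c.run σ π)

/-- There is an execution from the starting node to the final node that ends with a cache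
not containing the target block. -/
def ExistMiss {β : Type} (c : Cache β) (i : InitialCache) (I : Input β) : Prop :=
  ∃ σ, c.IsInitial i σ ∧ ∃ π, I.IsPath π I.start I.final ∧ I.target ∉ c.contents (c.run σ π)

/-! ### Random access machines -/

/-- A state of a random access machine: registers and memory, both holding natural numbers. -/
structure RAM where
  reg : ℕ → ℕ
  mem : ℕ → ℕ

/-- Programs of a random access machine, in structured form. The arithmetic operations are
addition and truncated subtraction; a program names finitely many registers. -/
inductive Program
  | const (r c : ℕ)
  | copy (r s : ℕ)
  | add (r s t : ℕ)
  | sub (r s t : ℕ)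
  | load (r s : ℕ)
  | store (r s : ℕ)
  | seq (p q : Program)
  | ifPos (r : ℕ) (p q : Program)
  | whilePos (r : ℕ) (p : Program)

/-- Set a register. -/
def RAM.setReg (m : RAM) (r v : ℕ) : RAM := { m with reg := Function.update m.reg r v }

/-- Set a memory cell. -/
def RAM.setMem (m : RAM) (i v : ℕ) : RAM := { m with mem := Function.update m.mem i v }

/-- `p.Runs m t m'`: started in `m`, the program `p` halts in `m'` after `t` steps. Each elementary
instruction and each test of a register takes one step. -/
inductive Program.Runs : Program → RAM → ℕ → RAM → Prop
  | const (r c : ℕ) (m : RAM) : Runs (.const r c) m 1 (m.setReg r c)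
  | copy (r s : ℕ) (m : RAM) : Runs (.copy r s) m 1 (m.setReg r (m.reg s))
  | add (r s t : ℕ) (m : RAM) : Runs (.add r s t) m 1 (m.setReg r (m.reg s + m.reg t))
  | sub (r s t : ℕ) (m : RAM) : Runs (.sub r s t) m 1 (m.setReg r (m.reg s - m.reg t))
  | load (r s : ℕ) (m : RAM) : Runs (.load r s) m 1 (m.setReg r (m.mem (m.reg s)))
  | store (r s : ℕ) (m : RAM) : Runs (.store r s) m 1 (m.setMem (m.reg r) (m.reg s))
  | seq {p q : Program} {m₁ m₂ m₃ : RAM} {t₁ t₂ : ℕ} :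
      Runs p m₁ t₁ m₂ → Runs q m₂ t₂ m₃ → Runs (.seq p q) m₁ (t₁ + t₂) m₃
  | ifTrue {r : ℕ} {p q : Program} {m₁ m₂ : RAM} {t : ℕ} :
      0 < m₁.reg r → Runs p m₁ t m₂ → Runs (.ifPos r p q) m₁ (t + 1) m₂
  | ifFalse {r : ℕ} {p q : Program} {m₁ m₂ : RAM} {t : ℕ} :
      m₁.reg r = 0 → Runs q m₁ t m₂ → Runs (.ifPos r p q) m₁ (t + 1) m₂
  | whileStep {r : ℕ} {p : Program} {m₁ m₂ m₃ : RAM} {t₁ t₂ : ℕ} :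
      0 < m₁.reg r → Runs p m₁ t₁ m₂ → Runs (.whilePos r p) m₂ t₂ m₃ →
      Runs (.whilePos r p) m₁ (t₁ + t₂ + 1) m₃
  | whileDone {r : ℕ} {p : Program} {m : RAM} :
      m.reg r = 0 → Runs (.whilePos r p) m 1 m

/-- The five words that describe an edge: its source, its label (`0, 0, 0` for no access, and `1`
followed by the set number and the name of the block otherwise), and its target. -/
def Edge.words {k n : ℕ} (e : Edge (Fin k × ℕ) n) : List ℕ :=
  match e.label with
  | none => [e.src, 0, 0, 0, e.dst]
  | some b => [e.src, 1, b.1, b.2, e.dst]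

/-- The words that describe an input. -/
def Input.words {k : ℕ} (I : Input (Fin k × ℕ)) : List ℕ :=
  [I.numNodes, I.edges.length, I.start, I.final, I.target.1, I.target.2] ++
    I.edges.flatMap Edge.words

/-- The machine at the start of a computation: the input stands at the beginning of the memory,
all other memory cells and all registers are zero. -/
def RAM.init {k : ℕ} (I : Input (Fin k × ℕ)) : RAM where
  reg _ := 0
  mem i := I.words.getD i 0

open Classical in
/-- The program decides `Q` on all inputs, leaving the answer (`1` for yes, `0` for no) in
register `0`, within the number of steps that `T` allows. -/
def Program.DecidesWithin {k : ℕ} (p : Program) (Q : Input (Fin k × ℕ) → Prop)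
    (T : Input (Fin k × ℕ) → ℕ) : Prop :=
  ∀ I, ∃ t m, p.Runs (RAM.init I) t m ∧ t ≤ T I ∧ m.reg 0 = if Q I then 1 else 0

end CacheAnalysis

namespace CacheAnalysis

/-! ### Running programs -/

/-! A replacement policy never looks at a name itself; it only tests whether the accessed name
equals a cached one. A state of a cache with n = kN lines is therefore a pattern (a state over the
names `Fin n`, of which there are finitely many) together with the n names in its slots. Such a
cache is simulated by a register automaton with n registers (`SymCache.rep_step`), whose finite
transition table can be built into the program.

Names can be replaced with small numbers: the target and the names on edges get identifiers in 1, …,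
|E| + 1, every other name gets 0. This renaming is not injective, but no path accesses a name with
identifier 0, and an access commutes with every renaming that keeps the accessed name apart from the
other names present (`SymCache.access_map`). Hence the presence of the target is preserved along
every path (`SymCache.map_foldl`, `SymCache.solves_iff`). For arbitrary initial contents the
registers start with any tuple whose nonzero entries are distinct, because such a tuple comes from
distinct names (`exists_names`).

What remains is reachability among configurations (location, control state, registers). Locations
are the nodes and the edges, and the edges leaving a node are chained into a list, so a
configuration has at most two successors: move on in the list, or take the current edge. The
reachable configurations lie in a box with O(|G|) · O(1) · (|E| + 2)^n elements (`reach_bound`);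
each is pushed at most once and processed in constant time (`Program.main_loop_spec`).

Visited configurations are marked in an array indexed by their base-W numerals. The machine cannot
multiply, so the products needed for the index are read from tables (`Program.address_spec`). The
array has of the order of |G|^(n + 2) cells, too many to be cleared in time; the argument uses that
memory is initially zero. Preprocessing takes time quadratic in |G|, which fits into |G|^(n + 1)
because n ≥ 1. -/

@[simp] theorem RAM.setReg_reg (m : RAM) (r v s : ℕ) :
    (m.setReg r v).reg s = if s = r then v else m.reg s := by
  simp [RAM.setReg, Function.update_apply]

@[simp] theorem RAM.setReg_mem (m : RAM) (r v : ℕ) : (m.setReg r v).mem = m.mem := rfl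

@[simp] theorem RAM.setMem_reg (m : RAM) (i v : ℕ) : (m.setMem i v).reg = m.reg := rfl

@[simp] theorem RAM.setMem_mem (m : RAM) (i v j : ℕ) :
    (m.setMem i v).mem j = if j = i then v else m.mem j := by
  simp [RAM.setMem, Function.update_apply]

namespace Program

/-- Started in `m`, the program halts within `T` steps in a state with the property `Q`. -/
def Halts (p : Program) (m : RAM) (T : ℕ) (Q : RAM → Prop) : Prop :=
  ∃ t m', p.Runs m t m' ∧ t ≤ T ∧ Q m'

variable {p q : Program} {m : RAM} {T T' : ℕ} {Q R : RAM → Prop} {r : ℕ}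

theorem Halts.mono (h : p.Halts m T Q) (hT : T ≤ T') (hQ : ∀ m, Q m → R m) :
    p.Halts m T' R := by
  obtain ⟨t, m', h, ht, hq⟩ := h
  exact ⟨t, m', h, ht.trans hT, hQ _ hq⟩

theorem Halts.seq (h : p.Halts m T Q) (h' : ∀ m', Q m' → q.Halts m' T' R) :
    (p.seq q).Halts m (T + T') R := by
  obtain ⟨t, m', h, ht, hq⟩ := h
  obtain ⟨t', m'', h', ht', hr⟩ := h' m' hq
  exact ⟨_, _, .seq h h', by omega, hr⟩

/-- The rule for loops, with an amortized time bound: every iteration is paid for by the decrease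
of a potential. -/
theorem Halts.whilePos {G : Type*} (Inv : G → RAM → Prop) (pot : G → ℕ)
    (body : ∀ g m, Inv g m → 0 < m.reg r →
      ∃ T, p.Halts m T fun m' => ∃ g', Inv g' m' ∧ pot g' + T + 1 ≤ pot g)
    {g : G} (h : Inv g m) :
    (Program.whilePos r p).Halts m (pot g + 1) fun m' => m'.reg r = 0 ∧ ∃ g', Inv g' m' := by
  induction hn : pot g using Nat.strong_induction_on generalizing g m with
  | _ n ih =>
    rcases Nat.eq_zero_or_pos (m.reg r) with h0 | h0
    · exact ⟨1, m, .whileDone h0, by omega, h0, g, h⟩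
    · obtain ⟨T, t, m', hr, ht, g', hg', hp⟩ := body g m h h0
      obtain ⟨t', m'', hr', ht', hq⟩ := ih (pot g') (by omega) hg' rfl
      exact ⟨_, m'', .whileStep h0 hr hr', by omega, hq⟩

/-- The rule for loops that count down. -/
theorem Halts.countdown (Inv : ℕ → RAM → Prop) (T : ℕ) (hreg : ∀ j m, Inv j m → m.reg r = j)
    (body : ∀ j m, Inv (j + 1) m → p.Halts m T (Inv j)) {j : ℕ} (h : Inv j m) :
    (Program.whilePos r p).Halts m (j * (T + 1) + 1) (Inv 0) := by
  refine (Halts.whilePos (r := r) Inv (fun j => j * (T + 1)) ?_ h).mono le_rfl ?_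
  · intro j m h h0
    rw [hreg j m h] at h0
    obtain ⟨j, rfl⟩ := Nat.exists_eq_succ_of_ne_zero h0.ne'
    exact ⟨T, (body j m h).mono le_rfl fun m' h' => ⟨j, h', by simp only [Nat.succ_mul]; omega⟩⟩
  · rintro m' ⟨h0, j, hj⟩
    rw [hreg j m' hj] at h0
    exact h0 ▸ hj

/-- A program without loops. -/
def LoopFree : Program → Prop
  | .seq p q => p.LoopFree ∧ q.LoopFree
  | .ifPos _ p q => p.LoopFree ∧ q.LoopFree
  | .whilePos _ _ => False
  | _ => True

/-- The effect of a program without loops. -/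
def eval : Program → RAM → RAM
  | .const r c, m => m.setReg r c
  | .copy r s, m => m.setReg r (m.reg s)
  | .add r s t, m => m.setReg r (m.reg s + m.reg t)
  | .sub r s t, m => m.setReg r (m.reg s - m.reg t)
  | .load r s, m => m.setReg r (m.mem (m.reg s))
  | .store r s, m => m.setMem (m.reg r) (m.reg s)
  | .seq p q, m => q.eval (p.eval m)
  | .ifPos r p q, m => if 0 < m.reg r then p.eval m else q.eval m
  | .whilePos _ _, m => m

/-- A bound on the running time of a program without loops. -/
def cost : Program → ℕ
  | .seq p q => p.cost + q.cost
  | .ifPos _ p q => p.cost + q.cost + 1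
  | _ => 1

/-- Only one arm of a branch is executed but `cost` charges for both, so the bound does not depend
on the machine state. This is what makes a loop-free loop body a constant-time step. -/
theorem LoopFree.halts {p : Program} (h : p.LoopFree) (m : RAM) :
    p.Halts m p.cost (· = p.eval m) := by
  induction p generalizing m with
  | const r c => exact ⟨1, _, .const r c m, le_rfl, rfl⟩
  | copy r s => exact ⟨1, _, .copy r s m, le_rfl, rfl⟩
  | add r s t => exact ⟨1, _, .add r s t m, le_rfl, rfl⟩
  | sub r s t => exact ⟨1, _, .sub r s t m, le_rfl, rfl⟩
  | load r s => exact ⟨1, _, .load r s m, le_rfl, rfl⟩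
  | store r s => exact ⟨1, _, .store r s m, le_rfl, rfl⟩
  | seq p q ihp ihq =>
    exact Halts.seq (ihp h.1 m) fun m' hm' => hm' ▸ ihq h.2 _
  | ifPos r p q ihp ihq =>
    rcases Nat.eq_zero_or_pos (m.reg r) with h0 | h0
    · obtain ⟨t, m', hr, ht, rfl⟩ := ihq h.2 m
      exact ⟨_, _, .ifFalse h0 hr, by simp only [cost]; omega, by simp [eval, h0]⟩
    · obtain ⟨t, m', hr, ht, rfl⟩ := ihp h.1 m
      exact ⟨_, _, .ifTrue h0 hr, by simp only [cost]; omega, by simp [eval, h0]⟩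
  | whilePos r p => exact h.elim

theorem LoopFree.halts_of {p : Program} (h : p.LoopFree) (hQ : Q (p.eval m)) :
    p.Halts m p.cost Q :=
  (h.halts m).mono le_rfl fun _ h' => h' ▸ hQ

/-- The program without effect. -/
def skip : Program := .copy 0 0

@[simp] theorem skip_loopFree : skip.LoopFree := trivial

@[simp] theorem eval_skip (m : RAM) : skip.eval m = m := by
  simp [skip, eval, RAM.setReg]

/-- Sequential composition of a list of programs. -/
def seqs : List Program → Program
  | [] => skip
  | [p] => p
  | p :: q :: l => .seq p (seqs (q :: l))

theorem seqs_loopFree {l : List Program} (h : ∀ p ∈ l, p.LoopFree) : (seqs l).LoopFree := by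
  induction l using seqs.induct with
  | case1 => trivial
  | case2 p => exact h p (by simp)
  | case3 p q l ih => exact ⟨h p (by simp), ih fun p hp => h p (by simp_all)⟩

theorem eval_seqs (l : List Program) (m : RAM) :
    (seqs l).eval m = l.foldl (fun m p => p.eval m) m := by
  induction l using seqs.induct generalizing m with
  | case1 => simp [seqs]
  | case2 p => simp [seqs]
  | case3 p q l ih => simp [seqs, eval, ih]

/-- Execute `f 0, …, f (d - 1)`. -/
def upTo (f : ℕ → Program) : ℕ → Program
  | 0 => skip
  | d + 1 => .seq (upTo f d) (f d)

theorem upTo_loopFree {f : ℕ → Program} {d : ℕ} (h : ∀ i < d, (f i).LoopFree) :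
    (upTo f d).LoopFree := by
  induction d with
  | zero => trivial
  | succ d ih => exact ⟨ih fun i hi => h i (by omega), h d (by omega)⟩

/-- The number of repetitions is fixed by the program text, not by the input. Such a loop is
unrolled and remains loop-free, and an invariant indexed by the number of completed rounds describes
its effect. -/
theorem eval_upTo_induct {f : ℕ → Program} {d : ℕ} (Inv : ℕ → RAM → Prop) (h0 : Inv 0 m)
    (hs : ∀ i < d, ∀ m, Inv i m → Inv (i + 1) ((f i).eval m)) : Inv d ((upTo f d).eval m) := by
  induction d with
  | zero => simpa [upTo] using h0
  | succ d ih => exact hs d (by omega) _ (ih fun i hi => hs i (by omega))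

theorem Halts.upTo {f : ℕ → Program} {d : ℕ} (Inv : ℕ → RAM → Prop) (T : ℕ) (h0 : Inv 0 m)
    (hs : ∀ i < d, ∀ m, Inv i m → (f i).Halts m T (Inv (i + 1))) :
    (upTo f d).Halts m (d * T + 1) (Inv d) := by
  induction d with
  | zero =>
    rw [Nat.zero_mul, zero_add]
    exact skip_loopFree.halts_of (by simpa using h0)
  | succ d ih =>
    exact (Halts.seq (ih fun i hi => hs i (by omega)) (hs d (by omega))).mono
      (by rw [Nat.succ_mul]; omega) fun _ h => h

/-- Execute the program whose position in the list is the contents of the register `r`. The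
register `1` has to contain `1`. -/
def switch (r : ℕ) : List Program → Program
  | [] => skip
  | p :: l => .ifPos r (.seq (.sub r r 1) (switch r l)) p

theorem switch_loopFree {l : List Program} (h : ∀ p ∈ l, p.LoopFree) : (switch r l).LoopFree := by
  induction l with
  | nil => trivial
  | cons p l ih => exact ⟨⟨trivial, ih fun p hp => h p (by simp_all)⟩, h p (by simp)⟩

/-- The register is counted down while the list is traversed, so the selected program starts with
this register equal to `0`. -/
theorem eval_switch {l : List Program} (hr : r ≠ 1) (h1 : m.reg 1 = 1) (hl : m.reg r < l.length) :
    (switch r l).eval m = (l[m.reg r]).eval (m.setReg r 0) := by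
  induction l generalizing m with
  | nil => simp at hl
  | cons p l ih =>
    rcases Nat.eq_zero_or_pos (m.reg r) with h0 | h0
    · have : m.setReg r 0 = m := by
        rw [← h0]; simp [RAM.setReg]
      simp [switch, eval, h0, this]
    · have h2 : (m.setReg r (m.reg r - 1)).reg r = m.reg r - 1 := by simp
      simp only [List.length_cons] at hl
      simp only [switch, eval, h0, if_true, h1]
      rw [ih (by simp [hr.symm, h1]) (by simp; omega)]
      have h3 : (m.setReg r (m.reg r - 1)).setReg r 0 = m.setReg r 0 := by
        simp [RAM.setReg]
      rw [h3]
      congr 1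
      simp only [h2]
      rw [List.getElem_cons]
      simp [h0.ne']

end Program

/-! ### Register automata -/

/-- An automaton with finitely many control states and `n` registers that hold names. An access
to a name `a` in the set `s` compares `a` with all registers; depending on the control state, on
`s` and on the outcome, it changes the control state and fills each register with the contents of
an old register or with `a` (`none`). -/
structure RegAut (n : ℕ) where
  size : ℕ
  next : ℕ → ℕ → (ℕ → Bool) → ℕ
  source : ℕ → ℕ → (ℕ → Bool) → Fin n → Option (Fin n)
  accept : ℕ → ℕ → (ℕ → Bool) → Bool
  init : List ℕ
  next_lt : ∀ q s P, next q s P < size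
  init_lt : ∀ q ∈ init, q < size

/-- The registers that contain `a`. -/
def pattern {n : ℕ} (x : Fin n → ℕ) (a : ℕ) (j : ℕ) : Bool :=
  if h : j < n then decide (x ⟨j, h⟩ = a) else false

/-- The contents of the registers after an access. -/
def RegAut.move {n : ℕ} (A : RegAut n) (q s a : ℕ) (x : Fin n → ℕ) (i : Fin n) : ℕ :=
  (A.source q s (pattern x a) i).elim a x

/-- A configuration of the search: a location of the control-flow graph, a control state, and the
contents of the registers of the automaton. -/
abbrev Cfg (n : ℕ) : Type := Fin (n + 2) → ℕ

/-- The code of a configuration with respect to the radix `W`. -/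
def Cfg.code {n : ℕ} (W : ℕ) (c : Cfg n) : ℕ := ∑ i : Fin (n + 2), c i * W ^ (i : ℕ)

/-- The code is a base-`W` numeral with the components as digits. Its range and its injectivity are
those of `finFunctionFinEquiv`. -/
theorem Cfg.code_eq {n W : ℕ} {c : Cfg n} (h : ∀ i, c i < W) :
    c.code W = (finFunctionFinEquiv (m := W) (n := n + 2) fun i => ⟨c i, h i⟩ : Fin _) := by
  simp [Cfg.code]

theorem Cfg.code_lt {n W : ℕ} {c : Cfg n} (h : ∀ i, c i < W) : c.code W < W ^ (n + 2) := by
  rw [Cfg.code_eq h]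
  exact Fin.is_lt _

theorem Cfg.code_injective {n W : ℕ} {c d : Cfg n} (hc : ∀ i, c i < W) (hd : ∀ i, d i < W)
    (h : c.code W = d.code W) : c = d := by
  rw [Cfg.code_eq hc, Cfg.code_eq hd] at h
  have := finFunctionFinEquiv.injective (Fin.ext h)
  funext i
  simpa using congrFun this i

/-- The static data of the search: the base address `B` of the cells of the nodes, their end `H`,
the radix `W` of the codes, the memory contents `μ` (adjacency lists and multiplication tables),
the cache set of the target block and the location of the final node. -/
structure Arena where
  B : ℕ
  H : ℕ
  W : ℕ
  μ : ℕ → ℕ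
  tset : ℕ
  floc : ℕ

/-! ### Memory layout of the search: tables, marks, stack. -/

namespace Arena

/-- The base address of the marks of the visited configurations. -/
def visBase (L : Arena) (n : ℕ) : ℕ := L.H + (n + 2) * L.W

/-- The base address of the stack. -/
def stackBase (L : Arena) (n : ℕ) : ℕ := L.visBase n + L.W ^ (n + 2)

/-- The memory contains the given stack, whose free end is at the address `sp`. -/
def StackAt {n : ℕ} (L : Arena) (mem : ℕ → ℕ) : List (Cfg n) → ℕ → Prop
  | [], sp => sp = L.stackBase n
  | c :: s, sp => ∃ sp', sp = sp' + (n + 2) ∧ (∀ i : Fin (n + 2), mem (sp' + i) = c i) ∧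
      L.StackAt mem s sp'

theorem StackAt.le {n : ℕ} {L : Arena} {mem : ℕ → ℕ} {s : List (Cfg n)} {sp : ℕ}
    (h : L.StackAt mem s sp) : L.stackBase n ≤ sp := by
  induction s generalizing sp with
  | nil => exact h.ge
  | cons c s ih =>
    obtain ⟨sp', rfl, -, h⟩ := h
    exact (ih h).trans (by omega)

/-- The stack occupies exactly the cells from its base up to `sp`. Setting a mark happens below them
and pushing above them. -/
theorem StackAt.congr {n : ℕ} {L : Arena} {mem mem' : ℕ → ℕ} {s : List (Cfg n)} {sp : ℕ}
    (h : L.StackAt mem s sp) (hm : ∀ a, L.stackBase n ≤ a → a < sp → mem' a = mem a) :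
    L.StackAt mem' s sp := by
  induction s generalizing sp with
  | nil => exact h
  | cons c s ih =>
    obtain ⟨sp', rfl, h1, h⟩ := h
    have := h.le
    exact ⟨sp', rfl, fun i => by rw [hm _ (by omega) (by omega), h1],
      ih h fun a h1 h2 => hm a h1 (by omega)⟩

/-- The state of the search is represented by the machine state `m`: the configurations `vis`
have been visited, those on the stack are still to be processed. -/
structure Holds {n : ℕ} (L : Arena) (vis : Finset (Cfg n)) (stack : List (Cfg n)) (m : RAM) :
    Prop where
  one : m.reg 1 = 1
  base : m.reg 2 = L.B
  bound : m.reg 3 = L.H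
  radix : m.reg 4 = L.W
  visBase : m.reg 5 = L.visBase n
  stackAt : L.StackAt m.mem stack (m.reg 6)
  length : m.reg 7 = stack.length
  tset : m.reg 8 = L.tset
  floc : m.reg 9 = L.floc
  static : ∀ a < L.visBase n, m.mem a = L.μ a
  marks : ∀ c : Cfg n, (∀ i, c i < L.W) →
    m.mem (L.visBase n + c.code L.W) = if c ∈ vis then 1 else 0

/-- Registers `0` and those from `10` on do not take part in the representation: `0` is the answer,
the others serve as scratch space and for configurations. -/
theorem Holds.congr {n : ℕ} {L : Arena} {vis : Finset (Cfg n)} {stack : List (Cfg n)} {m m' : RAM}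
    (h : L.Holds vis stack m) (hm : m'.mem = m.mem)
    (hr : ∀ r, 1 ≤ r → r ≤ 9 → m'.reg r = m.reg r) : L.Holds vis stack m' where
  one := by rw [hr _ (by omega) (by omega), h.one]
  base := by rw [hr _ (by omega) (by omega), h.base]
  bound := by rw [hr _ (by omega) (by omega), h.bound]
  radix := by rw [hr _ (by omega) (by omega), h.radix]
  visBase := by rw [hr _ (by omega) (by omega), h.visBase]
  stackAt := by rw [hr _ (by omega) (by omega), hm]; exact h.stackAt
  length := by rw [hr _ (by omega) (by omega), h.length]
  tset := by rw [hr _ (by omega) (by omega), h.tset]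
  floc := by rw [hr _ (by omega) (by omega), h.floc]
  static := by rw [hm]; exact h.static
  marks := by rw [hm]; exact h.marks

/-- The multiplication tables. -/
def Tables (L : Arena) (n : ℕ) : Prop :=
  ∀ i < n + 2, ∀ v < L.W, L.μ (L.H + i * L.W + v) = v * L.W ^ i

end Arena

/-- Two machine states that differ at most in the registers `10`, `11`, `12`. -/
structure RAM.Similar (m m' : RAM) : Prop where
  mem : m'.mem = m.mem
  reg : ∀ r, r ≠ 10 → r ≠ 11 → r ≠ 12 → m'.reg r = m.reg r

/-! ### Subroutines: marks, stack operations, branching on the pattern. -/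

namespace Program

/-- Compute into register `10` the address of the mark of the configuration in the registers
`22 + n, …, 23 + 2 * n`. -/
def address (n : ℕ) : Program :=
  seqs [.copy 10 5, .copy 11 3,
    upTo (fun i => seqs [.add 12 11 (22 + n + i), .load 12 12, .add 10 10 12, .add 11 11 4])
      (n + 2)]

/-- Each product of a digit and a power of `W` is one lookup in the multiplication tables. Register
`11` runs through the base addresses of the tables, which are `W` apart. -/
theorem address_spec {n : ℕ} {L : Arena} {vis : Finset (Cfg n)} {stack : List (Cfg n)} {m : RAM}
    {c : Cfg n} (h : L.Holds vis stack m) (hT : L.Tables n)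
    (hc : ∀ i : Fin (n + 2), m.reg (22 + n + i) = c i) (hW : ∀ i, c i < L.W) :
    ((address n).eval m).reg 10 = L.visBase n + c.code L.W ∧ m.Similar ((address n).eval m) := by
  have key := eval_upTo_induct
    (f := fun i => seqs [.add 12 11 (22 + n + i), .load 12 12, .add 10 10 12, .add 11 11 4])
    (m := (m.setReg 10 (m.reg 5)).setReg 11 (m.reg 3)) (d := n + 2)
    (fun j m' => m'.reg 10 = L.visBase n + ∑ i ∈ Finset.range j, m.reg (22 + n + i) * L.W ^ i ∧
      m'.reg 11 = L.H + j * L.W ∧ m.Similar m')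
    (by
      refine ⟨by simp [h.visBase], by simp [h.bound], rfl, ?_⟩
      intro r h1 h2 h3
      simp [h1, h2])
    (by
      rintro i hi m' ⟨h1, h2, h3⟩
      have h4 : m'.reg (22 + n + i) = m.reg (22 + n + i) :=
        h3.reg _ (by omega) (by omega) (by omega)
      have h5 := hT i hi (m.reg (22 + n + i)) (by rw [hc ⟨i, hi⟩]; exact hW _)
      have h6 : i * L.W + L.W ≤ (n + 2) * L.W := by
        rw [← Nat.succ_mul]; exact Nat.mul_le_mul_right _ (by omega)
      have h7 : m.reg (22 + n + i) < L.W := by rw [hc ⟨i, hi⟩]; exact hW _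
      have h8 := h.static (L.H + i * L.W + m.reg (22 + n + i)) (by
        simp only [Arena.visBase]; omega)
      have h9 := h3.reg 4 (by omega) (by omega) (by omega)
      rw [h.radix] at h9
      refine ⟨?_, ?_, ?_, ?_⟩
      · simp [eval_seqs, eval, h1, h2, h3.mem, h4, h8, h5, Finset.sum_range_succ, ← add_assoc]
      · simp [eval_seqs, eval, h2, h9, Nat.succ_mul, add_assoc]
      · simp [eval_seqs, eval, h3.mem]
      · intro r r1 r2 r3
        simp [eval_seqs, eval, r1, r2, r3, h3.reg r r1 r2 r3])
  have he : (address n).eval m = (upTo (fun i => seqs [.add 12 11 (22 + n + i), .load 12 12,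
      .add 10 10 12, .add 11 11 4]) (n + 2)).eval ((m.setReg 10 (m.reg 5)).setReg 11 (m.reg 3)) := by
    simp [address, eval_seqs, eval]
  rw [he]
  refine ⟨?_, key.2.2⟩
  rw [key.1, Cfg.code, Finset.sum_range]
  simp [hc]

/-- Push the configuration in the registers `22 + n, …, 23 + 2 * n`. -/
def push (n : ℕ) : Program :=
  seqs [.copy 11 6, upTo (fun i => seqs [.store 11 (22 + n + i), .add 11 11 1]) (n + 2),
    .copy 6 11, .add 7 7 1]

theorem push_spec {n : ℕ} {m : RAM} (h1 : m.reg 1 = 1) :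
    ((push n).eval m).reg 6 = m.reg 6 + (n + 2) ∧ ((push n).eval m).reg 7 = m.reg 7 + 1 ∧
    (∀ i < n + 2, ((push n).eval m).mem (m.reg 6 + i) = m.reg (22 + n + i)) ∧
    (∀ a < m.reg 6, ((push n).eval m).mem a = m.mem a) ∧
    ∀ r, r ≠ 6 → r ≠ 7 → r ≠ 11 → ((push n).eval m).reg r = m.reg r := by
  have key := eval_upTo_induct
    (f := fun i => seqs [.store 11 (22 + n + i), .add 11 11 1])
    (m := m.setReg 11 (m.reg 6)) (d := n + 2)
    (fun j m' => m'.reg 11 = m.reg 6 + j ∧ (∀ i < j, m'.mem (m.reg 6 + i) = m.reg (22 + n + i)) ∧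
      (∀ a < m.reg 6, m'.mem a = m.mem a) ∧ ∀ r, r ≠ 11 → m'.reg r = m.reg r)
    (by
      refine ⟨by simp, by simp, by simp, ?_⟩
      intro r hr
      simp [hr])
    (by
      rintro i hi m' ⟨h2, h3, h4, h5⟩
      have h6 := h5 1 (by omega)
      rw [h1] at h6
      refine ⟨?_, ?_, ?_, ?_⟩
      · simp [eval_seqs, eval, h2, h6, add_assoc]
      · intro j hj
        simp only [eval_seqs, eval, List.foldl, RAM.setReg_mem, RAM.setMem_mem, h2]
        rcases eq_or_ne j i with rfl | hne
        · simp [h5 (22 + n + j) (by omega)]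
        · rw [if_neg (by omega), h3 j (by omega)]
      · intro a ha
        simp only [eval_seqs, eval, List.foldl, RAM.setReg_mem, RAM.setMem_mem, h2]
        rw [if_neg (by omega), h4 a ha]
      · intro r hr
        simp [eval_seqs, eval, hr, h5 r hr])
  have he : (push n).eval m = (seqs [.copy 6 11, .add 7 7 1]).eval
      ((upTo (fun i => seqs [.store 11 (22 + n + i), .add 11 11 1]) (n + 2)).eval
        (m.setReg 11 (m.reg 6))) := by
    simp [push, eval_seqs, eval]
  rw [he]
  obtain ⟨h2, h3, h4, h5⟩ := key
  refine ⟨?_, ?_, ?_, ?_, ?_⟩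
  · simp [eval_seqs, eval, h2]
  · simp [eval_seqs, eval, h5, h1]
  · intro i hi
    simp [eval_seqs, eval, h3 i hi]
  · intro a ha
    simp [eval_seqs, eval, h4 a ha]
  · intro r h6 h7 h8
    simp [eval_seqs, eval, h6, h7, h5 r h8]

/-- Visit the configuration in the registers `22 + n, …, 23 + 2 * n`: unless it is marked, mark
and push it. -/
def visit (n : ℕ) : Program :=
  seqs [address n, .load 12 10, .ifPos 12 skip (.seq (.store 10 1) (push n))]

theorem address_loopFree (n : ℕ) : (address n).LoopFree :=
  ⟨trivial, trivial, upTo_loopFree fun _ _ => ⟨trivial, trivial, trivial, trivial⟩⟩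

theorem push_loopFree (n : ℕ) : (push n).LoopFree :=
  ⟨trivial, upTo_loopFree fun _ _ => ⟨trivial, trivial⟩, trivial, trivial⟩

theorem visit_loopFree (n : ℕ) : (visit n).LoopFree :=
  ⟨address_loopFree n, trivial, trivial, trivial, push_loopFree n⟩

/-- The effect of a visit on the state of the search. -/
def _root_.CacheAnalysis.Cfg.visit {n : ℕ} (g : Finset (Cfg n) × List (Cfg n)) (c : Cfg n) :
    Finset (Cfg n) × List (Cfg n) :=
  if c ∈ g.1 then g else (insert c g.1, c :: g.2)

/-- A new mark hits no other mark, since codes are injective on configurations with components below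
`W`. It lies below the stack and above the static data, so neither of them changes. -/
theorem visit_spec {n : ℕ} {L : Arena} {g : Finset (Cfg n) × List (Cfg n)} {m : RAM} {c : Cfg n}
    (h : L.Holds g.1 g.2 m) (hT : L.Tables n)
    (hc : ∀ i : Fin (n + 2), m.reg (22 + n + i) = c i) (hW : ∀ i, c i < L.W) :
    L.Holds (c.visit g).1 (c.visit g).2 ((visit n).eval m) ∧
    ((visit n).eval m).reg 0 = m.reg 0 ∧
    ∀ r, 13 ≤ r → ((visit n).eval m).reg r = m.reg r := by
  obtain ⟨ha, hs⟩ := address_spec h hT hc hW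
  set m₁ := (address n).eval m with hm₁
  have h₁ : L.Holds g.1 g.2 m₁ := h.congr hs.mem fun r _ _ =>
    hs.reg r (by omega) (by omega) (by omega)
  have hmark := h₁.marks c hW
  have he : (visit n).eval m = if 0 < m₁.mem (m₁.reg 10) then m₁.setReg 12 (m₁.mem (m₁.reg 10))
      else (push n).eval ((m₁.setReg 12 (m₁.mem (m₁.reg 10))).setMem (m₁.reg 10) (m₁.reg 1)) := by
    simp [visit, eval_seqs, eval, ← hm₁]
  rw [ha, hmark] at he
  by_cases hv : c ∈ g.1
  · simp only [hv, if_true, zero_lt_one] at he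
    rw [he, Cfg.visit, if_pos hv]
    refine ⟨h₁.congr rfl fun r _ _ => by simp; omega, ?_, ?_⟩
    · simp [hs.reg 0]
    · intro r hr
      rw [RAM.setReg_reg, if_neg (by omega)]
      exact hs.reg r (by omega) (by omega) (by omega)
  · simp only [hv, if_false, lt_irrefl] at he
    rw [he, Cfg.visit, if_neg hv]
    set m₂ := (m₁.setReg 12 0).setMem (L.visBase n + c.code L.W) (m₁.reg 1) with hm₂
    have r₂ : ∀ r, r ≠ 12 → m₂.reg r = m₁.reg r := fun r hr => by simp [hm₂, hr]
    obtain ⟨p1, p2, p3, p4, p5⟩ := push_spec (n := n) (m := m₂) (by simp [hm₂, h₁.one])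
    rw [r₂ 6 (by omega)] at p1 p3 p4
    rw [r₂ 7 (by omega)] at p2
    have hsp := h₁.stackAt.le
    have hcode := Cfg.code_lt hW
    have hsb : L.stackBase n = L.visBase n + L.W ^ (n + 2) := rfl
    refine ⟨⟨?_, ?_, ?_, ?_, ?_, ?_, ?_, ?_, ?_, ?_, ?_⟩, ?_, ?_⟩
    · rw [p5 _ (by omega) (by omega) (by omega), r₂ _ (by omega), h₁.one]
    · rw [p5 _ (by omega) (by omega) (by omega), r₂ _ (by omega), h₁.base]
    · rw [p5 _ (by omega) (by omega) (by omega), r₂ _ (by omega), h₁.bound]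
    · rw [p5 _ (by omega) (by omega) (by omega), r₂ _ (by omega), h₁.radix]
    · rw [p5 _ (by omega) (by omega) (by omega), r₂ _ (by omega), h₁.visBase]
    · rw [p1]
      refine ⟨m₁.reg 6, rfl, fun i => ?_, h₁.stackAt.congr fun a a1 a2 => ?_⟩
      · rw [p3 i i.2, r₂ _ (by omega), hs.reg _ (by omega) (by omega) (by omega), hc]
      · rw [p4 a a2, hm₂, RAM.setMem_mem, if_neg (by omega), RAM.setReg_mem]
    · rw [p2, h₁.length, List.length_cons]
    · rw [p5 _ (by omega) (by omega) (by omega), r₂ _ (by omega), h₁.tset]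
    · rw [p5 _ (by omega) (by omega) (by omega), r₂ _ (by omega), h₁.floc]
    · intro a ha
      rw [p4 a (by omega), hm₂, RAM.setMem_mem, if_neg (by omega), RAM.setReg_mem, h₁.static a ha]
    · intro d hd
      have hdc := Cfg.code_lt hd
      rw [p4 _ (by omega), hm₂, RAM.setMem_mem, RAM.setReg_mem, h₁.marks d hd, h₁.one]
      rcases eq_or_ne d c with rfl | hne
      · simp
      · rw [if_neg fun h => hne (Cfg.code_injective hd hW (by omega))]
        simp [hne]
    · rw [p5 _ (by omega) (by omega) (by omega), r₂ _ (by omega),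
        hs.reg _ (by omega) (by omega) (by omega)]
    · intro r hr
      rw [p5 _ (by omega) (by omega) (by omega), r₂ _ (by omega),
        hs.reg _ (by omega) (by omega) (by omega)]

/-- Pop a configuration into the registers `20, …, 21 + n`. -/
def pop (n : ℕ) : Program :=
  seqs [.sub 7 7 1, .const 11 (n + 2), .sub 6 6 11, .copy 11 6,
    upTo (fun i => seqs [.load (20 + i) 11, .add 11 11 1]) (n + 2)]

theorem pop_loopFree (n : ℕ) : (pop n).LoopFree :=
  ⟨trivial, trivial, trivial, trivial, upTo_loopFree fun _ _ => ⟨trivial, trivial⟩⟩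

theorem pop_spec {n : ℕ} {L : Arena} {vis : Finset (Cfg n)} {stack : List (Cfg n)} {m : RAM}
    {c : Cfg n} (h : L.Holds vis (c :: stack) m) :
    L.Holds vis stack ((pop n).eval m) ∧ ((pop n).eval m).reg 0 = m.reg 0 ∧
    ∀ i : Fin (n + 2), ((pop n).eval m).reg (20 + i) = c i := by
  obtain ⟨sp, hsp, hc, hst⟩ := h.stackAt
  have h1 := h.one
  have h7 := h.length
  set m₁ := (((m.setReg 7 (m.reg 7 - 1)).setReg 11 (n + 2)).setReg 6
    (m.reg 6 - (n + 2))).setReg 11 (m.reg 6 - (n + 2)) with hm₁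
  have key := eval_upTo_induct (f := fun i => seqs [.load (20 + i) 11, .add 11 11 1])
    (m := m₁) (d := n + 2)
    (fun j m' => m'.reg 11 = sp + j ∧ m'.mem = m.mem ∧
      (∀ r, r < 20 → r ≠ 11 → m'.reg r = m₁.reg r) ∧
      ∀ i : Fin (n + 2), i < j → m'.reg (20 + i) = c i)
    (by
      refine ⟨?_, rfl, fun _ _ _ => rfl, by simp⟩
      simp [hm₁, hsp])
    (by
      rintro i hi m' ⟨g1, g2, g3, g4⟩
      have g5 : m'.reg 1 = 1 := by rw [g3 1 (by omega) (by omega)]; simp [hm₁, h1]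
      refine ⟨?_, ?_, ?_, ?_⟩
      · simp [eval_seqs, eval, g1, g5]
        rw [if_neg (by omega), if_neg (by omega)]
        omega
      · simp [eval_seqs, eval, g2]
      · intro r r1 r2
        simp [eval_seqs, eval, r2]
        rw [if_neg (by omega), g3 r r1 r2]
      · intro j hj
        simp only [eval_seqs, eval, List.foldl, RAM.setReg_reg, g1, g2]
        rw [if_neg (by omega)]
        rcases eq_or_ne (j : ℕ) i with rfl | hne
        · rw [if_pos rfl, hc]
        · rw [if_neg (by omega), g4 j (by omega)])
  have he : (pop n).eval m =
      (upTo (fun i => seqs [.load (20 + i) 11, .add 11 11 1]) (n + 2)).eval m₁ := by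
    simp [pop, eval_seqs, eval, hm₁, h1]
  rw [he]
  obtain ⟨-, k2, k3, k4⟩ := key
  refine ⟨⟨?_, ?_, ?_, ?_, ?_, ?_, ?_, ?_, ?_, ?_, ?_⟩, ?_, ?_⟩
  · rw [k3 _ (by omega) (by omega)]; simp [hm₁, h.one]
  · rw [k3 _ (by omega) (by omega)]; simp [hm₁, h.base]
  · rw [k3 _ (by omega) (by omega)]; simp [hm₁, h.bound]
  · rw [k3 _ (by omega) (by omega)]; simp [hm₁, h.radix]
  · rw [k3 _ (by omega) (by omega)]; simp [hm₁, h.visBase]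
  · rw [k3 _ (by omega) (by omega), k2]; simpa [hm₁, hsp] using hst
  · rw [k3 _ (by omega) (by omega)]; simp [hm₁, h7]
  · rw [k3 _ (by omega) (by omega)]; simp [hm₁, h.tset]
  · rw [k3 _ (by omega) (by omega)]; simp [hm₁, h.floc]
  · rw [k2]; exact h.static
  · rw [k2]; exact h.marks
  · rw [k3 _ (by omega) (by omega)]; simp [hm₁]
  · exact fun i => k4 i i.2

/-- Compare the registers `22, …, 21 + j` with the register `ra`, and branch accordingly. -/
def branch (ra : ℕ) (leaf : (ℕ → Bool) → Program) : ℕ → (ℕ → Bool) → Program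
  | 0, P => leaf P
  | j + 1, P => seqs [.sub 10 (22 + j) ra, .sub 11 ra (22 + j), .add 10 10 11,
      .ifPos 10 (branch ra leaf j (Function.update P j false))
        (branch ra leaf j (Function.update P j true))]

theorem branch_loopFree {ra : ℕ} {leaf : (ℕ → Bool) → Program} (h : ∀ P, (leaf P).LoopFree)
    (j : ℕ) (P : ℕ → Bool) : (branch ra leaf j P).LoopFree := by
  induction j generalizing P with
  | zero => exact h P
  | succ j ih => exact ⟨trivial, trivial, trivial, ih _, ih _⟩

/-- With truncated subtraction, x - y + (y - x) vanishes exactly if x = y, which gives an equality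
test. The comparisons form a binary decision tree, so the full outcome is known statically at each
leaf. -/
theorem eval_branch {ra : ℕ} (h10 : ra ≠ 10) (h11 : ra ≠ 11) (leaf : (ℕ → Bool) → Program) (j : ℕ)
    (P : ℕ → Bool) (m : RAM) : ∃ m', m.Similar m' ∧ (branch ra leaf j P).eval m =
      (leaf fun i => if i < j then decide (m.reg (22 + i) = m.reg ra) else P i).eval m' := by
  induction j generalizing P m with
  | zero => exact ⟨m, ⟨rfl, fun _ _ _ _ => rfl⟩, by simp [branch]⟩
  | succ j ih =>
    set v := m.reg (22 + j) - m.reg ra with hv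
    set w := m.reg ra - m.reg (22 + j) with hw
    set m₁ := ((m.setReg 10 v).setReg 11 w).setReg 10 (v + w) with hm₁
    have hs : ∀ r, r ≠ 10 → r ≠ 11 → m₁.reg r = m.reg r := fun r r1 r2 => by
      simp [hm₁, r1, r2]
    have he : (branch ra leaf (j + 1) P).eval m =
        (branch ra leaf j (Function.update P j (decide (m.reg (22 + j) = m.reg ra)))).eval m₁ := by
      have h12 : ¬ 22 + j = 10 := by omega
      simp only [branch, eval_seqs, eval, List.foldl, RAM.setReg_reg, h10, h12, if_true,
        if_false, Nat.reduceEqDiff, ← hv, ← hw, ← hm₁]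
      have h13 : m₁.reg 10 = v + w := by simp [hm₁]
      by_cases hd : m.reg (22 + j) = m.reg ra
      · rw [if_neg (by omega)]; simp [hd]
      · rw [if_pos (by omega)]; simp [hd]
    obtain ⟨m', h', e'⟩ := ih (Function.update P j (decide (m.reg (22 + j) = m.reg ra))) m₁
    refine ⟨m', ⟨h'.mem, fun r r1 r2 r3 => (h'.reg r r1 r2 r3).trans (hs r r1 r2)⟩, ?_⟩
    rw [he, e']
    congr 2
    funext i
    rw [hs ra h10 h11, hs (22 + i) (by omega) (by omega)]
    rcases lt_trichotomy i j with h | h | h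
    · simp [h, h.trans (Nat.lt_succ_self j)]
    · subst h; simp
    · rw [if_neg (by omega), if_neg (by omega), Function.update_of_ne (by omega)]

/-- Branch on the control state, on the set number in the register `rs`, and on the registers of
the automaton that contain the same as the register `ra`. -/
def dispatch (n size k rs ra : ℕ) (leaf : ℕ → ℕ → (ℕ → Bool) → Program) : Program :=
  .seq (.copy 10 21) (switch 10 ((List.range size).map fun q =>
    .seq (.copy 10 rs) (switch 10 ((List.range k).map fun s =>
      branch ra (leaf q s) n fun _ => false))))

theorem dispatch_loopFree {n size k rs ra : ℕ} {leaf : ℕ → ℕ → (ℕ → Bool) → Program}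
    (h : ∀ q s P, (leaf q s P).LoopFree) : (dispatch n size k rs ra leaf).LoopFree := by
  refine ⟨trivial, switch_loopFree fun p hp => ?_⟩
  obtain ⟨q, -, rfl⟩ := List.mem_map.1 hp
  refine ⟨trivial, switch_loopFree fun p hp => ?_⟩
  obtain ⟨s, -, rfl⟩ := List.mem_map.1 hp
  exact branch_loopFree (h q s) _ _

/-- At a leaf the control state, the set number and the pattern are constants of the program text.
Arbitrary transition functions, even noncomputably defined ones, can thus be hard-wired. -/
theorem eval_dispatch {n size k rs ra : ℕ} (leaf : ℕ → ℕ → (ℕ → Bool) → Program) {m : RAM}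
    {c : Cfg n} (h1 : m.reg 1 = 1) (hrs : rs ≠ 10) (h10 : ra ≠ 10) (h11 : ra ≠ 11)
    (hc : ∀ i : Fin (n + 2), m.reg (20 + i) = c i) (hq : c 1 < size) (hs : m.reg rs < k) :
    ∃ m', m.Similar m' ∧ (dispatch n size k rs ra leaf).eval m =
      (leaf (c 1) (m.reg rs) (pattern (fun i => c i.succ.succ) (m.reg ra))).eval m' := by
  have h21 : m.reg 21 = c 1 := hc 1
  set m₁ := ((m.setReg 10 (c 1)).setReg 10 0) with hm₁
  set m₂ := (m₁.setReg 10 (m.reg rs)).setReg 10 0 with hm₂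
  have r₂ : ∀ r, r ≠ 10 → m₂.reg r = m.reg r := fun r hr => by simp [hm₂, hm₁, hr]
  have he : (dispatch n size k rs ra leaf).eval m =
      (branch ra (leaf (c 1) (m.reg rs)) n fun _ => false).eval m₂ := by
    simp only [dispatch, eval, h21]
    rw [eval_switch (by omega) (by simp [h1]) (by simpa using hq)]
    simp only [RAM.setReg_reg, if_true, List.getElem_map, List.getElem_range, eval, ← hm₁]
    have : m₁.reg rs = m.reg rs := by simp [hm₁, hrs]
    rw [this, eval_switch (by omega) (by simp [hm₁, h1]) (by simpa using hs)]
    simp [← hm₂]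
  obtain ⟨m', h', e'⟩ := eval_branch h10 h11 (leaf (c 1) (m.reg rs)) n (fun _ => false) m₂
  refine ⟨m', ⟨h'.mem, fun r r1 r2 r3 => (h'.reg r r1 r2 r3).trans (r₂ r r1)⟩, ?_⟩
  rw [he, e']
  congr 2
  funext i
  rw [r₂ ra h10, r₂ (22 + i) (by omega)]
  by_cases hi : i < n
  · have := hc ⟨i + 2, by omega⟩
    simp only [pattern, hi, if_true, dif_pos]
    rw [show 22 + i = 20 + (i + 2) by omega, this]
    rfl
  · simp [pattern, hi]

end Program

/-! ### The search -/

/-- A configuration from its location and its cache state. -/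
def Cfg.mk {n : ℕ} (p : ℕ) (y : Fin (n + 1) → ℕ) : Cfg n := Matrix.vecCons p y

/-- The cache state of a configuration: the control state and the contents of the registers. -/
def Cfg.state {n : ℕ} (c : Cfg n) : Fin (n + 1) → ℕ := fun i => c i.succ

@[simp] theorem Cfg.mk_zero {n p : ℕ} {y : Fin (n + 1) → ℕ} : Cfg.mk p y 0 = p := rfl

@[simp] theorem Cfg.mk_succ {n p : ℕ} {y : Fin (n + 1) → ℕ} (i : Fin (n + 1)) :
    Cfg.mk p y i.succ = y i := rfl

@[simp] theorem Cfg.state_mk {n p : ℕ} {y : Fin (n + 1) → ℕ} : (Cfg.mk p y).state = y := rfl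

namespace RegAut

variable {n : ℕ} (A : RegAut n)

/-- The effect of an access on a control state and the contents of the registers. -/
def step (s a : ℕ) (y : Fin (n + 1) → ℕ) : Fin (n + 1) → ℕ :=
  Matrix.vecCons (A.next (y 0) s (pattern (Matrix.vecTail y) a))
    (A.move (y 0) s a (Matrix.vecTail y))

/-- The automaton accepts. -/
def Accepts (s a : ℕ) (y : Fin (n + 1) → ℕ) : Prop :=
  A.accept (y 0) s (pattern (Matrix.vecTail y) a) = true

end RegAut

namespace Arena

variable {n : ℕ} (L : Arena) (A : RegAut n)

/-- The configuration at the next location of an adjacency list. -/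
def nextCfg (c : Cfg n) : Cfg n := .mk (L.μ (c 0)) c.state

/-- The configuration after the edge at the current location has been taken. -/
def edgeCfg (c : Cfg n) : Cfg n :=
  .mk (L.B + L.μ (c 0 + 4))
    (if L.μ (c 0 + 1) = 0 then c.state else A.step (L.μ (c 0 + 2)) (L.μ (c 0 + 3)) c.state)

/-- The successors of a configuration. -/
def succs (c : Cfg n) : List (Cfg n) :=
  (if L.μ (c 0) = 0 then [] else [L.nextCfg c]) ++ if c 0 < L.B then [L.edgeCfg A c] else []

/-- A configuration at the final node in which the automaton accepts. -/
def Accepting (c : Cfg n) : Prop := c 0 = L.floc ∧ A.Accepts L.tset 1 c.state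

end Arena

/-! ### Processing one configuration. -/

namespace Program

/-- Copy the current cache state into the new configuration. -/
def stay (n : ℕ) : Program := upTo (fun i => .copy (23 + n + i) (21 + i)) (n + 1)

theorem stay_loopFree (n : ℕ) : (stay n).LoopFree := upTo_loopFree fun _ _ => trivial

theorem stay_spec (n : ℕ) (m : RAM) : ((stay n).eval m).mem = m.mem ∧
    (∀ r < 23 + n, ((stay n).eval m).reg r = m.reg r) ∧
    ∀ i < n + 1, ((stay n).eval m).reg (23 + n + i) = m.reg (21 + i) := by
  refine eval_upTo_induct (f := fun i => .copy (23 + n + i) (21 + i)) (m := m) (d := n + 1)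
    (fun j m' => m'.mem = m.mem ∧ (∀ r < 23 + n, m'.reg r = m.reg r) ∧
      ∀ i < j, m'.reg (23 + n + i) = m.reg (21 + i)) ⟨rfl, fun _ _ => rfl, by simp⟩ ?_
  rintro i hi m' ⟨h1, h2, h3⟩
  refine ⟨h1, fun r hr => ?_, fun j hj => ?_⟩
  · simp only [eval, RAM.setReg_reg]
    rw [if_neg (by omega), h2 r hr]
  · simp only [eval, RAM.setReg_reg]
    rcases eq_or_ne j i with rfl | hne
    · rw [if_pos rfl, h2 _ (by omega)]
    · rw [if_neg (by omega), h3 j (by omega)]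

/-- Write the cache state after an access into the new configuration. -/
def emit {n : ℕ} (A : RegAut n) (q s : ℕ) (P : ℕ → Bool) : Program :=
  .seq (.const (23 + n) (A.next q s P))
    (upTo (fun i => if h : i < n then
      .copy (24 + n + i) ((A.source q s P ⟨i, h⟩).elim 13 fun j => 22 + j) else skip) n)

theorem emit_loopFree {n : ℕ} (A : RegAut n) (q s : ℕ) (P : ℕ → Bool) :
    (emit A q s P).LoopFree :=
  ⟨trivial, upTo_loopFree fun i hi => by simp only [hi, dif_pos]; trivial⟩

/-- The new configuration is written into registers disjoint from those of the old one, so a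
sequence of copies acts as a simultaneous assignment. The accessed name is in register `13`, the old
contents start at register `22`. -/
theorem emit_spec {n : ℕ} (A : RegAut n) (q s : ℕ) (P : ℕ → Bool) (m : RAM) :
    ((emit A q s P).eval m).mem = m.mem ∧
    (∀ r < 23 + n, ((emit A q s P).eval m).reg r = m.reg r) ∧
    ((emit A q s P).eval m).reg (23 + n) = A.next q s P ∧
    ∀ i : Fin n, ((emit A q s P).eval m).reg (24 + n + i) =
      (A.source q s P i).elim (m.reg 13) fun j => m.reg (22 + j) := by
  have key := eval_upTo_induct (f := fun i => if h : i < n then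
      .copy (24 + n + i) ((A.source q s P ⟨i, h⟩).elim 13 fun j => 22 + j) else skip)
    (m := m.setReg (23 + n) (A.next q s P)) (d := n)
    (fun j m' => m'.mem = m.mem ∧ (∀ r < 23 + n, m'.reg r = m.reg r) ∧
      m'.reg (23 + n) = A.next q s P ∧ ∀ i : Fin n, i < j → m'.reg (24 + n + i) =
        (A.source q s P i).elim (m.reg 13) fun j => m.reg (22 + j))
    ⟨rfl, fun r hr => by simp only [RAM.setReg_reg]; rw [if_neg (by omega)], by simp, by simp⟩
    (by
      rintro i hi m' ⟨h1, h2, h3, h4⟩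
      simp only [hi, dif_pos, eval]
      refine ⟨h1, fun r hr => ?_, ?_, fun j hj => ?_⟩
      · rw [RAM.setReg_reg, if_neg (by omega), h2 r hr]
      · rw [RAM.setReg_reg, if_neg (by omega), h3]
      · rw [RAM.setReg_reg]
        rcases eq_or_ne (j : ℕ) i with rfl | hne
        · rw [if_pos rfl]
          cases A.source q s P j with
          | none => exact h2 13 (by omega)
          | some l => exact h2 (22 + l) (by omega)
        · rw [if_neg (by omega), h4 j (by omega)])
  exact ⟨key.1, key.2.1, key.2.2.1, fun i => key.2.2.2 i i.2⟩

/-- If the current location is the final node and the automaton accepts, set the answer to `1`. -/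
def answer {n : ℕ} (A : RegAut n) (k : ℕ) : Program :=
  seqs [.sub 16 20 9, .sub 17 9 20, .add 16 16 17,
    .ifPos 16 skip (dispatch n A.size k 8 1 fun q s P =>
      if A.accept q s P then .const 0 1 else skip)]

theorem answer_loopFree {n : ℕ} (A : RegAut n) (k : ℕ) : (answer A k).LoopFree :=
  ⟨trivial, trivial, trivial, trivial, dispatch_loopFree fun q s P => by split <;> trivial⟩

variable {n k : ℕ} {A : RegAut n} {L : Arena} {g : Finset (Cfg n) × List (Cfg n)} {m : RAM}
  {c : Cfg n}

open Classical in
-- The target always has identifier `1`, so the constant register `1` doubles as the register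
-- holding the accessed name.
theorem answer_spec (h : L.Holds g.1 g.2 m) (hc : ∀ i : Fin (n + 2), m.reg (20 + i) = c i)
    (hq : c 1 < A.size) (hk : L.tset < k) :
    L.Holds g.1 g.2 ((answer A k).eval m) ∧
    (∀ i : Fin (n + 2), ((answer A k).eval m).reg (20 + i) = c i) ∧
    ((answer A k).eval m).reg 0 = if L.Accepting A c then 1 else m.reg 0 := by
  have hc0 : m.reg 20 = c 0 := hc 0
  set m₁ := ((m.setReg 16 (c 0 - L.floc)).setReg 17 (L.floc - c 0)).setReg 16
    (c 0 - L.floc + (L.floc - c 0)) with hm₁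
  have r₁ : ∀ r, r ≠ 16 → r ≠ 17 → m₁.reg r = m.reg r := fun r r1 r2 => by simp [hm₁, r1, r2]
  have c₁ : ∀ i : Fin (n + 2), m₁.reg (20 + i) = c i := fun i => by
    rw [r₁ _ (by omega) (by omega), hc]
  have h₁ : L.Holds g.1 g.2 m₁ := h.congr rfl fun r _ _ => r₁ r (by omega) (by omega)
  have he : (answer A k).eval m = if 0 < m₁.reg 16 then m₁ else
      (dispatch n A.size k 8 1 fun q s P =>
        if A.accept q s P then .const 0 1 else skip).eval m₁ := by
    simp [answer, eval_seqs, eval, hc0, h.floc, ← hm₁]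
  have h16 : m₁.reg 16 = c 0 - L.floc + (L.floc - c 0) := by simp [hm₁]
  rw [he]
  by_cases hf : c 0 = L.floc
  · rw [if_neg (by omega)]
    obtain ⟨m', h', e'⟩ := eval_dispatch (n := n) (size := A.size) (k := k) (rs := 8) (ra := 1)
      (fun q s P => if A.accept q s P then .const 0 1 else skip) h₁.one (by omega) (by omega)
      (by omega) c₁ hq (by rw [h₁.tset]; exact hk)
    rw [e', h₁.tset, h₁.one]
    have hacc : L.Accepting A c ↔ A.accept (c 1) L.tset
        (pattern (fun i => c i.succ.succ) 1) = true := by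
      simp only [Arena.Accepting, hf, true_and]; rfl
    have hm' : L.Holds g.1 g.2 m' :=
      h₁.congr h'.mem fun r _ _ => h'.reg r (by omega) (by omega) (by omega)
    have hc' : ∀ i : Fin (n + 2), m'.reg (20 + i) = c i := fun i => by
      rw [h'.reg _ (by omega) (by omega) (by omega), c₁]
    by_cases ha : L.Accepting A c
    · rw [if_pos (hacc.1 ha), if_pos ha]
      refine ⟨hm'.congr rfl fun r r1 _ => ?_, fun i => ?_, ?_⟩
      · simp only [eval, RAM.setReg_reg]; rw [if_neg (by omega)]
      · simp only [eval, RAM.setReg_reg]; rw [if_neg (by omega), hc']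
      · simp [eval]
    · rw [if_neg (fun hh => ha (hacc.2 hh)), if_neg ha, eval_skip]
      exact ⟨hm', hc', by
        rw [h'.reg 0 (by omega) (by omega) (by omega), r₁ _ (by omega) (by omega)]⟩
  · rw [if_pos (by omega), if_neg (fun ha => hf ha.1)]
    exact ⟨h₁, c₁, r₁ 0 (by omega) (by omega)⟩

/-- Visit the configuration at the next location of the adjacency list. -/
def followNext (n : ℕ) : Program :=
  .seq (.load 16 20) (.ifPos 16 (seqs [stay n, .copy (22 + n) 16, visit n]) skip)

theorem followNext_loopFree (n : ℕ) : (followNext n).LoopFree :=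
  ⟨trivial, ⟨stay_loopFree n, trivial, visit_loopFree n⟩, trivial⟩

/-- A node cell links to the first edge of the node and an edge cell to the next edge with the same
source. Both are followed in the same way, and the value `0`, which is not the address of an edge,
ends the list. -/
theorem followNext_spec (h : L.Holds g.1 g.2 m) (hT : L.Tables n)
    (hc : ∀ i : Fin (n + 2), m.reg (20 + i) = c i) (h0 : c 0 < L.H)
    (hW : L.μ (c 0) ≠ 0 → ∀ i, L.nextCfg c i < L.W) :
    let g' := (if L.μ (c 0) = 0 then [] else [L.nextCfg c]).foldl Cfg.visit g
    L.Holds g'.1 g'.2 ((followNext n).eval m) ∧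
    (∀ i : Fin (n + 2), ((followNext n).eval m).reg (20 + i) = c i) ∧
    ((followNext n).eval m).reg 0 = m.reg 0 := by
  intro g'
  have hc0 : m.reg 20 = c 0 := hc 0
  have hμ : m.mem (c 0) = L.μ (c 0) := h.static _ (by simp only [Arena.visBase]; omega)
  set m₁ := m.setReg 16 (L.μ (c 0)) with hm₁
  have r₁ : ∀ r, r ≠ 16 → m₁.reg r = m.reg r := fun r r1 => by simp [hm₁, r1]
  have c₁ : ∀ i : Fin (n + 2), m₁.reg (20 + i) = c i := fun i => by rw [r₁ _ (by omega), hc]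
  have h₁ : L.Holds g.1 g.2 m₁ := h.congr rfl fun r _ _ => r₁ r (by omega)
  have h16 : m₁.reg 16 = L.μ (c 0) := by simp [hm₁]
  by_cases h0 : L.μ (c 0) = 0
  · have he : (followNext n).eval m = m₁ := by
      simp [followNext, eval, hc0, hμ, h0, hm₁]
    have hg : g' = g := by simp [g', h0]
    rw [he, hg]
    exact ⟨h₁, c₁, r₁ 0 (by omega)⟩
  · set m₂ := ((stay n).eval m₁).setReg (22 + n) (((stay n).eval m₁).reg 16) with hm₂
    have he : (followNext n).eval m = (visit n).eval m₂ := by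
      simp [followNext, eval, hc0, hμ, ← hm₁, h16, h0, eval_seqs, Nat.pos_iff_ne_zero, ← hm₂]
    have hg : g' = (L.nextCfg c).visit g := by simp [g', h0]
    obtain ⟨s1, s2, s3⟩ := stay_spec n m₁
    have r₂ : ∀ r < 22 + n, m₂.reg r = m₁.reg r := fun r hr => by
      rw [hm₂, RAM.setReg_reg, if_neg (by omega), s2 r (by omega)]
    obtain ⟨v1, v2, v3⟩ := visit_spec (c := L.nextCfg c) (m := m₂)
      (h₁.congr (by simp [hm₂, s1]) fun r _ _ => r₂ r (by omega)) hT (by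
        intro i
        refine Fin.cases ?_ (fun i => ?_) i
        · simpa [hm₂, Arena.nextCfg, h16] using s2 16 (by omega)
        · rw [hm₂, RAM.setReg_reg, if_neg (by simp)]
          have := s3 i i.2
          have h2 := c₁ i.succ
          simp only [Fin.val_succ, Arena.nextCfg, Cfg.mk_succ, Cfg.state] at h2 ⊢
          rw [← h2, show 22 + n + (i + 1 : ℕ) = 23 + n + i by omega, this,
            show 21 + (i : ℕ) = 20 + (i + 1) by omega]) (hW h0)
    rw [he, hg]
    refine ⟨v1, fun i => ?_, ?_⟩
    · rw [v3 _ (by omega), r₂ _ (by omega), c₁]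
    · rw [v2, r₂ _ (by omega), r₁ _ (by omega)]

/-- Read the label of the edge at the current location, and the location of its target. -/
def readEdge (n : ℕ) : Program :=
  seqs [.add 16 20 1, .load 15 16, .add 16 16 1, .load 14 16, .add 16 16 1, .load 13 16,
    .add 16 16 1, .load 16 16, .add (22 + n) 2 16]

/-- If the current location is an edge, visit the configuration after this edge. -/
def followEdge (A : RegAut n) (k : ℕ) : Program :=
  .seq (.sub 16 2 20) (.ifPos 16
    (seqs [readEdge n, .ifPos 15 (dispatch n A.size k 14 13 (emit A)) (stay n), visit n]) skip)

theorem followEdge_loopFree (A : RegAut n) (k : ℕ) : (followEdge A k).LoopFree :=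
  ⟨trivial, ⟨⟨trivial, trivial, trivial, trivial, trivial, trivial, trivial, trivial, trivial⟩,
    ⟨dispatch_loopFree fun q s P => emit_loopFree A q s P, stay_loopFree n⟩, visit_loopFree n⟩,
    trivial⟩

/-- Edge cells lie below `L.B` and node cells do not, so one subtraction tells whether there is an
edge to take. The hypothesis `hB` keeps all five words of the edge inside the static part of the
memory. -/
theorem followEdge_spec (h : L.Holds g.1 g.2 m) (hT : L.Tables n)
    (hc : ∀ i : Fin (n + 2), m.reg (20 + i) = c i) (hB : L.B + 4 ≤ L.visBase n)
    (hq : c 1 < A.size) (hk : c 0 < L.B → L.μ (c 0 + 2) < k)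
    (hW : c 0 < L.B → ∀ i, L.edgeCfg A c i < L.W) :
    let g' := (if c 0 < L.B then [L.edgeCfg A c] else []).foldl Cfg.visit g
    L.Holds g'.1 g'.2 ((followEdge A k).eval m) ∧ ((followEdge A k).eval m).reg 0 = m.reg 0 := by
  intro g'
  have hc0 : m.reg 20 = c 0 := hc 0
  by_cases h0 : c 0 < L.B
  swap
  · have he : (followEdge A k).eval m = m.setReg 16 (L.B - c 0) := by
      simp [followEdge, eval, hc0, h.base, h0]
    have hg : g' = g := by simp [g', h0]
    rw [he, hg]
    refine ⟨h.congr rfl fun r _ _ => ?_, by simp⟩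
    rw [RAM.setReg_reg, if_neg (by omega)]
  have μ1 : m.mem (c 0 + 1) = L.μ (c 0 + 1) := h.static _ (by omega)
  have μ2 : m.mem (c 0 + 2) = L.μ (c 0 + 2) := h.static _ (by omega)
  have μ3 : m.mem (c 0 + 3) = L.μ (c 0 + 3) := h.static _ (by omega)
  have μ4 : m.mem (c 0 + 4) = L.μ (c 0 + 4) := h.static _ (by omega)
  set m₁ := (readEdge n).eval (m.setReg 16 (L.B - c 0)) with hm₁
  have hm₁mem : m₁.mem = m.mem := by simp [hm₁, readEdge, eval_seqs, eval]
  have r₁ : ∀ r, r < 22 + n → r ≠ 13 → r ≠ 14 → r ≠ 15 → r ≠ 16 → m₁.reg r = m.reg r :=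
    fun r r1 r2 r3 r4 r5 => by simp [hm₁, readEdge, eval_seqs, eval, r1.ne, r2, r3, r4, r5]
  have hn : ∀ r < 22, r ≠ 22 + n := fun r hr => by omega
  have e13 : m₁.reg 13 = L.μ (c 0 + 3) := by
    simp [hm₁, readEdge, eval_seqs, eval, hn, hc0, h.one, μ3, add_assoc]
  have e14 : m₁.reg 14 = L.μ (c 0 + 2) := by
    simp [hm₁, readEdge, eval_seqs, eval, hn, hc0, h.one, μ2, add_assoc]
  have e15 : m₁.reg 15 = L.μ (c 0 + 1) := by
    simp [hm₁, readEdge, eval_seqs, eval, hn, hc0, h.one, μ1]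
  have e22 : m₁.reg (22 + n) = L.B + L.μ (c 0 + 4) := by
    simp [hm₁, readEdge, eval_seqs, eval, hc0, h.one, h.base, μ4, add_assoc]
  have c₁ : ∀ i : Fin (n + 2), m₁.reg (20 + i) = c i := fun i => by
    rw [r₁ _ (by omega) (by omega) (by omega) (by omega) (by omega), hc]
  have h₁ : L.Holds g.1 g.2 m₁ := h.congr hm₁mem fun r _ _ =>
    r₁ r (by omega) (by omega) (by omega) (by omega) (by omega)
  have he : (followEdge A k).eval m = (visit n).eval (if 0 < m₁.reg 15 then
      (dispatch n A.size k 14 13 (emit A)).eval m₁ else (stay n).eval m₁) := by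
    have : 0 < L.B - c 0 := by omega
    simp only [followEdge, eval, hc0, h.base, RAM.setReg_reg, if_true, this, eval_seqs, List.foldl,
      ← hm₁]
  have hg : g' = (L.edgeCfg A c).visit g := by simp [g', h0]
  -- With or without an access, the new configuration ends up in the same registers while memory and
  -- the low registers are untouched; the final visit is common to both cases.
  suffices key : ∃ m₂ : RAM, (if 0 < m₁.reg 15 then
      (dispatch n A.size k 14 13 (emit A)).eval m₁ else (stay n).eval m₁) = m₂ ∧
      m₂.mem = m₁.mem ∧ (∀ r < 10, m₂.reg r = m₁.reg r) ∧
      ∀ i : Fin (n + 2), m₂.reg (22 + n + i) = L.edgeCfg A c i by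
    obtain ⟨m₂, e2, k1, k2, k3⟩ := key
    rw [he, hg, e2]
    obtain ⟨v1, v2, v3⟩ := visit_spec (c := L.edgeCfg A c) (m := m₂) (g := g)
      (h₁.congr k1 fun r _ _ => k2 r (by omega)) hT k3 (hW h0)
    refine ⟨v1, ?_⟩
    rw [v2, k2 0 (by omega), r₁ _ (by omega) (by omega) (by omega) (by omega) (by omega)]
  refine ⟨_, rfl, ?_⟩
  by_cases h5 : L.μ (c 0 + 1) = 0
  · rw [if_neg (by omega)]
    obtain ⟨s1, s2, s3⟩ := stay_spec n m₁
    refine ⟨s1, fun r hr => s2 r (by omega), fun i => ?_⟩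
    refine Fin.cases ?_ (fun i => ?_) i
    · simp [Arena.edgeCfg, s2, e22]
    · have := s3 i i.2
      have h2 := c₁ i.succ
      simp only [Fin.val_succ, Arena.edgeCfg, Cfg.mk_succ, Cfg.state, h5, if_true] at h2 ⊢
      rw [← h2, show 22 + n + (i + 1 : ℕ) = 23 + n + i by omega, this,
        show 21 + (i : ℕ) = 20 + (i + 1) by omega]
  · rw [if_pos (by omega)]
    obtain ⟨m', h', e'⟩ := eval_dispatch (n := n) (size := A.size) (k := k) (rs := 14) (ra := 13)
      (emit A) h₁.one (by omega) (by omega) (by omega) c₁ hq (by rw [e14]; exact hk h0)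
    rw [e', e13, e14]
    obtain ⟨s1, s2, s3, s4⟩ := emit_spec A (c 1) (L.μ (c 0 + 2))
      (pattern (fun i => c i.succ.succ) (L.μ (c 0 + 3))) m'
    refine ⟨s1.trans h'.mem, fun r hr => ?_, fun i => ?_⟩
    · rw [s2 r (by omega), h'.reg r (by omega) (by omega) (by omega)]
    · refine Fin.cases ?_ (fun i => Fin.cases ?_ (fun i => ?_) i) i
      · simp only [Fin.val_zero, add_zero, Arena.edgeCfg, Cfg.mk_zero]
        rw [s2 _ (by omega), h'.reg _ (by omega) (by omega) (by omega), e22]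
      · simp only [Fin.val_succ, Fin.val_zero, zero_add, Arena.edgeCfg, Cfg.mk_succ, h5, if_false]
        rw [show 22 + n + 1 = 23 + n by omega, s3]
        rfl
      · simp only [Fin.val_succ, Arena.edgeCfg, Cfg.mk_succ, h5, if_false]
        rw [show 22 + n + (i + 1 + 1 : ℕ) = 24 + n + i by omega, s4,
          h'.reg 13 (by omega) (by omega) (by omega), e13]
        simp only [RegAut.step, Matrix.cons_val_succ, RegAut.move]
        have : ∀ j : Fin n, m'.reg (22 + j) = c j.succ.succ := fun j => by
          rw [h'.reg _ (by omega) (by omega) (by omega), ← c₁ j.succ.succ]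
          congr 1
          simp only [Fin.val_succ]
          omega
        simp only [this]
        rfl

/-- Process the configuration on the top of the stack. -/
def process (A : RegAut n) (k : ℕ) : Program :=
  seqs [pop n, answer A k, followNext n, followEdge A k]

theorem process_loopFree (A : RegAut n) (k : ℕ) : (process A k).LoopFree :=
  ⟨pop_loopFree n, answer_loopFree A k, followNext_loopFree n, followEdge_loopFree A k⟩

open Classical in
theorem process_spec {stack : List (Cfg n)} {vis : Finset (Cfg n)}
    (h : L.Holds vis (c :: stack) m) (hT : L.Tables n) (hB : L.B + 4 ≤ L.visBase n)
    (h0 : c 0 < L.H) (hq : c 1 < A.size) (ht : L.tset < k) (hk : c 0 < L.B → L.μ (c 0 + 2) < k)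
    (hW : ∀ d ∈ L.succs A c, ∀ i, d i < L.W) :
    let g := (L.succs A c).foldl Cfg.visit (vis, stack)
    L.Holds g.1 g.2 ((process A k).eval m) ∧
    ((process A k).eval m).reg 0 = if L.Accepting A c then 1 else m.reg 0 := by
  obtain ⟨p1, p2, p3⟩ := pop_spec h
  obtain ⟨a1, a2, a3⟩ := answer_spec (g := (vis, stack)) (k := k) p1 p3 hq ht
  obtain ⟨n1, n2, n3⟩ := followNext_spec a1 hT a2 h0 fun h => hW _ (by simp [Arena.succs, h])
  obtain ⟨e1, e2⟩ := followEdge_spec n1 hT n2 hB hq hk fun h => hW _ (by simp [Arena.succs, h])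
  have he : (process A k).eval m =
      (followEdge A k).eval ((followNext n).eval ((answer A k).eval ((pop n).eval m))) := by
    simp [process, eval_seqs]
  rw [he]
  refine ⟨?_, ?_⟩
  · simpa only [Arena.succs, List.foldl_append] using e1
  · rw [e2, n3, a3, p2]

end Program

/-! ### Correctness and running time of the search -/

/-- The effect of a sequence of visits on the state of the search. -/
theorem Cfg.foldl_visit {n : ℕ} (ds : List (Cfg n)) (g : Finset (Cfg n) × List (Cfg n)) :
    g.1 ⊆ (ds.foldl Cfg.visit g).1 ∧ (∀ c ∈ g.2, c ∈ (ds.foldl Cfg.visit g).2) ∧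
    (∀ d ∈ ds, d ∈ (ds.foldl Cfg.visit g).1) ∧
    (∀ c ∈ (ds.foldl Cfg.visit g).1, c ∈ g.1 ∨ c ∈ ds ∧ c ∈ (ds.foldl Cfg.visit g).2) ∧
    (∀ c ∈ (ds.foldl Cfg.visit g).2, c ∈ g.2 ∨ c ∈ (ds.foldl Cfg.visit g).1) ∧
    (ds.foldl Cfg.visit g).2.length + g.1.card = g.2.length + (ds.foldl Cfg.visit g).1.card := by
  induction ds generalizing g with
  | nil =>
    exact ⟨subset_rfl, fun _ h => h, by simp, fun c hc => .inl hc, fun c hc => .inl hc, rfl⟩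
  | cons d ds ih =>
    obtain ⟨h1, h2, h3, h4, h5, h6⟩ := ih (d.visit g)
    simp only [List.foldl_cons]
    by_cases hd : d ∈ g.1
    · have hv : d.visit g = g := if_pos hd
      rw [hv] at h1 h2 h3 h4 h5 h6 ⊢
      refine ⟨h1, h2, ?_, ?_, h5, h6⟩
      · intro c hc
        rcases List.mem_cons.1 hc with rfl | hc
        · exact h1 hd
        · exact h3 c hc
      · intro c hc
        exact (h4 c hc).imp id fun h => ⟨List.mem_cons_of_mem _ h.1, h.2⟩
    · have hv : d.visit g = (insert d g.1, d :: g.2) := if_neg hd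
      rw [hv] at h1 h2 h3 h4 h5 h6 ⊢
      have hdm := h1 (Finset.mem_insert_self _ _)
      refine ⟨(Finset.subset_insert _ _).trans h1, fun c hc => h2 c (List.mem_cons_of_mem _ hc),
        ?_, ?_, ?_, ?_⟩
      · intro c hc
        rcases List.mem_cons.1 hc with rfl | hc
        · exact hdm
        · exact h3 c hc
      · intro c hc
        rcases h4 c hc with h | h
        · rcases Finset.mem_insert.1 h with rfl | h
          · exact .inr ⟨List.mem_cons_self, h2 c List.mem_cons_self⟩
          · exact .inl h
        · exact .inr ⟨List.mem_cons_of_mem _ h.1, h.2⟩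
      · intro c hc
        rcases h5 c hc with h | h
        · rcases List.mem_cons.1 h with rfl | h
          · exact .inr hdm
          · exact .inl h
        · exact .inr h
      · rw [Finset.card_insert_of_notMem hd, List.length_cons] at h6
        omega

/-- The configurations that can be reached from the initial ones. -/
def Arena.Reach {n : ℕ} (L : Arena) (A : RegAut n) (Init : Cfg n → Prop) (c : Cfg n) : Prop :=
  ∃ c₀, Init c₀ ∧ Relation.ReflTransGen (fun c d => d ∈ L.succs A c) c₀ c

/-- A configuration that the search can process. -/
structure Arena.Good {n : ℕ} (L : Arena) (A : RegAut n) (k : ℕ) (c : Cfg n) : Prop where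
  lt_radix : ∀ i, c i < L.W
  loc_lt : c 0 < L.H
  control_lt : c 1 < A.size
  set_lt : c 0 < L.B → L.μ (c 0 + 2) < k

namespace Program

variable {n k : ℕ} {A : RegAut n} {L : Arena} {Init : Cfg n → Prop} {m : RAM}

open Classical in
/-- The main loop decides whether an accepting configuration can be reached. -/
theorem main_loop_spec {g : Finset (Cfg n) × List (Cfg n)} (hT : L.Tables n)
    (hB : L.B + 4 ≤ L.visBase n) (ht : L.tset < k) (F : Finset (Cfg n))
    (hF : ∀ c, L.Reach A Init c → c ∈ F) (hG : ∀ c, L.Reach A Init c → L.Good A k c)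
    (h : L.Holds g.1 g.2 m) (hI : ∀ c, c ∈ g.1 ↔ Init c) (hs : ∀ c, c ∈ g.2 ↔ c ∈ g.1)
    (hl : g.2.length = g.1.card) (h0 : m.reg 0 = 0) :
    (whilePos 7 (process A k)).Halts m (((process A k).cost + 1) * F.card + 1) fun m' =>
      m'.reg 0 = if ∃ c, L.Reach A Init c ∧ L.Accepting A c then 1 else 0 := by
  set K := (process A k).cost + 1 with hK
  have hinit : ∀ c, Init c → L.Reach A Init c := fun c hc => ⟨c, hc, .refl⟩
  have hcard : ∀ v : Finset (Cfg n), (∀ c ∈ v, L.Reach A Init c) → v.card ≤ F.card :=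
    fun v hv => Finset.card_le_card fun c hc => hF c (hv c hc)
  -- The invariant: visited configurations are reachable, and each is either still on the stack or
  -- has all its successors visited and its acceptance recorded. The potential counts stack entries
  -- plus configurations not yet visited. A push trades one for the other, so only the pop changes
  -- the sum.
  have key := Halts.whilePos (r := 7) (p := process A k) (m := m)
    (fun (g : Finset (Cfg n) × List (Cfg n)) m => L.Holds g.1 g.2 m ∧
      (∀ c ∈ g.1, L.Reach A Init c) ∧ (∀ c ∈ g.2, c ∈ g.1) ∧ (∀ c, Init c → c ∈ g.1) ∧
      (m.reg 0 = 0 ∨ m.reg 0 = 1 ∧ ∃ c, L.Reach A Init c ∧ L.Accepting A c) ∧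
      ∀ c ∈ g.1, c ∈ g.2 ∨ (∀ d ∈ L.succs A c, d ∈ g.1) ∧ (L.Accepting A c → m.reg 0 = 1))
    (fun g => K * (g.2.length + F.card - g.1.card)) (g := g) ?_
    ⟨h, fun c hc => hinit c ((hI c).1 hc), fun c => (hs c).1, fun c => (hI c).2, .inl h0,
      fun c hc => .inl ((hs c).2 hc)⟩
  · refine key.mono ?_ ?_
    · simp only [hl]
      rw [show g.1.card + F.card - g.1.card = F.card by omega]
    -- Once the stack is empty, the visited set contains the initial configurations and is closed
    -- under successors, hence contains everything reachable.
    · rintro m' ⟨h7, ⟨vis, stack⟩, hh, h1, -, h3, h4, h5⟩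
      have hst : stack = [] := List.length_eq_zero_iff.1 (by rw [← hh.length, h7])
      subst hst
      have hall : ∀ c, L.Reach A Init c → c ∈ vis := by
        rintro c ⟨c₀, hc₀, hc⟩
        induction hc with
        | refl => exact h3 _ hc₀
        | tail _ hd ih => exact ((h5 _ ih).resolve_left (by simp)).1 _ hd
      by_cases hex : ∃ c, L.Reach A Init c ∧ L.Accepting A c
      · obtain ⟨c, hc, ha⟩ := hex
        rw [if_pos ⟨c, hc, ha⟩]
        exact ((h5 c (hall c hc)).resolve_left (by simp)).2 ha
      · rw [if_neg hex]
        exact h4.resolve_right fun h => hex h.2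
  · rintro ⟨vis, stack⟩ m ⟨hh, h1, h2, h3, h4, h5⟩ h7
    simp only at hh h1 h2 h3 h4 h5
    rw [hh.length] at h7
    obtain ⟨c, stack, rfl⟩ := List.exists_cons_of_length_pos h7
    have hcv := h2 c List.mem_cons_self
    have hc := h1 c hcv
    have hsucc : ∀ d ∈ L.succs A c, L.Reach A Init d := fun d hd => by
      obtain ⟨c₀, hc₀, hr⟩ := hc
      exact ⟨c₀, hc₀, hr.tail hd⟩
    have hgood := hG c hc
    obtain ⟨p1, p2⟩ := process_spec (A := A) (k := k) hh hT hB hgood.loc_lt hgood.control_lt ht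
      hgood.set_lt fun d hd => (hG d (hsucc d hd)).lt_radix
    obtain ⟨v1, v2, v3, v4, v5, v6⟩ := Cfg.foldl_visit (L.succs A c) (vis, stack)
    set g' := (L.succs A c).foldl Cfg.visit (vis, stack) with hg'
    have r1 : ∀ d ∈ g'.1, L.Reach A Init d := fun d hd =>
      (v4 d hd).elim (h1 d) fun h => hsucc d h.1
    refine ⟨_, (process_loopFree A k).halts_of ⟨g', ⟨p1, r1, fun d hd => ?_,
      fun d hd => v1 (h3 d hd), ?_, ?_⟩, ?_⟩⟩
    · exact (v5 d hd).elim (fun h => v1 (h2 d (List.mem_cons_of_mem _ h))) id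
    · rw [p2]
      by_cases ha : L.Accepting A c
      · rw [if_pos ha]
        exact .inr ⟨rfl, c, hc, ha⟩
      · rw [if_neg ha]
        exact h4
    · intro d hd
      by_cases hdc : d = c
      · subst hdc
        exact .inr ⟨v3, fun ha => by rw [p2, if_pos ha]⟩
      rcases v4 d hd with h | h
      · rcases h5 d h with h | h
        · exact .inl (v2 d ((List.mem_cons.1 h).resolve_left hdc))
        · refine .inr ⟨fun e he => v1 (h.1 e he), fun ha => ?_⟩
          rw [p2, h.2 ha, ite_self]
      · exact .inl h.2
    · have c1 := hcard g'.1 r1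
      have c2 := hcard vis h1
      simp only [List.length_cons] at v6 ⊢
      -- By `v6`, the stack and the visited set grow by the same amount. The truncated subtractions
      -- are harmless because neither visited set is larger than `F`.
      rw [show stack.length + 1 + F.card - vis.card = g'.2.length + F.card - g'.1.card + 1 by
        omega, mul_add, mul_one]
      omega

/-! ### Enumeration of the initial configurations -/

/-- Set register `16` to `0` if the nonzero ones among the registers `24 + n, …, 23 + 2 * n` have
distinct contents, and to `1` otherwise. -/
def distinct (n : ℕ) : Program :=
  .seq (.const 16 0) (upTo (fun i => upTo (fun j => .ifPos (24 + n + i)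
    (seqs [.sub 10 (24 + n + i) (24 + n + j), .sub 11 (24 + n + j) (24 + n + i), .add 10 10 11,
      .ifPos 10 skip (.const 16 1)]) skip) i) n)

theorem distinct_loopFree (n : ℕ) : (distinct n).LoopFree :=
  ⟨trivial, upTo_loopFree fun _ _ => upTo_loopFree fun _ _ =>
    ⟨⟨trivial, trivial, trivial, trivial, trivial⟩, trivial⟩⟩

/-- A tuple whose nonzero entries are distinct. -/
def _root_.CacheAnalysis.InjOffZero {n : ℕ} (x : Fin n → ℕ) : Prop :=
  ∀ i j, x i = x j → x i ≠ 0 → i = j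

/-- Each nonzero entry is compared with all earlier ones. Testing only the later entry for zero
suffices, since equal entries are both zero or both nonzero. -/
theorem distinct_spec {x : Fin n → ℕ} (hx : ∀ i : Fin n, m.reg (24 + n + i) = x i) :
    ((distinct n).eval m).mem = m.mem ∧
    (∀ r, r ≠ 10 → r ≠ 11 → r ≠ 16 → ((distinct n).eval m).reg r = m.reg r) ∧
    (((distinct n).eval m).reg 16 = 0 ↔ InjOffZero x) := by
  let ok (i j : ℕ) : Prop := m.reg (24 + n + i) ≠ 0 → m.reg (24 + n + i) ≠ m.reg (24 + n + j)
  have inner (i : ℕ) (S : Prop) (m' : RAM) (h1 : m'.mem = m.mem)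
      (h2 : ∀ r, r ≠ 10 → r ≠ 11 → r ≠ 16 → m'.reg r = m.reg r) (h3 : m'.reg 16 = 0 ↔ S) :=
    eval_upTo_induct (f := fun j => .ifPos (24 + n + i)
      (seqs [.sub 10 (24 + n + i) (24 + n + j), .sub 11 (24 + n + j) (24 + n + i), .add 10 10 11,
        .ifPos 10 skip (.const 16 1)]) skip) (d := i) (m := m')
      (fun j m' => m'.mem = m.mem ∧ (∀ r, r ≠ 10 → r ≠ 11 → r ≠ 16 → m'.reg r = m.reg r) ∧
        (m'.reg 16 = 0 ↔ S ∧ ∀ j' < j, ok i j')) ⟨h1, h2, by simpa using h3⟩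
      (by
        rintro j hj m' ⟨h1, h2, h3⟩
        have hi := h2 (24 + n + i) (by omega) (by omega) (by omega)
        have hj := h2 (24 + n + j) (by omega) (by omega) (by omega)
        have split : (∀ j' < j + 1, ok i j') ↔ (∀ j' < j, ok i j') ∧ ok i j :=
          Nat.forall_lt_succ_right
        have d1 : ¬ 24 + n + i = 10 := by omega
        have d2 : ¬ 24 + n + j = 10 := by omega
        rw [split]
        simp only [eval, eval_seqs, List.foldl, eval_skip, RAM.setReg_reg, hi, hj, d1, d2,
          if_true, if_false, Nat.reduceEqDiff]
        by_cases z : m.reg (24 + n + i) = 0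
        · rw [if_neg (by omega)]
          refine ⟨h1, h2, ?_⟩
          rw [h3]
          simp [ok, z]
        · rw [if_pos (by omega)]
          by_cases e : m.reg (24 + n + i) = m.reg (24 + n + j)
          · rw [if_neg (by omega)]
            refine ⟨by simpa using h1, fun r r1 r2 r3 => by simp [r1, r2, r3, h2], ?_⟩
            simp [ok, e, e ▸ z]
          · rw [if_pos (by omega)]
            refine ⟨by simpa using h1, fun r r1 r2 r3 => by simp [r1, r2, r3, h2], ?_⟩
            simp [ok, e, h3])
  have key := eval_upTo_induct (f := fun i => upTo (fun j => .ifPos (24 + n + i)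
      (seqs [.sub 10 (24 + n + i) (24 + n + j), .sub 11 (24 + n + j) (24 + n + i), .add 10 10 11,
        .ifPos 10 skip (.const 16 1)]) skip) i) (d := n) (m := m.setReg 16 0)
    (fun i m' => m'.mem = m.mem ∧ (∀ r, r ≠ 10 → r ≠ 11 → r ≠ 16 → m'.reg r = m.reg r) ∧
        (m'.reg 16 = 0 ↔ ∀ i' < i, ∀ j < i', ok i' j))
    ⟨rfl, fun r _ _ r3 => by simp [r3], by simp⟩
    (by
      rintro i hi m' ⟨h1, h2, h3⟩
      obtain ⟨k1, k2, k3⟩ := inner i _ m' h1 h2 h3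
      exact ⟨k1, k2, k3.trans Nat.forall_lt_succ_right.symm⟩)
  refine ⟨key.1, key.2.1, key.2.2.trans ⟨fun h i j hij hi => ?_, fun h i hi j hj => ?_⟩⟩
  · rw [← hx] at hi
    rw [← hx, ← hx] at hij
    rcases lt_trichotomy (i : ℕ) j with hlt | heq | hlt
    · exact absurd hij.symm (h j j.2 i hlt (hij ▸ hi))
    · exact Fin.ext heq
    · exact absurd hij (h i i.2 j hlt hi)
  · intro h1 h2
    have e1 := hx ⟨i, hi⟩
    have e2 := hx ⟨j, hj.trans hi⟩
    simp only at e1 e2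
    rw [e1] at h1 h2
    rw [e2] at h2
    have := h _ _ h2 h1
    simp at this
    omega

/-- Visit the initial configurations with the given contents of the registers. -/
def start (A : RegAut n) : Program :=
  .seq (distinct n) (.ifPos 16 skip
    (seqs (A.init.map fun q => .seq (.const (23 + n) q) (visit n))))

theorem start_loopFree (A : RegAut n) : (start A).LoopFree := by
  refine ⟨distinct_loopFree n, trivial, seqs_loopFree fun p hp => ?_⟩
  obtain ⟨q, -, rfl⟩ := List.mem_map.1 hp
  exact ⟨trivial, visit_loopFree n⟩

/-- The initial configurations at the location `p`. -/
def _root_.CacheAnalysis.RegAut.Initial (A : RegAut n) (p M : ℕ) (c : Cfg n) : Prop :=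
  ∃ q ∈ A.init, ∃ x : Fin n → ℕ, (∀ i, x i < M) ∧ InjOffZero x ∧
    c = .mk p (Matrix.vecCons q x)

/-- The invariant of the enumeration. -/
structure StartInv (L : Arena) (A : RegAut n) (p M : ℕ) (g : Finset (Cfg n) × List (Cfg n))
    (m : RAM) : Prop where
  holds : L.Holds g.1 g.2 m
  loc : m.reg (22 + n) = p
  bound : m.reg 18 = M
  answer : m.reg 0 = 0
  initial : ∀ c ∈ g.1, A.Initial p M c
  stack : ∀ c, c ∈ g.2 ↔ c ∈ g.1
  length : g.2.length = g.1.card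

/-- The list of initial control states is a constant of the automaton, so for each tuple of contents
only a constant number of visits is made. -/
theorem start_spec {p M : ℕ} {g : Finset (Cfg n) × List (Cfg n)} {x : Fin n → ℕ}
    (hT : L.Tables n) (h : StartInv L A p M g m) (hW : ∀ c, A.Initial p M c → ∀ i, c i < L.W)
    (hx : ∀ i : Fin n, m.reg (24 + n + i) = x i) (hM : ∀ i, x i < M) :
    ∃ g', StartInv L A p M g' ((start A).eval m) ∧ g.1 ⊆ g'.1 ∧
      (∀ r, 24 + n ≤ r → ((start A).eval m).reg r = m.reg r) ∧
      (InjOffZero x → ∀ q ∈ A.init, Cfg.mk p (Matrix.vecCons q x) ∈ g'.1) := by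
  obtain ⟨d1, d2, d3⟩ := distinct_spec hx
  set m₁ := (distinct n).eval m with hm₁
  have h₁ : StartInv L A p M g m₁ :=
    ⟨h.holds.congr d1 fun r _ _ => d2 r (by omega) (by omega) (by omega),
      by rw [d2 _ (by omega) (by omega) (by omega), h.loc],
      by rw [d2 _ (by omega) (by omega) (by omega), h.bound],
      by rw [d2 _ (by omega) (by omega) (by omega), h.answer], h.initial, h.stack, h.length⟩
  have r₁ : ∀ r, 24 + n ≤ r → m₁.reg r = m.reg r := fun r hr =>
    d2 r (by omega) (by omega) (by omega)
  by_cases hi : InjOffZero x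
  swap
  · have he : (start A).eval m = m₁ := by
      have : 0 < m₁.reg 16 := Nat.pos_of_ne_zero fun h => hi (d3.1 h)
      simp [start, eval, ← hm₁, this]
    rw [he]
    exact ⟨g, h₁, subset_rfl, r₁, fun h => absurd h hi⟩
  have he : (start A).eval m =
      (seqs (A.init.map fun q => .seq (.const (23 + n) q) (visit n))).eval m₁ := by
    simp [start, eval, ← hm₁, d3.2 hi]
  have key : ∀ l : List ℕ, (∀ q ∈ l, q ∈ A.init) → ∀ (g : Finset (Cfg n) × List (Cfg n)) (m' : RAM),
      StartInv L A p M g m' → (∀ r, 24 + n ≤ r → m'.reg r = m.reg r) →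
      ∃ g', StartInv L A p M g'
          ((seqs (l.map fun q => .seq (.const (23 + n) q) (visit n))).eval m') ∧ g.1 ⊆ g'.1 ∧
        (∀ r, 24 + n ≤ r →
          ((seqs (l.map fun q => .seq (.const (23 + n) q) (visit n))).eval m').reg r = m.reg r) ∧
        ∀ q ∈ l, Cfg.mk p (Matrix.vecCons q x) ∈ g'.1 := by
    intro l
    induction l with
    | nil =>
      intro _ g m' h hr
      exact ⟨g, by simpa [eval_seqs] using h, subset_rfl, by simpa [eval_seqs] using hr, by simp⟩
    | cons q l ih =>
      intro hl g m' h hr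
      have hini : A.Initial p M (Cfg.mk p (Matrix.vecCons q x)) :=
        ⟨q, hl q (by simp), x, hM, hi, rfl⟩
      obtain ⟨v1, v2, v3⟩ := visit_spec (c := Cfg.mk p (Matrix.vecCons q x)) (g := g)
        (m := m'.setReg (23 + n) q)
        (h.holds.congr rfl fun r _ _ => by rw [RAM.setReg_reg, if_neg (by omega)]) hT (by
          intro i
          refine Fin.cases ?_ (fun i => Fin.cases ?_ (fun i => ?_) i) i
          · simp [h.loc]
          · simp only [Fin.val_succ, Fin.val_zero, Cfg.mk_succ, Matrix.cons_val_zero,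
              RAM.setReg_reg]
            rw [if_pos (by omega)]
          · simp only [Fin.val_succ, Cfg.mk_succ, Matrix.cons_val_succ, RAM.setReg_reg]
            rw [if_neg (by omega), ← hx, hr _ (by omega)]
            congr 1
            omega) (hW _ hini)
      obtain ⟨f1, f2, f3, f4, f5, f6⟩ := Cfg.foldl_visit [Cfg.mk p (Matrix.vecCons q x)] g
      simp only [List.foldl_cons, List.foldl_nil] at f1 f2 f3 f4 f5 f6
      set g₁ := Cfg.visit g (Cfg.mk p (Matrix.vecCons q x)) with hg₁
      obtain ⟨g', k1, k2, k3, k4⟩ := ih (fun q hq => hl q (by simp [hq])) g₁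
        ((visit n).eval (m'.setReg (23 + n) q))
        ⟨v1, by rw [v3 _ (by omega), RAM.setReg_reg, if_neg (by omega), h.loc],
          by rw [v3 _ (by omega), RAM.setReg_reg, if_neg (by omega), h.bound],
          by rw [v2, RAM.setReg_reg, if_neg (by omega), h.answer],
          fun c hc => (f4 c hc).elim (h.initial c) fun hh => by
            rw [List.mem_singleton.1 hh.1]; exact hini,
          fun c => ⟨fun hc => (f5 c hc).elim (fun hc => f1 ((h.stack c).1 hc)) id,
            fun hc => (f4 c hc).elim (fun hc => f2 c ((h.stack c).2 hc)) fun hh => hh.2⟩,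
          by have := h.length; omega⟩
        (fun r r1 => by rw [v3 _ (by omega), RAM.setReg_reg, if_neg (by omega), hr r r1])
      refine ⟨g', ?_, f1.trans k2, ?_, ?_⟩
      · simpa [eval_seqs, eval] using k1
      · simpa [eval_seqs, eval] using k3
      · intro q' hq'
        rcases List.mem_cons.1 hq' with rfl | hq'
        · exact k2 (f3 _ (by simp))
        · exact k4 q' hq'
  obtain ⟨g', k1, k2, k3, k4⟩ := key A.init (fun _ h => h) g m₁ h₁ r₁
  rw [he]
  exact ⟨g', k1, k2, k3, fun _ => k4⟩

/-- Visit the initial configurations, with all values below the contents of register `18` in the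
first `j` registers of the automaton. -/
def enumerate (A : RegAut n) : ℕ → Program
  | 0 => start A
  | j + 1 => .seq (.copy (24 + n + j) 18) (.whilePos (24 + n + j)
      (.seq (.sub (24 + n + j) (24 + n + j) 1) (enumerate A j)))

/-- The program consists of `j` nested loops, each counting a register down from `M`. The summand `4
* j` in the time bound pays for the overhead of the loops. -/
theorem enumerate_spec {p M : ℕ} (hT : L.Tables n) (hW : ∀ c, A.Initial p M c → ∀ i, c i < L.W)
    (hM : 0 < M) (j : ℕ) (hj : j ≤ n) (g : Finset (Cfg n) × List (Cfg n)) (m : RAM)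
    (h : StartInv L A p M g m) (hlt : ∀ i : Fin n, j ≤ i → m.reg (24 + n + i) < M) :
    (enumerate A j).Halts m (((start A).cost + 4 * j) * M ^ j) fun m' =>
      ∃ g', StartInv L A p M g' m' ∧ g.1 ⊆ g'.1 ∧
        (∀ i, j ≤ i → m'.reg (24 + n + i) = m.reg (24 + n + i)) ∧
        ∀ x : Fin n → ℕ, (∀ i, x i < M) → (∀ i : Fin n, j ≤ i → x i = m.reg (24 + n + i)) →
          InjOffZero x → ∀ q ∈ A.init, Cfg.mk p (Matrix.vecCons q x) ∈ g'.1 := by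
  induction j generalizing g m with
  | zero =>
    obtain ⟨g', k1, k2, k3, k4⟩ := start_spec (x := fun i : Fin n => m.reg (24 + n + i)) hT h hW
      (fun _ => rfl) (fun i => hlt i (by omega))
    refine ((start_loopFree A).halts_of (Q := fun m' => ∃ g', StartInv L A p M g' m' ∧ g.1 ⊆ g'.1 ∧
        (∀ i, 0 ≤ i → m'.reg (24 + n + i) = m.reg (24 + n + i)) ∧
        ∀ x : Fin n → ℕ, (∀ i, x i < M) → (∀ i : Fin n, 0 ≤ (i : ℕ) → x i = m.reg (24 + n + i)) →
          InjOffZero x → ∀ q ∈ A.init, Cfg.mk p (Matrix.vecCons q x) ∈ g'.1)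
      ⟨g', k1, k2, fun i _ => k3 _ (by omega), ?_⟩).mono (by simp) fun _ h => h
    intro x _ hx
    have : x = fun i : Fin n => m.reg (24 + n + i) := funext fun i => hx i (by omega)
    rw [this]
    exact k4
  | succ j ih =>
    set T := ((start A).cost + 4 * j) * M ^ j with hTdef
    set m₁ := m.setReg (24 + n + j) M with hm₁
    -- The counter is decreased before the inner enumeration, so when it shows `v` the values `v, …,
    -- M - 1` have been treated. Initially `v = M` and there is nothing to show.
    have loop := Halts.countdown (r := 24 + n + j) (m := m₁)
      (p := .seq (.sub (24 + n + j) (24 + n + j) 1) (enumerate A j))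
      (fun v m' => m'.reg (24 + n + j) = v ∧ v ≤ M ∧ ∃ g', StartInv L A p M g' m' ∧ g.1 ⊆ g'.1 ∧
        (∀ i, j + 1 ≤ i → m'.reg (24 + n + i) = m.reg (24 + n + i)) ∧
        ∀ x : Fin n → ℕ, (∀ i, x i < M) → (∀ i : Fin n, j + 1 ≤ i → x i = m.reg (24 + n + i)) →
          v ≤ x ⟨j, hj⟩ →
          InjOffZero x → ∀ q ∈ A.init, Cfg.mk p (Matrix.vecCons q x) ∈ g'.1)
      (1 + T) (fun v m' h => h.1)
      (by
        rintro v m' ⟨h1, hv, g', h2, h3, h4, h5⟩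
        refine Halts.seq (Q := (· = m'.setReg (24 + n + j) v))
          ((LoopFree.halts_of (p := .sub (24 + n + j) (24 + n + j) 1) trivial (by
            simp [eval, h1, h2.holds.one]))) ?_
        rintro m'' rfl
        set m₂ := m'.setReg (24 + n + j) v with hm₂
        have r₂ : ∀ r, r ≠ 24 + n + j → m₂.reg r = m'.reg r := fun r hr => by simp [hm₂, hr]
        have e₂ : m₂.reg (24 + n + j) = v := by simp [hm₂]
        refine (ih (by omega) g' m₂ ⟨h2.holds.congr rfl fun r _ _ => r₂ r (by omega),
          by rw [r₂ _ (by omega), h2.loc], by rw [r₂ _ (by omega), h2.bound],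
          by rw [r₂ _ (by omega), h2.answer], h2.initial, h2.stack, h2.length⟩
          (fun i hi => ?_)).mono le_rfl ?_
        · rcases eq_or_ne (i : ℕ) j with e | e
          · rw [e, e₂]; omega
          · rw [r₂ _ (by omega), h4 _ (by omega)]
            exact hlt i (by omega)
        · rintro m' ⟨g'', k1, k2, k3, k4⟩
          refine ⟨by rw [k3 j le_rfl, e₂], by omega, g'', k1, h3.trans k2, fun i hi => ?_,
            fun x hx hx' hxv hinj q hq => ?_⟩
          · rw [k3 i (by omega), r₂ _ (by omega), h4 i hi]
          · rcases Nat.lt_or_ge v (x ⟨j, hj⟩) with hlt' | hge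
            · exact k2 (h5 x hx hx' hlt' hinj q hq)
            · refine k4 x hx (fun i hi => ?_) hinj q hq
              rcases eq_or_ne (i : ℕ) j with e | e
              · have hi' : i = ⟨j, hj⟩ := Fin.ext e
                rw [e, e₂, hi']
                omega
              · rw [hx' i (by omega), r₂ _ (by omega), h4 _ (by omega)])
      (j := M)
      ⟨by simp [hm₁], le_rfl, g, ⟨h.holds.congr rfl fun r _ _ => by
          rw [hm₁, RAM.setReg_reg, if_neg (by omega)],
        by rw [hm₁, RAM.setReg_reg, if_neg (by omega), h.loc],
        by rw [hm₁, RAM.setReg_reg, if_neg (by omega), h.bound],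
        by rw [hm₁, RAM.setReg_reg, if_neg (by omega), h.answer], h.initial, h.stack, h.length⟩,
        subset_rfl, fun i hi => by rw [hm₁, RAM.setReg_reg, if_neg (by omega)],
        fun x hx _ hM => absurd (hx ⟨j, hj⟩) (by omega)⟩
    have first : (Program.copy (24 + n + j) 18).Halts m 1 (· = m₁) :=
      (LoopFree.halts_of (p := .copy (24 + n + j) 18) trivial (by simp [eval, h.bound, hm₁]))
    refine (first.seq (T' := M * (1 + T + 1) + 1) (fun m' hm' => hm' ▸ loop)).mono ?_ ?_
    · have h1 : 1 ≤ M ^ j := Nat.one_le_pow _ _ hM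
      have h2 : M ≤ M * M ^ j := Nat.le_mul_of_pos_right _ h1
      have h3 : ((start A).cost + 4 * (j + 1)) * M ^ (j + 1) = M * T + 4 * (M * M ^ j) := by
        rw [hTdef]; ring
      rw [h3]
      have h4 : M * (1 + T + 1) = M * T + 2 * M := by ring
      omega
    · rintro m' ⟨-, -, g', h2, h3, h4, h5⟩
      exact ⟨g', h2, h3, h4, fun x hx hx' => h5 x hx hx' (Nat.zero_le _)⟩

/-- The search: visit the initial configurations, and process the stack. -/
def search (A : RegAut n) (k : ℕ) : Program :=
  .seq (enumerate A n) (.whilePos 7 (process A k))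

open Classical in
-- All initial configurations are put on the stack before any is processed. The finite set `F`
-- enters only through its cardinality, in the time bound; it may be far smaller than the array of
-- marks.
theorem search_spec {p M : ℕ} (hT : L.Tables n) (hB : L.B + 4 ≤ L.visBase n) (ht : L.tset < k)
    (hM : 0 < M) (F : Finset (Cfg n)) (hF : ∀ c, L.Reach A (A.Initial p M) c → c ∈ F)
    (hG : ∀ c, L.Reach A (A.Initial p M) c → L.Good A k c) (h : L.Holds (n := n) ∅ [] m)
    (hp : m.reg (22 + n) = p) (h18 : m.reg 18 = M) (h0 : m.reg 0 = 0) :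
    (search A k).Halts m (((start A).cost + 4 * n) * M ^ n +
      (((process A k).cost + 1) * F.card + 1)) fun m' =>
      m'.reg 0 = if ∃ c, L.Reach A (A.Initial p M) c ∧ L.Accepting A c then 1 else 0 := by
  refine (enumerate_spec (p := p) (M := M) hT (fun c hc => (hG c ⟨c, hc, .refl⟩).lt_radix) hM n
    le_rfl (∅, []) m ⟨h, hp, h18, h0, by simp, by simp, by simp⟩ (fun i hi => by omega)).seq ?_
  rintro m' ⟨g, h1, -, -, h2⟩
  refine main_loop_spec hT hB ht F hF hG h1.holds (fun c => ⟨h1.initial c, ?_⟩) h1.stack h1.length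
    h1.answer
  rintro ⟨q, hq, x, hx, hi, rfl⟩
  exact h2 x hx (fun i hi => by omega) hi q hq

end Program

/-! ### Preprocessing of the input -/

section Words

variable (w : ℕ → ℕ)

/-- The names in the input: that of the target block, followed by those on the edges. -/
def nameAt (j : ℕ) : ℕ := if j = 0 then w 5 else w (4 + 5 * j)

open Classical in
/-- The identifier of a name: the number of its first occurrence in the input, starting from `1`,
or `0` if there is none. -/
def ident (a : ℕ) : ℕ := if h : ∃ j ≤ w 1, nameAt w j = a then Nat.find h + 1 else 0

/-- `p` is the location of the first edge from the node `v`, among those with number at least `j`,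
or `0` if there is none. -/
def IsFirst (v j p : ℕ) : Prop :=
  (p = 0 ∧ ∀ e, j ≤ e → e < w 1 → w (6 + 5 * e) ≠ v) ∨
    ∃ e, j ≤ e ∧ e < w 1 ∧ w (6 + 5 * e) = v ∧ p = 6 + 5 * e ∧
      ∀ e', j ≤ e' → e' < e → w (6 + 5 * e') ≠ v

/-- The memory `μ` contains the preprocessed input: sources of edges have been replaced with links
to the next edge with the same source, names with identifiers, and there is a link from every node
to its first edge. -/
structure Prepared (μ : ℕ → ℕ) : Prop where
  head : ∀ v < w 0, IsFirst w v 0 (μ (6 + 5 * w 1 + v))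
  link : ∀ e < w 1, IsFirst w (w (6 + 5 * e)) (e + 1) (μ (6 + 5 * e))
  kind : ∀ e < w 1, μ (6 + 5 * e + 1) = w (6 + 5 * e + 1)
  set : ∀ e < w 1, μ (6 + 5 * e + 2) = w (6 + 5 * e + 2)
  name : ∀ e < w 1, μ (6 + 5 * e + 3) = ident w (w (6 + 5 * e + 3))
  dst : ∀ e < w 1, μ (6 + 5 * e + 4) = w (6 + 5 * e + 4)

end Words

theorem Prepared.congr {w μ μ' : ℕ → ℕ} (h : Prepared w μ)
    (hμ : ∀ a < 6 + 5 * w 1 + w 0, μ' a = μ a) : Prepared w μ' where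
  head v hv := by rw [hμ _ (by omega)]; exact h.head v hv
  link e he := by rw [hμ _ (by omega)]; exact h.link e he
  kind e he := by rw [hμ _ (by omega)]; exact h.kind e he
  set e he := by rw [hμ _ (by omega)]; exact h.set e he
  name e he := by rw [hμ _ (by omega)]; exact h.name e he
  dst e he := by rw [hμ _ (by omega)]; exact h.dst e he

/-! ### Programs for the preprocessing. -/

namespace Program

/-- Initialize the registers. -/
def setup (n size : ℕ) : Program :=
  seqs [.const 1 1, .const 15 5, .load 17 10, .load 16 1, .const 10 2, .load 14 10, .const 10 3,
    .load 9 10, .const 10 4, .load 8 10, .const 11 5, .load 12 11, .store 10 12,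
    .const 2 6, .add 2 2 16, .add 2 2 16, .add 2 2 16, .add 2 2 16, .add 2 2 16,
    .add 3 2 17, .const 4 size, .add 4 4 3, .add 9 2 9, .add (22 + n) 2 14,
    .const 18 2, .add 18 18 16, .copy 13 2]

/-- The registers that are constant during the preprocessing. -/
structure SetupRegs (w : ℕ → ℕ) (n size : ℕ) (m : RAM) : Prop where
  answer : m.reg 0 = 0
  one : m.reg 1 = 1
  base : m.reg 2 = 6 + 5 * w 1
  bound : m.reg 3 = 6 + 5 * w 1 + w 0
  radix : m.reg 4 = size + (6 + 5 * w 1 + w 0)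
  count : m.reg 7 = 0
  tset : m.reg 8 = w 4
  floc : m.reg 9 = 6 + 5 * w 1 + w 3
  five : m.reg 15 = 5
  names : m.reg 18 = w 1 + 2
  loc : m.reg (22 + n) = 6 + 5 * w 1 + w 2

theorem SetupRegs.congr {w : ℕ → ℕ} {n size : ℕ} {m m' : RAM} (h : SetupRegs w n size m)
    (hr : ∀ r, r ≤ 9 ∨ r = 15 ∨ r = 18 ∨ 22 ≤ r → m'.reg r = m.reg r) :
    SetupRegs w n size m' where
  answer := by rw [hr _ (by omega), h.answer]
  one := by rw [hr _ (by omega), h.one]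
  base := by rw [hr _ (by omega), h.base]
  bound := by rw [hr _ (by omega), h.bound]
  radix := by rw [hr _ (by omega), h.radix]
  count := by rw [hr _ (by omega), h.count]
  tset := by rw [hr _ (by omega), h.tset]
  floc := by rw [hr _ (by omega), h.floc]
  five := by rw [hr _ (by omega), h.five]
  names := by rw [hr _ (by omega), h.names]
  loc := by rw [hr _ (by omega), h.loc]

theorem setup_loopFree (n size : ℕ) : (setup n size).LoopFree := by
  refine seqs_loopFree ?_
  simp [LoopFree]

/-- Once the set number of the target has been saved in a register, its cell `4` receives the name
of the target. Now all names, that of the target included, stand at the addresses `4 + 5 * j`, and a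
lookup needs no special case. -/
theorem setup_spec {w : ℕ → ℕ} {m : RAM} (n size : ℕ) (hm : m.mem = w) (hr : ∀ r, m.reg r = 0) :
    SetupRegs w n size ((setup n size).eval m) ∧
    ((setup n size).eval m).mem = Function.update w 4 (w 5) ∧
    ((setup n size).eval m).reg 16 = w 1 ∧ ((setup n size).eval m).reg 13 = 6 + 5 * w 1 := by
  have hn : ∀ r < 22, r ≠ 22 + n := fun r hr => by omega
  have hn' : ∀ r < 22, 22 + n ≠ r := fun r hr => by omega
  refine ⟨⟨?_, ?_, ?_, ?_, ?_, ?_, ?_, ?_, ?_, ?_, ?_⟩, ?_, ?_, ?_⟩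
  · simp [setup, eval_seqs, eval, hn, hr]
  · simp [setup, eval_seqs, eval, hn]
  · simp [setup, eval_seqs, eval, hn, hm]; omega
  · simp [setup, eval_seqs, eval, hn, hm, hr]; omega
  · simp [setup, eval_seqs, eval, hn, hm, hr]; omega
  · simp [setup, eval_seqs, eval, hn, hr]
  · simp [setup, eval_seqs, eval, hn, hm]
  · simp [setup, eval_seqs, eval, hn, hm]; omega
  · simp [setup, eval_seqs, eval, hn]
  · simp [setup, eval_seqs, eval, hn, hm]; omega
  · simp [setup, eval_seqs, eval, hn', hm]; omega
  · funext a
    simp [setup, eval_seqs, eval, hm, Function.update_apply]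
  · simp [setup, eval_seqs, eval, hn, hm]
  · simp [setup, eval_seqs, eval, hn, hm]; omega

/-- Compare the name at the address in register `10` with the name in register `12`. -/
def compareNames : Program := seqs [.load 11 10, .sub 19 11 12, .sub 11 12 11, .add 11 11 19]

/-- Look up the first occurrence of the name in register `12`. -/
def lookUp : Program :=
  .seq (seqs [.const 10 4, .const 17 1, compareNames])
    (.whilePos 11 (seqs [.add 10 10 15, .add 17 17 1, compareNames]))

/-- The scan stops at the first occurrence, which is at most `l` because the name stands at position
`l` itself. Only positions up to `l` are read, so later names may already have been replaced. -/
theorem lookUp_spec {w : ℕ → ℕ} {m : RAM} {l : ℕ} (hl : l ≤ w 1) (h1 : m.reg 1 = 1)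
    (h15 : m.reg 15 = 5) (h12 : m.reg 12 = nameAt w l)
    (hm : ∀ j ≤ l, m.mem (4 + 5 * j) = nameAt w j) :
    lookUp.Halts m (7 * w 1 + 7) fun m' => m'.reg 17 = ident w (nameAt w l) ∧ m'.mem = m.mem ∧
      ∀ r, r ≠ 10 → r ≠ 11 → r ≠ 17 → r ≠ 19 → m'.reg r = m.reg r := by
  classical
  have hex : ∃ j ≤ w 1, nameAt w j = nameAt w l := ⟨l, hl, rfl⟩
  set d := Nat.find hex with hd
  have hdl : d ≤ l := Nat.find_min' hex ⟨hl, rfl⟩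
  have hds : nameAt w d = nameAt w l := (Nat.find_spec hex).2
  have hid : ident w (nameAt w l) = d + 1 := dif_pos hex
  let Inv (j : ℕ) (m' : RAM) : Prop := j ≤ d ∧ m'.reg 10 = 4 + 5 * j ∧ m'.reg 17 = j + 1 ∧
    m'.reg 11 = nameAt w l - nameAt w j + (nameAt w j - nameAt w l) ∧ m'.mem = m.mem ∧
      ∀ r, r ≠ 10 → r ≠ 11 → r ≠ 17 → r ≠ 19 → m'.reg r = m.reg r
  have hinit : (seqs [.const 10 4, .const 17 1, compareNames]).Halts m 6 (Inv 0) := by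
    refine LoopFree.halts_of (p := seqs [.const 10 4, .const 17 1, compareNames])
      ⟨trivial, trivial, trivial, trivial, trivial, trivial⟩ ?_
    have := hm 0 (by omega)
    simp only [mul_zero, add_zero] at this
    refine ⟨Nat.zero_le _, ?_, ?_, ?_, ?_, ?_⟩
    · simp [eval_seqs, compareNames, eval]
    · simp [eval_seqs, compareNames, eval]
    · simp [eval_seqs, compareNames, eval, this, h12]
    · simp [eval_seqs, compareNames, eval]
    · intro r r1 r2 r3 r4
      simp [eval_seqs, compareNames, eval, r1, r2, r3, r4]
  have hloop := fun m₁ (h : Inv 0 m₁) => Halts.whilePos (r := 11) (m := m₁)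
    (p := seqs [.add 10 10 15, .add 17 17 1, compareNames]) Inv (fun j => 7 * (d - j)) (by
      rintro j m' ⟨g1, g2, g3, g4, g5, g6⟩ h0
      have hne : j ≠ d := by
        rintro rfl
        rw [g4, hds] at h0
        omega
      refine ⟨6, LoopFree.halts_of (p := seqs [.add 10 10 15, .add 17 17 1, compareNames])
        ⟨trivial, trivial, trivial, trivial, trivial, trivial⟩ ⟨j + 1, ⟨?_, ?_, ?_, ?_, ?_, ?_⟩, ?_⟩⟩
      · omega
      · simp [eval_seqs, compareNames, eval, g2, g6, h15]; omega
      · simp [eval_seqs, compareNames, eval, g3, g6, h1]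
      · have := hm (j + 1) (by omega)
        rw [show 4 + 5 * (j + 1) = 4 + 5 * j + 5 by omega] at this
        simp [eval_seqs, compareNames, eval, g2, g5, g6, h15, h12, this]
      · simp [eval_seqs, compareNames, eval, g5]
      · intro r r1 r2 r3 r4
        simp [eval_seqs, compareNames, eval, r1, r2, r3, r4, g6]
      · omega) h
  refine (hinit.seq hloop).mono (by omega) ?_
  rintro m' ⟨h0, j, g1, g2, g3, g4, g5, g6⟩
  rw [h0] at g4
  have hj : nameAt w j = nameAt w l := by omega
  have hjd : d ≤ j := Nat.find_min' hex ⟨by omega, hj⟩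
  refine ⟨by rw [g3, hid]; omega, g5, g6⟩

/-- Preprocess the edge at the address in register `13`. -/
def prepareEdge : Program :=
  .seq (seqs [.sub 13 13 15, .load 10 13, .add 10 2 10, .load 11 10, .store 13 11, .store 10 13,
    .const 14 3, .add 14 13 14, .load 12 14])
    (.seq lookUp (.seq (.store 14 17) (.sub 16 16 1)))

/-- The state of the preprocessing when the edges with numbers below `j` remain. -/
structure EdgeInv (w : ℕ → ℕ) (n size j : ℕ) (m : RAM) : Prop where
  regs : SetupRegs w n size m
  count : m.reg 16 = j
  ptr : m.reg 13 = 6 + 5 * j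
  le : j ≤ w 1
  target : m.mem 4 = w 5
  zero : ∀ a, 6 + 5 * w 1 + w 0 ≤ a → m.mem a = 0
  head : ∀ v < w 0, IsFirst w v j (m.mem (6 + 5 * w 1 + v))
  todo : ∀ e < j, m.mem (6 + 5 * e) = w (6 + 5 * e) ∧ m.mem (6 + 5 * e + 3) = w (6 + 5 * e + 3)
  link : ∀ e < w 1, j ≤ e → IsFirst w (w (6 + 5 * e)) (e + 1) (m.mem (6 + 5 * e))
  name : ∀ e < w 1, j ≤ e → m.mem (6 + 5 * e + 3) = ident w (w (6 + 5 * e + 3))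
  kind : ∀ e < w 1, m.mem (6 + 5 * e + 1) = w (6 + 5 * e + 1)
  set : ∀ e < w 1, m.mem (6 + 5 * e + 2) = w (6 + 5 * e + 2)
  dst : ∀ e < w 1, m.mem (6 + 5 * e + 4) = w (6 + 5 * e + 4)

/-- Edges are treated from the last to the first. A lookup therefore still sees the original names
at all positions up to the current one, and inserting each edge at the front of the list of its
source keeps the lists in increasing order. -/
theorem prepareEdge_spec {w : ℕ → ℕ} {n size j : ℕ} {m : RAM}
    (hsrc : ∀ e < w 1, w (6 + 5 * e) < w 0) (h : EdgeInv w n size (j + 1) m) :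
    prepareEdge.Halts m (7 * w 1 + 18) (EdgeInv w n size j) := by
  have hj : j < w 1 := h.le
  obtain ⟨t1, t2⟩ := h.todo j (by omega)
  set v := w (6 + 5 * j) with hv
  have hvV : v < w 0 := hsrc j hj
  have e13 : m.reg 13 - m.reg 15 = 6 + 5 * j := by rw [h.ptr, h.regs.five]; omega
  set p := 6 + 5 * j with hp
  set hd := m.mem (6 + 5 * w 1 + v) with hhd
  set m₁ := (seqs [.sub 13 13 15, .load 10 13, .add 10 2 10, .load 11 10, .store 13 11,
    .store 10 13, .const 14 3, .add 14 13 14, .load 12 14]).eval m with hm₁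
  have q13 : m₁.reg 13 = p := by simp [hm₁, eval_seqs, eval, e13]
  have q14 : m₁.reg 14 = p + 3 := by simp [hm₁, eval_seqs, eval, e13]
  have mem₁ : ∀ a, m₁.mem a = if a = 6 + 5 * w 1 + v then p else if a = p then hd else m.mem a := by
    intro a
    simp [hm₁, eval_seqs, eval, e13, t1, h.regs.base, ← hhd]
  have q12 : m₁.reg 12 = w (p + 3) := by
    have : m₁.reg 12 = m₁.mem (p + 3) := by simp [hm₁, eval_seqs, eval, e13]
    rw [this, mem₁, if_neg (by omega), if_neg (by omega), t2]
  have r₁ : ∀ r, r ≠ 10 → r ≠ 11 → r ≠ 12 → r ≠ 13 → r ≠ 14 → m₁.reg r = m.reg r := by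
    intro r s1 s2 s3 s4 s5
    simp [hm₁, eval_seqs, eval, s1, s2, s3, s4, s5]
  have hname : w (p + 3) = nameAt w (j + 1) := by
    rw [nameAt, if_neg (by omega)]; congr 1; omega
  have hlook := lookUp_spec (w := w) (m := m₁) (l := j + 1) hj
    (by rw [r₁ _ (by omega) (by omega) (by omega) (by omega) (by omega), h.regs.one])
    (by rw [r₁ _ (by omega) (by omega) (by omega) (by omega) (by omega), h.regs.five])
    (by rw [q12, hname])
    (by
      intro i hi
      rw [mem₁, if_neg (by omega), if_neg (by omega), nameAt]
      rcases Nat.eq_zero_or_pos i with rfl | h0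
      · simpa using h.target
      · rw [if_neg (by omega)]
        have := (h.todo (i - 1) (by omega)).2
        rw [show 6 + 5 * (i - 1) + 3 = 4 + 5 * i by omega] at this
        exact this)
  refine (((LoopFree.halts_of (p := seqs [.sub 13 13 15, .load 10 13, .add 10 2 10, .load 11 10,
    .store 13 11, .store 10 13, .const 14 3, .add 14 13 14, .load 12 14])
    ⟨trivial, trivial, trivial, trivial, trivial, trivial, trivial, trivial, trivial⟩
    (Q := (· = m₁)) rfl)).seq (T' := 7 * w 1 + 9) ?_).mono (by simp [seqs, cost]; omega)
    fun _ h => h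
  rintro m' rfl
  refine (hlook.seq (T' := 2) ?_).mono (by omega) fun _ h => h
  rintro m₂ ⟨k1, k2, k3⟩
  refine LoopFree.halts_of (p := .seq (.store 14 17) (.sub 16 16 1)) ⟨trivial, trivial⟩ ?_
  have q16 : m₂.reg 16 = j + 1 := by
    rw [k3 _ (by omega) (by omega) (by omega) (by omega),
      r₁ _ (by omega) (by omega) (by omega) (by omega) (by omega), h.count]
  have q1 : m₂.reg 1 = 1 := by
    rw [k3 _ (by omega) (by omega) (by omega) (by omega),
      r₁ _ (by omega) (by omega) (by omega) (by omega) (by omega), h.regs.one]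
  have q14' : m₂.reg 14 = p + 3 := by
    rw [k3 _ (by omega) (by omega) (by omega) (by omega), q14]
  set m₃ := eval (.seq (.store 14 17) (.sub 16 16 1)) m₂ with hm₃
  have r₃ : ∀ r, r ≠ 16 → m₃.reg r = m₂.reg r := fun r hr => by simp [hm₃, eval, hr]
  have mem₃ : ∀ a, m₃.mem a = if a = p + 3 then ident w (w (p + 3)) else
      if a = 6 + 5 * w 1 + v then p else if a = p then hd else m.mem a := by
    intro a
    simp only [hm₃, eval, RAM.setReg_mem, RAM.setMem_mem, q14', k1, k2, mem₁, hname]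
  refine ⟨h.regs.congr fun r hr => ?_, ?_, ?_, hj.le, ?_, ?_, ?_, ?_, ?_, ?_, ?_, ?_, ?_⟩
  · rw [r₃ _ (by omega), k3 _ (by omega) (by omega) (by omega) (by omega),
      r₁ _ (by omega) (by omega) (by omega) (by omega) (by omega)]
  · simp [hm₃, eval, q16, q1]
  · rw [r₃ _ (by omega), k3 _ (by omega) (by omega) (by omega) (by omega), q13]
  · rw [mem₃, if_neg (by omega), if_neg (by omega), if_neg (by omega), h.target]
  · intro a ha
    rw [mem₃, if_neg (by omega), if_neg (by omega), if_neg (by omega), h.zero a ha]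
  · intro u hu
    rw [mem₃, if_neg (by omega)]
    by_cases huv : u = v
    · subst huv
      rw [if_pos rfl]
      exact .inr ⟨j, le_rfl, hj, rfl, rfl, fun e' h1 h2 => by omega⟩
    · rw [if_neg (by omega), if_neg (by omega)]
      have hjv : w (6 + 5 * j) ≠ u := fun h => huv (h ▸ rfl)
      rcases h.head u hu with ⟨h1, h2⟩ | ⟨e, h1, h2, h3, h4, h5⟩
      · refine .inl ⟨h1, fun e he => ?_⟩
        rcases eq_or_lt_of_le he with rfl | he
        · exact fun _ => hjv
        · exact h2 e he
      · refine .inr ⟨e, by omega, h2, h3, h4, fun e' he => ?_⟩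
        rcases eq_or_lt_of_le he with rfl | he
        · exact fun _ => hjv
        · exact h5 e' he
  · intro e he
    rw [mem₃, if_neg (by omega), if_neg (by omega), if_neg (by omega), mem₃, if_neg (by omega),
      if_neg (by omega), if_neg (by omega)]
    exact h.todo e (by omega)
  · intro e he hje
    rw [mem₃, if_neg (by omega), if_neg (by omega)]
    -- The old head of the list of the source is precisely the first later edge with this source.
    rcases eq_or_lt_of_le hje with rfl | hje
    · rw [if_pos rfl]
      exact h.head v hvV
    · rw [if_neg (by omega)]
      exact h.link e he hje
  · intro e he hje
    rw [mem₃]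
    rcases eq_or_lt_of_le hje with rfl | hje
    · rw [if_pos rfl]
    · rw [if_neg (by omega), if_neg (by omega), if_neg (by omega)]
      exact h.name e he hje
  · intro e he
    rw [mem₃, if_neg (by omega), if_neg (by omega), if_neg (by omega), h.kind e he]
  · intro e he
    rw [mem₃, if_neg (by omega), if_neg (by omega), if_neg (by omega), h.set e he]
  · intro e he
    rw [mem₃, if_neg (by omega), if_neg (by omega), if_neg (by omega), h.dst e he]

/-- Write the multiplication table for the number in register `11` to the address in register
`10`; multiply register `11` by the radix. -/
def table : Program :=
  .seq (.seq (.const 12 0) (.copy 13 4)) (.seq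
    (.whilePos 13 (seqs [.store 10 12, .add 12 12 11, .add 10 10 1, .sub 13 13 1]))
    (.copy 11 12))

/-- The state of the preprocessing after the completion of `i` multiplication tables. -/
structure TableInv (w : ℕ → ℕ) (n size i : ℕ) (m : RAM) : Prop where
  regs : SetupRegs w n size m
  prepared : Prepared w m.mem
  ptr : m.reg 10 = 6 + 5 * w 1 + w 0 + i * (size + (6 + 5 * w 1 + w 0))
  power : m.reg 11 = (size + (6 + 5 * w 1 + w 0)) ^ i
  zero : ∀ a, m.reg 10 ≤ a → m.mem a = 0
  tables : ∀ i' < i, ∀ v < size + (6 + 5 * w 1 + w 0),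
    m.mem (6 + 5 * w 1 + w 0 + i' * (size + (6 + 5 * w 1 + w 0)) + v) =
      v * (size + (6 + 5 * w 1 + w 0)) ^ i'

/-- The table is produced by repeated addition. After `W` rounds the running sum is `W` times the
current power, which is the power needed for the next table. -/
theorem table_spec {w : ℕ → ℕ} {n size i : ℕ} {m : RAM} (h : TableInv w n size i m) :
    table.Halts m (5 * (size + (6 + 5 * w 1 + w 0)) + 4) (TableInv w n size (i + 1)) := by
  let H := 6 + 5 * w 1 + w 0
  let W := size + H
  set p := m.reg 10 with hp
  have hpow : m.reg 11 = W ^ i := h.power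
  have hptr : p = H + i * W := h.ptr
  have htab : ∀ i' < i, ∀ v < W, m.mem (H + i' * W + v) = v * W ^ i' := h.tables
  change table.Halts m (5 * W + 4) _
  set m₁ := (m.setReg 12 0).setReg 13 W with hm₁
  have first : (Program.seq (.const 12 0) (.copy 13 4)).Halts m 2 (· = m₁) :=
    LoopFree.halts_of (p := .seq (.const 12 0) (.copy 13 4)) ⟨trivial, trivial⟩ (by
      simp [eval, h.regs.radix, hm₁, W, H])
  have loop := Halts.countdown (r := 13) (m := m₁)
    (p := seqs [.store 10 12, .add 12 12 11, .add 10 10 1, .sub 13 13 1])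
    (fun j m' => m'.reg 13 = j ∧ j ≤ W ∧ m'.reg 12 = (W - j) * W ^ i ∧ m'.reg 10 = p + (W - j) ∧
      (∀ a, (a < p ∨ p + (W - j) ≤ a) → m'.mem a = m.mem a) ∧
      (∀ v < W - j, m'.mem (p + v) = v * W ^ i) ∧
      ∀ r, r ≠ 10 → r ≠ 12 → r ≠ 13 → m'.reg r = m.reg r) 4 (fun j m' h => h.1)
    (by
      rintro j m' ⟨g1, g2, g3, g4, g5, g6, g7⟩
      have g11 := g7 11 (by omega) (by omega) (by omega)
      have g01 := g7 1 (by omega) (by omega) (by omega)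
      rw [hpow] at g11
      rw [h.regs.one] at g01
      have hWj : W - j = W - (j + 1) + 1 := by omega
      refine LoopFree.halts_of (p := seqs [.store 10 12, .add 12 12 11, .add 10 10 1, .sub 13 13 1])
        ⟨trivial, trivial, trivial, trivial⟩ ⟨?_, by omega, ?_, ?_, ?_, ?_, ?_⟩
      · simp [eval_seqs, eval, g1, g01]
      · simp [eval_seqs, eval, g3, g11, hWj, add_mul]
      · simp [eval_seqs, eval, g4, g01]; omega
      · intro a ha
        simp only [eval_seqs, eval, List.foldl, RAM.setReg_mem, RAM.setMem_mem, g4]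
        rw [if_neg (by omega), g5 a (by omega)]
      · intro v hv
        simp only [eval_seqs, eval, List.foldl, RAM.setReg_mem, RAM.setMem_mem, g4, g3]
        by_cases hvj : v = W - (j + 1)
        · rw [if_pos (by omega), hvj]
        · rw [if_neg (by omega), g6 v (by omega)]
      · intro r r1 r2 r3
        simp [eval_seqs, eval, r1, r2, r3, g7])
    (j := W)
    ⟨by simp [hm₁], le_rfl, by simp [hm₁], by simp [hm₁, hp], fun a _ => by simp [hm₁],
      by simp, fun r _ r2 r3 => by simp [hm₁, r2, r3]⟩
  refine (first.seq (T' := W * (4 + 1) + 1 + 1) ?_).mono (by omega) fun _ h => h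
  rintro m' rfl
  refine loop.seq ?_
  rintro m₂ ⟨-, -, g3, g4, g5, g6, g7⟩
  refine LoopFree.halts_of (p := .copy 11 12) trivial ?_
  rw [Nat.sub_zero] at g3 g4 g5 g6
  have hpH : H ≤ p := by omega
  have r₃ : ∀ r, r ≠ 11 → ((Program.copy 11 12).eval m₂).reg r = m₂.reg r := fun r hr => by
    simp [eval, hr]
  refine ⟨h.regs.congr fun r hr => ?_, ?_, ?_, ?_, ?_, ?_⟩
  · rw [r₃ _ (by omega), g7 _ (by omega) (by omega) (by omega)]
  · exact h.prepared.congr fun a ha => g5 a (by omega)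
  · rw [r₃ _ (by omega), g4, hptr, add_mul i, one_mul, add_assoc]
  · simpa [eval, g3] using (pow_succ' W i).symm
  · intro a ha
    rw [r₃ _ (by omega), g4] at ha
    exact (g5 a (by omega)).trans (h.zero a (by omega))
  · intro i' hi' v hv
    change m₂.mem (H + i' * W + v) = v * W ^ i'
    rcases eq_or_ne i' i with rfl | hne
    · rw [← hptr, g6 v hv]
    · have h1 : i' < i := by omega
      have h2 : i' * W + W ≤ i * W := by
        rw [← Nat.succ_mul]; exact Nat.mul_le_mul_right _ h1
      rw [g5 _ (by omega), htab i' h1 v hv]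

/-- Preprocess the input. -/
def prepare (n size : ℕ) : Program :=
  .seq (setup n size) (.seq (.whilePos 16 prepareEdge) (.seq (.seq (.copy 10 3) (.const 11 1))
    (.seq (upTo (fun _ => table) (n + 2)) (.seq (.copy 5 10) (.add 6 10 11)))))

/-- Replacing the names is the quadratic part; the tables cost a constant times `W`. Neither the
node cells nor the marks are ever cleared: all cells behind the input are zero from the start, which
means empty lists and no visited configuration. -/
theorem prepare_spec {w : ℕ → ℕ} {m : RAM} (n size : ℕ) (hm : m.mem = w) (hr : ∀ r, m.reg r = 0)
    (hsrc : ∀ e < w 1, w (6 + 5 * e) < w 0) (hzero : ∀ a, 6 + 5 * w 1 ≤ a → w a = 0) :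
    (prepare n size).Halts m ((setup n size).cost + ((w 1 * (7 * w 1 + 19) + 1) + (2 +
        (((n + 2) * (5 * (size + (6 + 5 * w 1 + w 0)) + 4) + 1) + 2))))
      fun m' => ∃ μ, Prepared w μ ∧
        let L : Arena := ⟨6 + 5 * w 1, 6 + 5 * w 1 + w 0, size + (6 + 5 * w 1 + w 0), μ, w 4,
          6 + 5 * w 1 + w 3⟩
        L.Tables n ∧ L.Holds (n := n) ∅ [] m' ∧ m'.reg (22 + n) = 6 + 5 * w 1 + w 2 ∧
        m'.reg 18 = w 1 + 2 ∧ m'.reg 0 = 0 := by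
  obtain ⟨s1, s2, s3, s4⟩ := setup_spec n size hm hr
  have hmem : ∀ a, a ≠ 4 → ((setup n size).eval m).mem a = w a := fun a ha => by
    rw [s2, Function.update_of_ne ha]
  have hE : EdgeInv w n size (w 1) ((setup n size).eval m) := by
    refine ⟨s1, s3, s4, le_rfl, by rw [s2]; simp, ?_, ?_, ?_, ?_, ?_, ?_, ?_, ?_⟩
    · intro a ha
      rw [hmem a (by omega), hzero a (by omega)]
    · intro v _
      exact .inl ⟨by rw [hmem _ (by omega), hzero _ (by omega)], fun e h1 h2 => by omega⟩
    · intro e _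
      exact ⟨hmem _ (by omega), hmem _ (by omega)⟩
    · intro e h1 h2
      omega
    · intro e h1 h2
      omega
    · intro e _
      exact hmem _ (by omega)
    · intro e _
      exact hmem _ (by omega)
    · intro e _
      exact hmem _ (by omega)
  refine ((setup_loopFree n size).halts_of hE).seq fun m₁ h₁ => ?_
  refine (Halts.countdown (r := 16) (p := prepareEdge) (EdgeInv w n size) (7 * w 1 + 18)
    (fun j m' h => h.count) (fun j m' h => prepareEdge_spec hsrc h) h₁).seq fun m₂ h₂ => ?_
  refine (LoopFree.halts_of (p := .seq (.copy 10 3) (.const 11 1)) ⟨trivial, trivial⟩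
    (Q := TableInv w n size 0) ?_).seq fun m₃ h₃ => ?_
  · refine ⟨h₂.regs.congr fun r hr => ?_, ⟨h₂.head, fun e he => h₂.link e he (Nat.zero_le _),
      h₂.kind, h₂.set, fun e he => h₂.name e he (Nat.zero_le _), h₂.dst⟩, ?_, ?_, ?_, by simp⟩
    · have h10 : r ≠ 10 := by omega
      have h11 : r ≠ 11 := by omega
      simp [eval, h10, h11]
    · simp [eval, h₂.regs.bound]
    · simp [eval]
    · intro a ha
      simp [eval, h₂.regs.bound] at ha
      exact h₂.zero a ha
  refine (Halts.upTo (f := fun _ => table) (d := n + 2) (TableInv w n size) _ h₃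
    fun i _ m h => table_spec h).seq fun m₄ h₄ => ?_
  refine LoopFree.halts_of (p := .seq (.copy 5 10) (.add 6 10 11)) ⟨trivial, trivial⟩ ?_
  have r₅ : ∀ r, r ≠ 5 → r ≠ 6 →
      (eval (.seq (.copy 5 10) (.add 6 10 11)) m₄).reg r = m₄.reg r := fun r r1 r2 => by
    simp [eval, r1, r2]
  refine ⟨m₄.mem, h₄.prepared, h₄.tables, ⟨?_, ?_, ?_, ?_, ?_, ?_, ?_, ?_, ?_, fun _ _ => rfl, ?_⟩,
    ?_, ?_, ?_⟩
  · rw [r₅ _ (by omega) (by omega), h₄.regs.one]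
  · rw [r₅ _ (by omega) (by omega), h₄.regs.base]
  · rw [r₅ _ (by omega) (by omega), h₄.regs.bound]
  · rw [r₅ _ (by omega) (by omega), h₄.regs.radix]
  · simp [eval, h₄.ptr, Arena.visBase]
  · simp [Arena.StackAt, eval, h₄.ptr, h₄.power, Arena.visBase, Arena.stackBase]
  · rw [r₅ _ (by omega) (by omega), h₄.regs.count, List.length_nil]
  · rw [r₅ _ (by omega) (by omega), h₄.regs.tset]
  · rw [r₅ _ (by omega) (by omega), h₄.regs.floc]
  · intro c hc
    have := h₄.zero (m₄.reg 10 + c.code (size + (6 + 5 * w 1 + w 0))) (by omega)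
    rw [h₄.ptr] at this
    simpa [Arena.visBase, eval] using this
  · rw [r₅ _ (by omega) (by omega), h₄.regs.loc]
  · rw [r₅ _ (by omega) (by omega), h₄.regs.names]
  · rw [r₅ _ (by omega) (by omega), h₄.regs.answer]

end Program

/-! ### The input in memory -/

namespace Edge

variable {k n : ℕ} (e : Edge (Fin k × ℕ) n)

theorem length_words : e.words.length = 5 := by
  unfold Edge.words; split <;> rfl

theorem words_src : e.words.getD 0 0 = e.src := by
  unfold Edge.words; split <;> rfl

theorem words_kind : e.words.getD 1 0 = if e.label.isSome then 1 else 0 := by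
  unfold Edge.words; split <;> simp_all

theorem words_set : e.words.getD 2 0 = e.label.elim (0 : ℕ) fun b => b.1 := by
  unfold Edge.words; split <;> simp_all

theorem words_name : e.words.getD 3 0 = e.label.elim (0 : ℕ) fun b => b.2 := by
  unfold Edge.words; split <;> simp_all

theorem words_dst : e.words.getD 4 0 = e.dst := by
  unfold Edge.words; split <;> rfl

end Edge

namespace Input

variable {k : ℕ} (I : Input (Fin k × ℕ))

/-- The words of the input, in memory. -/
abbrev mem : ℕ → ℕ := (RAM.init I).mem

theorem mem_zero : I.mem 0 = I.numNodes := rfl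

theorem mem_one : I.mem 1 = I.edges.length := rfl

theorem getD_flatMap_words {n : ℕ} (l : List (Edge (Fin k × ℕ) n)) (e : ℕ) (he : e < l.length)
    (j : ℕ) (hj : j < 5) : (l.flatMap Edge.words).getD (5 * e + j) 0 = l[e].words.getD j 0 := by
  induction l generalizing e with
  | nil => simp at he
  | cons d l ih =>
    rw [List.flatMap_cons]
    cases e with
    | zero => rw [List.getD_append _ _ _ _ (by rw [d.length_words]; omega)]; simp
    | succ e =>
      rw [List.getD_append_right _ _ _ _ (by rw [d.length_words]; omega), d.length_words,
        show 5 * (e + 1) + j - 5 = 5 * e + j by omega, ih e (by simpa using he)]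
      simp

theorem mem_edge (e : ℕ) (he : e < I.edges.length) (j : ℕ) (hj : j < 5) :
    I.mem (6 + 5 * e + j) = I.edges[e].words.getD j 0 := by
  rw [← getD_flatMap_words I.edges e he j hj]
  change I.words.getD _ _ = _
  rw [Input.words, List.getD_append_right _ _ _ _ (by simp; omega)]
  congr 1
  simp only [List.length_cons, List.length_nil]
  omega

theorem length_words : I.words.length = 6 + 5 * I.edges.length := by
  simp only [Input.words, List.length_append, List.length_flatMap, Edge.length_words]
  simp [mul_comm]

theorem mem_of_le {a : ℕ} (h : 6 + 5 * I.edges.length ≤ a) : I.mem a = 0 :=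
  List.getD_eq_default _ _ (by rw [I.length_words]; exact h)

theorem mem_src (e : ℕ) (he : e < I.edges.length) : I.mem (6 + 5 * e) = I.edges[e].src := by
  rw [← Edge.words_src, ← I.mem_edge e he 0 (by omega), add_zero]

theorem isPath_concat {β : Type} {I : Input β} {π : List (Edge β I.numNodes)}
    {p : Fin I.numNodes} {e : Edge β I.numNodes} (h : I.IsPath π p e.src) (he : e ∈ I.edges) :
    I.IsPath (π ++ [e]) p e.dst := by
  induction π generalizing p with
  | nil => exact ⟨he, h.symm, rfl⟩
  | cons d π ih => exact ⟨h.1, h.2.1, ih h.2.2⟩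

end Input

/-! ### Executions of register automata -/

namespace RegAut

variable {n k : ℕ} (A : RegAut n)

/-- The effect of an edge. Blocks are replaced with their identifiers `ι`. -/
def edgeStep {v : ℕ} (ι : ℕ → ℕ) (y : Fin (n + 1) → ℕ) (e : Edge (Fin k × ℕ) v) :
    Fin (n + 1) → ℕ :=
  e.label.elim y fun b => A.step b.1 (ι b.2) y

/-- There is an execution from an initial state and along a path to the final node that ends in an
accepting state. -/
def Solves (I : Input (Fin k × ℕ)) : Prop :=
  ∃ q ∈ A.init, ∃ x : Fin n → ℕ, (∀ i, x i < I.edges.length + 2) ∧ InjOffZero x ∧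
    ∃ π, I.IsPath π I.start I.final ∧
      A.Accepts I.target.1 1 (π.foldl (A.edgeStep (ident I.mem)) (Matrix.vecCons q x))

end RegAut

theorem ident_lt (w : ℕ → ℕ) (a : ℕ) : ident w a < w 1 + 2 := by
  classical
  unfold ident
  split
  · next h => have := (Nat.find_spec h).1; omega
  · omega

/-- A set of locations that is closed under links contains all edges of an adjacency list. -/
theorem IsFirst.mem_of_closed {w μ : ℕ → ℕ} (hμ : Prepared w μ) {S : Set ℕ}
    (hS : ∀ p ∈ S, μ p ≠ 0 → μ p ∈ S) {v j p : ℕ} (h : IsFirst w v j p) (hp : p ≠ 0 → p ∈ S)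
    {e : ℕ} (hj : j ≤ e) (he : e < w 1) (hv : w (6 + 5 * e) = v) : 6 + 5 * e ∈ S := by
  induction hd : w 1 - j using Nat.strong_induction_on generalizing j p with
  | _ d ih =>
    rcases h with ⟨-, h⟩ | ⟨e₀, h1, h2, h3, rfl, h4⟩
    · exact absurd hv (h e hj he)
    · have h0 := hp (by omega)
      rcases lt_trichotomy e e₀ with hlt | rfl | hlt
      · exact absurd hv (h4 e hj hlt)
      · exact h0
      · have hl := hμ.link e₀ h2
        rw [h3] at hl
        exact ih (w 1 - (e₀ + 1)) (by omega) hl (hS _ h0) hlt rfl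

/-! ### Reachable configurations correspond to paths in the control-flow graph. -/

section Graph

variable {n k : ℕ} (A : RegAut n) (I : Input (Fin k × ℕ)) {L : Arena}

/-- The location of a configuration belongs to a node: it is the cell of this node, or that of an
edge from this node. -/
def AtNode (I : Input (Fin k × ℕ)) (v : Fin I.numNodes) (p : ℕ) : Prop :=
  p = 6 + 5 * I.edges.length + v ∨ ∃ e, ∃ h : e < I.edges.length, I.edges[e].src = v ∧ p = 6 + 5 * e

theorem IsFirst.atNode {I : Input (Fin k × ℕ)} {v : Fin I.numNodes} {j p : ℕ}
    (h : IsFirst I.mem v j p) (hp : p ≠ 0) : AtNode I v p := by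
  rcases h with ⟨h, -⟩ | ⟨e, -, h2, h3, h4, -⟩
  · exact absurd h hp
  · rw [I.mem_src e h2] at h3
    exact .inr ⟨e, h2, Fin.ext h3, h4⟩

theorem edgeCfg_eq {L : Arena} (hμ : Prepared I.mem L.μ) (hB : L.B = 6 + 5 * I.edges.length)
    {c : Cfg n} {e : ℕ} (he : e < I.edges.length) (hc : c 0 = 6 + 5 * e) :
    L.edgeCfg A c = .mk (6 + 5 * I.edges.length + I.edges[e].dst)
      (A.edgeStep (ident I.mem) c.state I.edges[e]) := by
  have e1 := hμ.kind e he
  have e2 := hμ.set e he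
  have e3 := hμ.name e he
  have e4 := hμ.dst e he
  rw [I.mem_edge e he _ (by omega)] at e1 e2 e3 e4
  rw [Edge.words_kind] at e1
  rw [Edge.words_set] at e2
  rw [Edge.words_name] at e3
  rw [Edge.words_dst] at e4
  rw [Arena.edgeCfg, hc, hB, e1, e2, e3, e4]
  congr 1
  cases h : I.edges[e].label <;> simp [RegAut.edgeStep, h]

/-- The bounds on the components of the configurations. -/
def Cfg.bound (n H size M : ℕ) : Fin (n + 2) → ℕ := Matrix.vecCons H (Matrix.vecCons size fun _ => M)

/-- Registers are only ever filled with old contents or with the accessed name, so no new values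
arise. -/
theorem RegAut.step_lt {M s a : ℕ} {y : Fin (n + 1) → ℕ} (ha : a < M)
    (hy : ∀ i : Fin n, y i.succ < M) : A.step s a y 0 < A.size ∧ ∀ i : Fin n, A.step s a y i.succ < M := by
  refine ⟨A.next_lt _ _ _, fun i => ?_⟩
  simp only [RegAut.step, Matrix.cons_val_succ, RegAut.move]
  cases A.source (y 0) s (pattern (Matrix.vecTail y) a) i with
  | none => exact ha
  | some j => exact hy j

variable {A I}

/-- Following a link changes the location but stays at the same node, with the same path. Taking an
edge extends the path by that edge and leads to the cell of its target. -/
theorem reach_sound (hμ : Prepared I.mem L.μ) (hB : L.B = 6 + 5 * I.edges.length) {c : Cfg n}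
    (hc : L.Reach A (A.Initial (6 + 5 * I.edges.length + I.start) (I.edges.length + 2)) c) :
    ∃ q ∈ A.init, ∃ x : Fin n → ℕ, (∀ i, x i < I.edges.length + 2) ∧ InjOffZero x ∧ ∃ v π,
      I.IsPath π I.start v ∧ AtNode I v (c 0) ∧
      c.state = π.foldl (A.edgeStep (ident I.mem)) (Matrix.vecCons q x) := by
  obtain ⟨c₀, ⟨q, hq, x, hx, hi, rfl⟩, hr⟩ := hc
  refine ⟨q, hq, x, hx, hi, ?_⟩
  induction hr with
  | refl => exact ⟨I.start, [], rfl, .inl rfl, rfl⟩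
  | @tail c d _ hd ih =>
    obtain ⟨v, π, h1, h2, h3⟩ := ih
    rcases List.mem_append.1 hd with hd | hd
    · by_cases h0 : L.μ (c 0) = 0
      · simp [h0] at hd
      · simp only [h0, if_false, List.mem_singleton] at hd
        subst hd
        refine ⟨v, π, h1, ?_, h3⟩
        simp only [Arena.nextCfg, Cfg.mk_zero]
        rcases h2 with h2 | ⟨e, he, hv, h2⟩
        · rw [h2] at h0 ⊢
          exact (hμ.head v v.2).atNode h0
        · rw [h2] at h0 ⊢
          have hl := hμ.link e he
          rw [I.mem_src e he, hv] at hl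
          exact hl.atNode h0
    · by_cases h0 : c 0 < L.B
      · simp only [h0, if_true, List.mem_singleton] at hd
        subst hd
        rcases h2 with h2 | ⟨e, he, hv, h2⟩
        · omega
        · rw [edgeCfg_eq A I hμ hB he h2]
          refine ⟨_, π ++ [I.edges[e]], I.isPath_concat (hv ▸ h1) (List.getElem_mem he), .inl rfl, ?_⟩
          rw [List.foldl_append, ← h3]
          rfl
      · simp [h0] at hd

/-- With the cache state held fixed, the locations that can be reached are closed under links. From
the cell of a node all its edges are therefore reached, in particular the next edge of the path. -/
theorem reach_complete {Init : Cfg n → Prop} (hμ : Prepared I.mem L.μ)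
    (hB : L.B = 6 + 5 * I.edges.length)
    {π : List (Edge (Fin k × ℕ) I.numNodes)} {p q : Fin I.numNodes} (hπ : I.IsPath π p q)
    {y : Fin (n + 1) → ℕ} (h : L.Reach A Init (.mk (6 + 5 * I.edges.length + p) y)) :
    L.Reach A Init (.mk (6 + 5 * I.edges.length + q) (π.foldl (A.edgeStep (ident I.mem)) y)) := by
  induction π generalizing p y with
  | nil => obtain rfl : p = q := hπ; exact h
  | cons d π ih =>
    obtain ⟨hd, rfl, hπ⟩ := hπ
    obtain ⟨e, he, rfl⟩ := List.mem_iff_getElem.1 hd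
    refine ih hπ ?_
    have hS : ∀ p' ∈ {p' | L.Reach A Init (.mk p' y)}, L.μ p' ≠ 0 →
        L.μ p' ∈ {p' | L.Reach A Init (.mk p' y)} := by
      rintro p' ⟨c₀, hc₀, hr⟩ h0
      refine ⟨c₀, hc₀, hr.tail (List.mem_append.2 (.inl ?_))⟩
      simp [h0, Arena.nextCfg]
    obtain ⟨c₀, hc₀, hr⟩ : L.Reach A Init (.mk (6 + 5 * e) y) :=
      IsFirst.mem_of_closed hμ hS (hμ.head I.edges[e].src I.edges[e].src.2)
        (hS _ h) (Nat.zero_le e) he (I.mem_src e he)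
    refine ⟨c₀, hc₀, hr.tail (List.mem_append.2 (.inr ?_))⟩
    rw [if_pos (by rw [hB, Cfg.mk_zero]; omega),
      edgeCfg_eq A I hμ hB he rfl, Cfg.state_mk]
    exact List.mem_singleton_self _

/-- The final location is the cell of a node. It differs from all edge cells and from the cells of
other nodes, so it identifies the end of the path. -/
theorem exists_reach_iff (hμ : Prepared I.mem L.μ) (hB : L.B = 6 + 5 * I.edges.length)
    (ht : L.tset = I.target.1) (hf : L.floc = 6 + 5 * I.edges.length + I.final) :
    (∃ c, L.Reach A (A.Initial (6 + 5 * I.edges.length + I.start) (I.edges.length + 2)) c ∧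
      L.Accepting A c) ↔ A.Solves I := by
  constructor
  · rintro ⟨c, hc, h0, hacc⟩
    obtain ⟨q, hq, x, hx, hi, v, π, h1, h2, h3⟩ := reach_sound hμ hB hc
    have hv : v = I.final := by
      rcases h2 with h2 | ⟨e, he, -, h2⟩
      · exact Fin.ext (by omega)
      · omega
    rw [h3, ht] at hacc
    exact ⟨q, hq, x, hx, hi, π, hv ▸ h1, hacc⟩
  · rintro ⟨q, hq, x, hx, hi, π, hπ, hacc⟩
    refine ⟨_, reach_complete hμ hB hπ ⟨_, ⟨q, hq, x, hx, hi, rfl⟩, .refl⟩, hf.symm, ?_⟩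
    rw [ht]
    exact hacc

theorem foldl_edgeStep_lt (π : List (Edge (Fin k × ℕ) I.numNodes)) {y : Fin (n + 1) → ℕ}
    (h0 : y 0 < A.size) (hy : ∀ i : Fin n, y i.succ < I.edges.length + 2) :
    π.foldl (A.edgeStep (ident I.mem)) y 0 < A.size ∧
    ∀ i : Fin n, π.foldl (A.edgeStep (ident I.mem)) y i.succ < I.edges.length + 2 := by
  induction π generalizing y with
  | nil => exact ⟨h0, hy⟩
  | cons e π ih =>
    rw [List.foldl_cons]
    have : A.edgeStep (ident I.mem) y e 0 < A.size ∧
        ∀ i : Fin n, A.edgeStep (ident I.mem) y e i.succ < I.edges.length + 2 := by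
      unfold RegAut.edgeStep
      cases e.label with
      | none => exact ⟨h0, hy⟩
      | some b => exact A.step_lt (ident_lt _ _) hy
    exact ih this.1 this.2

/-- These bounds differ from component to component, unlike the common radix `W`, which is linear in
the size of the graph even for the control state. Only the finer bounds give the exponent `n + 1`
instead of `n + 2`. -/
theorem reach_bound (hμ : Prepared I.mem L.μ) (hB : L.B = 6 + 5 * I.edges.length) {c : Cfg n}
    (hc : L.Reach A (A.Initial (6 + 5 * I.edges.length + I.start) (I.edges.length + 2)) c) :
    (∀ i, c i < Cfg.bound n (6 + 5 * I.edges.length + I.numNodes) A.size (I.edges.length + 2) i) ∧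
      (c 0 < L.B → L.μ (c 0 + 2) < k) := by
  obtain ⟨q, hq, x, hx, hi, v, π, h1, h2, h3⟩ := reach_sound hμ hB hc
  have hy := foldl_edgeStep_lt (I := I) π (y := Matrix.vecCons q x) (A.init_lt q hq) hx
  rw [← h3] at hy
  refine ⟨fun i => ?_, fun h0 => ?_⟩
  · refine Fin.cases ?_ (fun i => Fin.cases ?_ (fun i => ?_) i) i
    · change c 0 < 6 + 5 * I.edges.length + I.numNodes
      rcases h2 with h2 | ⟨e, he, -, h2⟩ <;> omega
    · exact hy.1
    · exact hy.2 i
  · rcases h2 with h2 | ⟨e, he, -, h2⟩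
    · omega
    · rw [h2, hμ.set e he, I.mem_edge e he 2 (by omega), Edge.words_set]
      cases I.edges[e].label with
      | none => exact I.target.1.pos
      | some b => exact b.1.2

end Graph

/-! ### The decision procedure -/

open Classical in
/-- A register automaton with `n` registers can be executed on all paths within the time
`O(|G| ^ (n + 1))`. -/
theorem RegAut.decidable {n : ℕ} (A : RegAut n) (k : ℕ) (hn : 1 ≤ n) :
    ∃ (p : Program) (C : ℕ), p.DecidesWithin (k := k) A.Solves fun I => C * I.size ^ (n + 1) := by
  -- With s = |G| ≥ 1: the summand 33 is 26, for the lookups, plus 7 single steps; 59 comes from 5 ·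
  -- 11 s + 4; 11 from 6 + 5|E| + |V| ≤ 11 s; and 3 from |E| + 2 ≤ 3 s.
  refine ⟨.seq (.prepare n A.size) (.search A k),
    (Program.setup n A.size).cost + 33 + (n + 2) * (5 * A.size + 59) +
      ((Program.start A).cost + 4 * n) * 3 ^ n +
      ((Program.process A k).cost + 1) * (11 * A.size * 3 ^ n), fun I => ?_⟩
  set E := I.edges.length with hE
  set V := I.numNodes with hV
  have hVpos : 0 < V := I.start.pos
  have hprep := Program.prepare_spec (w := I.mem) (m := RAM.init I) n A.size rfl (fun _ => rfl)
    (fun e he => by rw [I.mem_src e he]; exact Fin.is_lt _) (fun a ha => I.mem_of_le ha)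
  have hall := hprep.seq (q := .search A k)
    (T' := ((Program.start A).cost + 4 * n) * (E + 2) ^ n +
      (((Program.process A k).cost + 1) * ((6 + 5 * E + V) * A.size * (E + 2) ^ n) + 1))
    (R := fun m' => m'.reg 0 = if A.Solves I then 1 else 0) ?_
  · obtain ⟨t, m, hr, ht, hm⟩ := hall
    refine ⟨t, m, hr, ht.trans ?_, hm⟩
    rw [I.mem_zero, I.mem_one]
    simp only [← hE, ← hV]
    set s := I.size with hs
    have hsE : E ≤ s := by simp only [hs, Input.size]; omega
    have hs1 : 1 ≤ s := by simp only [hs, Input.size]; omega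
    have hH : 6 + 5 * E + V ≤ 11 * s := by simp only [hs, Input.size]; omega
    have hM : (E + 2) ^ n ≤ 3 ^ n * s ^ n := by
      rw [← mul_pow]; exact Nat.pow_le_pow_left (by omega) n
    have hX1 : 1 ≤ s ^ (n + 1) := Nat.one_le_pow _ _ hs1
    -- This is where `1 ≤ n` is used: the quadratic preprocessing must not dominate.
    have hX2 : s * s ≤ s ^ (n + 1) := by
      rw [← sq]; exact Nat.pow_le_pow_right hs1 (by omega)
    have hX3 : s ≤ s ^ (n + 1) := (Nat.le_mul_of_pos_left s hs1).trans hX2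
    have hX4 : s ^ n ≤ s ^ (n + 1) := Nat.pow_le_pow_right hs1 (by omega)
    have b1 : E * (7 * E + 19) ≤ 26 * s ^ (n + 1) := by
      have : E * E ≤ s * s := Nat.mul_le_mul hsE hsE
      nlinarith
    have b2 : (n + 2) * (5 * (A.size + (6 + 5 * E + V)) + 4) ≤
        (n + 2) * (5 * A.size + 59) * s ^ (n + 1) := by
      rw [mul_assoc]
      refine Nat.mul_le_mul_left _ ?_
      have : A.size ≤ A.size * s ^ (n + 1) := Nat.le_mul_of_pos_right _ hX1
      nlinarith
    have b3 : ((Program.start A).cost + 4 * n) * (E + 2) ^ n ≤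
        ((Program.start A).cost + 4 * n) * 3 ^ n * s ^ (n + 1) := by
      rw [mul_assoc]
      exact Nat.mul_le_mul_left _ (hM.trans (Nat.mul_le_mul_left _ hX4))
    have b4 : ((Program.process A k).cost + 1) * ((6 + 5 * E + V) * A.size * (E + 2) ^ n) ≤
        ((Program.process A k).cost + 1) * (11 * A.size * 3 ^ n) * s ^ (n + 1) := by
      rw [mul_assoc _ (11 * A.size * 3 ^ n)]
      refine Nat.mul_le_mul_left _ ?_
      calc (6 + 5 * E + V) * A.size * (E + 2) ^ n ≤ 11 * s * A.size * (3 ^ n * s ^ n) := by gcongr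
        _ = 11 * A.size * 3 ^ n * s ^ (n + 1) := by ring
    have b5 : (Program.setup n A.size).cost ≤ (Program.setup n A.size).cost * s ^ (n + 1) :=
      Nat.le_mul_of_pos_right _ hX1
    linarith
  · rintro m' ⟨μ, hμ, hT, hh, hloc, h18, h0⟩
    set L : Arena := ⟨6 + 5 * I.mem 1, 6 + 5 * I.mem 1 + I.mem 0,
      A.size + (6 + 5 * I.mem 1 + I.mem 0), μ, I.mem 4, 6 + 5 * I.mem 1 + I.mem 3⟩ with hL
    have hbd := fun c hc => reach_bound (A := A) (I := I) (L := L) hμ rfl (c := c) hc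
    -- The set `F` is the box given by `Cfg.bound`; its cardinality is the product of the number of
    -- locations, the number of control states, and `n` factors |E| + 2.
    have key := Program.search_spec (A := A) (L := L) (k := k) (m := m')
      (p := 6 + 5 * E + I.start) (M := E + 2) hT ?_ I.target.1.2 (by omega)
      (Fintype.piFinset fun i => Finset.range (Cfg.bound n (6 + 5 * E + V) A.size (E + 2) i))
      (fun c hc => Fintype.mem_piFinset.2 fun i => Finset.mem_range.2 ((hbd c hc).1 i)) ?_
      hh hloc h18 h0
    · rw [exists_reach_iff hμ rfl rfl rfl] at key
      refine key.mono ?_ fun _ h => h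
      rw [Fintype.card_piFinset, Fin.prod_univ_succ, Fin.prod_univ_succ]
      simp [Cfg.bound, mul_assoc]
    · have h1 : 4 ≤ (n + 2) * L.W := by
        have : 2 * 6 ≤ (n + 2) * L.W := Nat.mul_le_mul (by omega) (by simp only [hL]; omega)
        omega
      simp only [Arena.visBase]
      have : L.B ≤ L.H := by simp only [hL]; omega
      omega
    · intro c hc
      obtain ⟨h1, h2⟩ := hbd c hc
      have hc0 : c 0 < 6 + 5 * E + V := h1 0
      have hc1 : c 1 < A.size := h1 1
      have hW : L.W = A.size + (6 + 5 * E + V) := rfl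
      refine ⟨fun i => ?_, hc0, hc1, h2⟩
      refine Fin.cases ?_ (fun i => Fin.cases ?_ (fun i => ?_) i) i
      · omega
      · change c 1 < _
        omega
      · have : c i.succ.succ < E + 2 := h1 i.succ.succ
        omega

/-! ### Caches that do not depend on the names of blocks -/

/-- A cache that can be used with any type of names. Its states have at most `n` names in them, and
accesses only compare names. -/
structure SymCache (k n : ℕ) where
  State : Type → Type
  map : {α γ : Type} → (α → γ) → State α → State γ
  names : {α : Type} → State α → List α
  WF : {α : Type} → State α → Prop
  Legal : {α : Type} → State α → Prop
  empty : {α : Type} → State α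
  access : {α : Type} → [DecidableEq α] → State α → Fin k → α → State α
  Mem : {α : Type} → State α → Fin k → α → Prop
  map_id : ∀ {α : Type} (σ : State α), map id σ = σ
  map_map : ∀ {α γ δ : Type} (f : α → γ) (g : γ → δ) (σ : State α),
    map g (map f σ) = map (g ∘ f) σ
  map_congr : ∀ {α γ : Type} (f g : α → γ) (σ : State α),
    (∀ b ∈ names σ, f b = g b) → map f σ = map g σ
  map_empty : ∀ {α γ : Type} (f : α → γ), map f empty = empty
  names_map : ∀ {α γ : Type} (f : α → γ) (σ : State α), names (map f σ) = (names σ).map f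
  length_names : ∀ {α : Type} (σ : State α), WF σ → (names σ).length ≤ n
  wf_map : ∀ {α γ : Type} (f : α → γ) (σ : State α), WF σ → WF (map f σ)
  wf_access : ∀ {α : Type} [DecidableEq α] (σ : State α) (s : Fin k) (a : α),
    WF σ → WF (access σ s a)
  wf_empty : ∀ {α : Type}, WF (empty : State α)
  wf_legal : ∀ {α : Type} (σ : State α), Legal σ → WF σ
  legal_map : ∀ {α γ : Type} (f : α → γ) (σ : State α), f.Injective → (Legal (map f σ) ↔ Legal σ)
  access_map : ∀ {α γ : Type} [DecidableEq α] [DecidableEq γ] (f : α → γ) (σ : State α) (s : Fin k)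
    (a : α), (∀ b ∈ names σ, f b = f a → b = a) →
    access (map f σ) s (f a) = map f (access σ s a)
  mem_map : ∀ {α γ : Type} (f : α → γ) (σ : State α) (s : Fin k) (a : α),
    (∀ b ∈ names σ, f b = f a → b = a) → (Mem (map f σ) s (f a) ↔ Mem σ s a)
  finite : Finite {q : State (Fin n) // WF q}

namespace SymCache

variable {k n : ℕ} (S : SymCache k n)

/-- The possible initial states. -/
def IsInitial {α : Type} (S : SymCache k n) : InitialCache → S.State α → Prop
  | .empty, σ => σ = S.empty
  | .arbitrary, σ => S.Legal σ

theorem wf_of_isInitial {α : Type} {i : InitialCache} {σ : S.State α} (h : S.IsInitial i σ) :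
    S.WF σ := by
  cases i with
  | empty => obtain rfl : σ = S.empty := h; exact S.wf_empty
  | arbitrary => exact S.wf_legal σ h

/-- Renaming fixes the empty state, and an injective renaming has a left inverse, so no other state
is mapped to the empty one. -/
theorem isInitial_map {α γ : Type} [Nonempty α] {i : InitialCache} {σ : S.State α} {f : α → γ}
    (hf : f.Injective) : S.IsInitial i (S.map f σ) ↔ S.IsInitial i σ := by
  cases i with
  | empty =>
    refine ⟨fun h => ?_, fun h => ?_⟩
    · have h' : S.map (Function.invFun f) (S.map f σ) = S.map (Function.invFun f) S.empty :=
        congrArg _ h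
      rw [S.map_map, Function.invFun_comp hf, S.map_id, S.map_empty] at h'
      exact h'
    · obtain rfl : σ = S.empty := h
      exact S.map_empty f
  | arbitrary => exact S.legal_map f σ hf

/-- A state with names from a set of `n` elements comes from a state with names in `Fin n`. -/
theorem exists_pattern (hn : 0 < n) {α : Type} {σ : S.State α} (hσ : S.WF σ) (T : Finset α)
    (hT : T.card = n) (h : ∀ b ∈ S.names σ, b ∈ T) :
    ∃ x : Fin n → α, x.Injective ∧ ∃ q, S.WF q ∧ S.map x q = σ := by
  classical
  let e := T.equivFinOfCardEq hT
  let g : α → Fin n := fun a => if h : a ∈ T then e ⟨a, h⟩ else ⟨0, hn⟩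
  refine ⟨fun i => e.symm i, fun i j hij => e.symm.injective (Subtype.ext hij), S.map g σ,
    S.wf_map g σ hσ, ?_⟩
  rw [S.map_map]
  conv_rhs => rw [← S.map_id σ]
  refine S.map_congr _ _ _ fun b hb => ?_
  simp [g, h b hb]

/-! ### The register automaton of a cache -/

/-- The patterns of states. -/
abbrev Pattern : Type := {q : S.State (Fin n) // S.WF q}

instance : Finite S.Pattern := S.finite

/-- The pattern with the number `q`. -/
noncomputable def decode (q : ℕ) : S.Pattern :=
  if h : q < Nat.card S.Pattern then (Finite.equivFin S.Pattern).symm ⟨q, h⟩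
  else ⟨S.empty, S.wf_empty⟩

/-- The number of a pattern. -/
noncomputable def encode (q : S.Pattern) : ℕ := Finite.equivFin S.Pattern q

theorem encode_lt (q : S.Pattern) : S.encode q < Nat.card S.Pattern := Fin.is_lt _

@[simp] theorem decode_encode (q : S.Pattern) : S.decode (S.encode q) = q := by
  rw [decode, dif_pos (S.encode_lt q)]
  simp [encode]

/-- Replace the names of the registers that contain the accessed name. -/
def collapse (P : ℕ → Bool) (j : Fin n) : Option (Fin n) := if P j then none else some j

/-- The state after an access to the name `none`. -/
noncomputable def result (q s : ℕ) (P : ℕ → Bool) : S.State (Option (Fin n)) :=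
  if h : s < k then S.access (S.map (collapse P) (S.decode q).1) ⟨s, h⟩ none
  else S.map (collapse P) (S.decode q).1

theorem wf_result (q s : ℕ) (P : ℕ → Bool) : S.WF (S.result q s P) := by
  unfold result
  split
  · exact S.wf_access _ _ _ (S.wf_map _ _ (S.decode q).2)
  · exact S.wf_map _ _ (S.decode q).2

/-- After an access there are n + 1 candidate names, the registers and the accessed name `none`, but
a well-formed state holds at most n of them. The new state is thus again a pattern with n register
contents, each an old register or the accessed name. -/
theorem exists_result (hn : 0 < n) (q s : ℕ) (P : ℕ → Bool) :
    ∃ y : (Fin n → Option (Fin n)) × S.Pattern, S.map y.1 y.2.1 = S.result q s P := by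
  classical
  obtain ⟨T, hT, -, hc⟩ := Finset.exists_subsuperset_card_eq
    (Finset.subset_univ (S.names (S.result q s P)).toFinset)
    ((List.toFinset_card_le _).trans (S.length_names _ (S.wf_result q s P))) (by simp)
  obtain ⟨x, -, q', hq', h⟩ := S.exists_pattern hn (S.wf_result q s P) T hc
    fun b hb => hT (List.mem_toFinset.2 hb)
  exact ⟨⟨x, q', hq'⟩, h⟩

open Classical in
/-- The register automaton that simulates a cache; it accepts on a hit, or on a miss. -/
noncomputable def toRegAut (hn : 0 < n) (i : InitialCache) (hit : Bool) : RegAut n where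
  size := Nat.card S.Pattern
  next q s P := S.encode (S.exists_result hn q s P).choose.2
  source q s P := (S.exists_result hn q s P).choose.1
  accept q s P :=
    decide ((∃ h : s < k, S.Mem (S.map (collapse P) (S.decode q).1) ⟨s, h⟩ none) ↔ hit = true)
  init := (List.range (Nat.card S.Pattern)).filter fun q => S.IsInitial i (S.decode q).1
  next_lt _ _ _ := S.encode_lt _
  init_lt q hq := by simpa using (List.mem_filter.1 hq).1

/-- The state that is represented by a state of the register automaton. -/
noncomputable def rep (y : Fin (n + 1) → ℕ) : S.State ℕ :=
  S.map (Matrix.vecTail y) (S.decode (y 0)).1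

section Simulation

variable (q : S.State (Fin n)) (x : Fin n → ℕ) (a : ℕ)

/-- Collapsing turns the registers that contain `a` into `none`, and evaluating `none` as `a`
restores the contents. -/
theorem elim_comp_collapse :
    (fun o : Option (Fin n) => o.elim a x) ∘ collapse (pattern x a) = x := by
  funext j
  by_cases h : x j = a <;> simp [collapse, pattern, h]

/-- After the collapse no register name evaluates to `a` any more. This is the condition under which
evaluation commutes with an access to `none`, even if `a` was in several registers. -/
theorem eq_none_of_elim_eq (b : Option (Fin n))
    (hb : b ∈ S.names (S.map (collapse (pattern x a)) q)) (h : b.elim a x = a) : b = none := by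
  rw [S.names_map] at hb
  obtain ⟨j, -, rfl⟩ := List.mem_map.1 hb
  by_cases hj : x j = a
  · simp [collapse, pattern, hj]
  · simp [collapse, pattern, hj] at h

end Simulation

/-- The automaton performs the access symbolically over `Option (Fin n)`; evaluating the symbolic
result gives the real one because evaluation is injective at `none`. Legality of the state plays no
role, so repeated names are allowed. -/
theorem rep_step (hn : 0 < n) (i : InitialCache) (hit : Bool) (s : Fin k) (a : ℕ)
    (y : Fin (n + 1) → ℕ) :
    S.rep ((S.toRegAut hn i hit).step s a y) = S.access (S.rep y) s a := by
  set x := Matrix.vecTail y with hx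
  set P := pattern x a with hP
  have h := (S.exists_result hn (y 0) s P).choose_spec
  set z := (S.exists_result hn (y 0) s P).choose with hz
  have h1 : S.rep ((S.toRegAut hn i hit).step s a y) =
      S.map ((fun o : Option (Fin n) => o.elim a x) ∘ z.1) z.2.1 := by
    have : S.decode ((S.toRegAut hn i hit).step s a y 0) = z.2 := S.decode_encode _
    rw [rep, this]
    rfl
  rw [h1, ← S.map_map, h, result, dif_pos s.2,
    ← S.access_map (fun o : Option (Fin n) => o.elim a x) _ _ none
      (fun b hb => S.eq_none_of_elim_eq _ x a b hb), S.map_map, elim_comp_collapse]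
  rfl

theorem accepts_iff (hn : 0 < n) (i : InitialCache) (hit : Bool) (s : Fin k) (a : ℕ)
    (y : Fin (n + 1) → ℕ) :
    (S.toRegAut hn i hit).Accepts s a y ↔ (S.Mem (S.rep y) s a ↔ hit = true) := by
  classical
  have h := S.mem_map (fun o : Option (Fin n) => o.elim a (Matrix.vecTail y)) _ s none
    (fun b hb => S.eq_none_of_elim_eq (S.decode (y 0)).1 (Matrix.vecTail y) a b hb)
  rw [S.map_map, elim_comp_collapse] at h
  change decide _ = true ↔ _
  rw [decide_eq_true_iff]
  refine iff_congr ?_ Iff.rfl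
  refine (Iff.trans ⟨fun h => h.2, fun h => ⟨s.2, h⟩⟩ h.symm)

/-- The effect of an edge on the state of the cache. Blocks are replaced with their identifiers. -/
def edgeStep {v : ℕ} (ι : ℕ → ℕ) (σ : S.State ℕ) (e : Edge (Fin k × ℕ) v) : S.State ℕ :=
  e.label.elim σ fun b => S.access σ b.1 (ι b.2)

theorem rep_foldl (hn : 0 < n) (i : InitialCache) (hit : Bool) {v : ℕ} (ι : ℕ → ℕ)
    (π : List (Edge (Fin k × ℕ) v)) (y : Fin (n + 1) → ℕ) :
    S.rep (π.foldl ((S.toRegAut hn i hit).edgeStep ι) y) = π.foldl (S.edgeStep ι) (S.rep y) := by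
  induction π generalizing y with
  | nil => rfl
  | cons e π ih =>
    rw [List.foldl_cons, List.foldl_cons, ih]
    congr 1
    unfold RegAut.edgeStep edgeStep
    cases e.label with
    | none => rfl
    | some b => exact S.rep_step hn i hit b.1 _ y

/-- The renaming needs to be injective only at the accessed names. All names that are never accessed
may be merged. -/
theorem map_foldl {v : ℕ} (f ι ι' : ℕ → ℕ) (π : List (Edge (Fin k × ℕ) v))
    (h : ∀ e ∈ π, ∀ b, e.label = some b →
      f (ι b.2) = ι' b.2 ∧ ∀ c, f c = f (ι b.2) → c = ι b.2) (σ : S.State ℕ) :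
    S.map f (π.foldl (S.edgeStep ι) σ) = π.foldl (S.edgeStep ι') (S.map f σ) := by
  induction π generalizing σ with
  | nil => rfl
  | cons e π ih =>
    rw [List.foldl_cons, List.foldl_cons, ih fun e he => h e (List.mem_cons_of_mem _ he)]
    congr 1
    unfold edgeStep
    cases hb : e.label with
    | none => rfl
    | some b =>
      obtain ⟨h1, h2⟩ := h e List.mem_cons_self b hb
      simp only [Option.elim_some]
      rw [← h1, S.access_map f σ b.1 (ι b.2) fun c _ => h2 c]

end SymCache

/-! ### Identifiers of names -/

section Ident

variable {k : ℕ} (I : Input (Fin k × ℕ))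

/-- A nonzero identifier determines its name, being one more than a position at which that name
stands. Injectivity of identifiers off zero follows. -/
theorem nameAt_of_ident {w : ℕ → ℕ} {a : ℕ} (h : ident w a ≠ 0) :
    nameAt w (ident w a - 1) = a ∧ ident w a - 1 ≤ w 1 := by
  classical
  unfold ident at h ⊢
  split at h
  · next hex =>
    rw [dif_pos hex]
    exact ⟨(Nat.find_spec hex).2, (Nat.find_spec hex).1⟩
  · exact absurd rfl h

theorem ident_injOn {w : ℕ → ℕ} {a b : ℕ} (h : ident w a = ident w b) (h0 : ident w a ≠ 0) :
    a = b := by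
  rw [← (nameAt_of_ident h0).1, h, (nameAt_of_ident (h ▸ h0)).1]

theorem ident_ne_zero {w : ℕ → ℕ} {a j : ℕ} (hj : j ≤ w 1) (h : nameAt w j = a) :
    ident w a ≠ 0 := by
  unfold ident
  rw [dif_pos ⟨j, hj, h⟩]
  omega

/-- The target heads the list of names, so its identifier does not depend on the input. -/
theorem ident_target : ident I.mem I.target.2 = 1 := by
  have hex : ∃ j ≤ I.mem 1, nameAt I.mem j = I.target.2 := ⟨0, Nat.zero_le _, rfl⟩
  unfold ident
  rw [dif_pos hex]
  classical
  have : Nat.find hex = 0 := (Nat.find_eq_zero hex).2 ⟨Nat.zero_le _, rfl⟩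
  simpa using this

theorem ident_label_ne_zero {e : Edge (Fin k × ℕ) I.numNodes} (he : e ∈ I.edges) {b : Fin k × ℕ}
    (hb : e.label = some b) : ident I.mem b.2 ≠ 0 := by
  obtain ⟨j, hj, rfl⟩ := List.mem_iff_getElem.1 he
  refine ident_ne_zero (j := j + 1) hj ?_
  rw [nameAt, if_neg (by omega), show 4 + 5 * (j + 1) = 6 + 5 * j + 3 by omega,
    I.mem_edge j hj 3 (by omega), Edge.words_name, hb]
  rfl

theorem Input.IsPath.mem_edges {β : Type} {I : Input β} {π : List (Edge β I.numNodes)}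
    {p q : Fin I.numNodes} (h : I.IsPath π p q) : ∀ e ∈ π, e ∈ I.edges := by
  induction π generalizing p with
  | nil => simp
  | cons d π ih =>
    intro e he
    rcases List.mem_cons.1 he with rfl | he
    · exact h.1
    · exact ih h.2.2 e he

open Classical in
/-- Replace with `0` the numbers that are not identifiers of names. -/
noncomputable def restrict (w : ℕ → ℕ) (v : ℕ) : ℕ := if ∃ a, ident w a = v then v else 0

/-- Identifiers are positions of first occurrences, so a repeated name leaves gaps, and the
enumeration also puts such unused numbers into registers. Sending them to `0` keeps every nonzero
identifier apart from all other numbers. -/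
theorem restrict_eq {w : ℕ → ℕ} {a v : ℕ} (h0 : ident w a ≠ 0) :
    restrict w (ident w a) = ident w a ∧
      (restrict w v = restrict w (ident w a) → v = ident w a) := by
  have h : restrict w (ident w a) = ident w a := if_pos ⟨a, rfl⟩
  refine ⟨h, ?_⟩
  rw [h]
  unfold restrict
  split
  · exact id
  · intro h; exact absurd h.symm h0

/-- Register contents that are distinct off zero come from distinct names. -/
theorem exists_names {n : ℕ} (w : ℕ → ℕ) {x : Fin n → ℕ} (hx : InjOffZero x) :
    ∃ z : Fin n → ℕ, z.Injective ∧ ∀ i, ident w (z i) = restrict w (x i) := by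
  classical
  -- `K` exceeds every name in the input. The names `K + i` are fresh and distinct, and fill the
  -- slots whose register holds `0` or an unused number.
  let K := ∑ j ∈ Finset.range (w 1 + 1), nameAt w j + 1
  have hK : ∀ a, K ≤ a → ident w a = 0 := by
    intro a ha
    by_contra h
    obtain ⟨h1, h2⟩ := nameAt_of_ident h
    have : nameAt w (ident w a - 1) ≤ ∑ j ∈ Finset.range (w 1 + 1), nameAt w j :=
      Finset.single_le_sum (fun _ _ => Nat.zero_le _) (Finset.mem_range.2 (by omega))
    omega
  let z : Fin n → ℕ := fun i =>
    if h : x i ≠ 0 ∧ ∃ a, ident w a = x i then h.2.choose else K + i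
  have z1 : ∀ i, (h : x i ≠ 0 ∧ ∃ a, ident w a = x i) → ident w (z i) = x i := by
    intro i h
    simp only [z]
    rw [dif_pos h]
    exact h.2.choose_spec
  have z2 : ∀ i, ¬ (x i ≠ 0 ∧ ∃ a, ident w a = x i) → z i = K + i := by
    intro i h
    simp only [z]
    rw [dif_neg h]
  refine ⟨z, fun i j hij => ?_, fun i => ?_⟩
  · by_cases hi : x i ≠ 0 ∧ ∃ a, ident w a = x i <;> by_cases hj : x j ≠ 0 ∧ ∃ a, ident w a = x j
    · exact hx i j (by rw [← z1 i hi, ← z1 j hj, hij]) hi.1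
    · have := z1 i hi
      rw [hij, z2 j hj, hK _ (by omega)] at this
      exact absurd this.symm hi.1
    · have := z1 j hj
      rw [← hij, z2 i hi, hK _ (by omega)] at this
      exact absurd this.symm hj.1
    · rw [z2 i hi, z2 j hj] at hij
      exact Fin.ext (by omega)
  · by_cases hi : x i ≠ 0 ∧ ∃ a, ident w a = x i
    · rw [z1 i hi, restrict, if_pos hi.2]
    · rw [z2 i hi, hK _ (by omega), restrict]
      split
      · next h => by_contra h0; exact hi ⟨fun h => h0 h.symm, h⟩
      · rfl

end Ident

/-! ### From register automata back to caches. -/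

namespace SymCache

variable {k n : ℕ} (S : SymCache k n)

theorem mem_toRegAut_init (hn : 0 < n) (i : InitialCache) (hit : Bool) {q : ℕ} :
    q ∈ (S.toRegAut hn i hit).init ↔ q < Nat.card S.Pattern ∧ S.IsInitial i (S.decode q).1 := by
  simp [toRegAut]

/-- The register automaton solves the analysis problem for the cache. -/
theorem solves_iff (hn : 0 < n) (i : InitialCache) (hit : Bool) (I : Input (Fin k × ℕ)) :
    (S.toRegAut hn i hit).Solves I ↔ ∃ σ : S.State ℕ, S.IsInitial i σ ∧
      ∃ π, I.IsPath π I.start I.final ∧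
        (S.Mem (π.foldl (S.edgeStep id) σ) I.target.1 I.target.2 ↔ hit = true) := by
  classical
  have : Nonempty (Fin n) := ⟨⟨0, hn⟩⟩
  set ι := ident I.mem with hι
  have target_ne : ι I.target.2 ≠ 0 := by rw [hι, ident_target]; omega
  -- Every accessed name has a nonzero identifier, so the renaming is injective at each access of
  -- the path.
  have hmap : ∀ {π : List (Edge (Fin k × ℕ) I.numNodes)}, I.IsPath π I.start I.final →
      ∀ σ, S.map ι (π.foldl (S.edgeStep id) σ) = π.foldl (S.edgeStep ι) (S.map ι σ) :=
    fun hπ σ => S.map_foldl ι id ι _ (fun e he b hb => ⟨rfl, fun c hc => ident_injOn hc (by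
      change ι c ≠ 0; rw [hc]; exact ident_label_ne_zero I (hπ.mem_edges e he) hb)⟩) σ
  have hmem : ∀ σ, S.Mem (S.map ι σ) I.target.1 1 ↔ S.Mem σ I.target.1 I.target.2 := fun σ => by
    rw [← ident_target I]
    exact S.mem_map ι σ _ _ fun b _ hb => ident_injOn hb (ne_of_eq_of_ne hb target_ne)
  constructor
  · rintro ⟨q, hq, x, -, hinj, π, hπ, hacc⟩
    rw [accepts_iff, rep_foldl] at hacc
    obtain ⟨-, hini⟩ := (S.mem_toRegAut_init hn i hit).1 hq
    -- The injective `z` keeps the initial state legal, which the register contents themselves need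
    -- not do.
    obtain ⟨z, hz, hzx⟩ := exists_names I.mem hinj
    refine ⟨S.map z (S.decode q).1, (S.isInitial_map hz).2 hini, π, hπ, ?_⟩
    rw [← hmem, hmap hπ, S.map_map]
    -- The genuine state and the state of the automaton have a common image: the former under the
    -- identifiers, the latter under `restrict`. Both renamings preserve the run and the membership
    -- of the target.
    have hcomp : ι ∘ z = restrict I.mem ∘ x := funext hzx
    rw [hcomp, ← S.map_map, ← S.map_foldl (restrict I.mem) ι ι π (fun e he b hb =>
      ⟨(restrict_eq (v := 0) (ident_label_ne_zero I (hπ.mem_edges e he) hb)).1,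
        fun c => (restrict_eq (ident_label_ne_zero I (hπ.mem_edges e he) hb)).2⟩)]
    have hr : restrict I.mem 1 = 1 := by
      rw [← ident_target I]; exact (restrict_eq (v := 0) target_ne).1
    have := S.mem_map (restrict I.mem) (π.foldl (S.edgeStep ι) (S.map x (S.decode q).1))
      I.target.1 1 fun b _ hb => by
        rw [← ident_target I] at hb ⊢
        exact (restrict_eq target_ne).2 hb
    rw [hr] at this
    rw [this]
    exact hacc
  · rintro ⟨σ, hσ, π, hπ, hacc⟩
    have hwf := S.wf_of_isInitial hσ
    -- A partly filled cache has fewer than n names. They are padded to n distinct ones so that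
    -- every register has a content.
    obtain ⟨T, hT, hc⟩ := Infinite.exists_superset_card_eq (S.names σ).toFinset n
      ((List.toFinset_card_le _).trans (S.length_names _ hwf))
    obtain ⟨z, hz, q, hq, rfl⟩ := S.exists_pattern hn hwf T hc
      fun b hb => hT (List.mem_toFinset.2 hb)
    refine ⟨S.encode ⟨q, hq⟩, (S.mem_toRegAut_init hn i hit).2 ⟨S.encode_lt _, ?_⟩, ι ∘ z,
      fun j => ident_lt _ _, fun j l hjl h0 => hz (ident_injOn hjl h0), π, hπ, ?_⟩
    · rw [S.decode_encode]
      exact (S.isInitial_map hz).1 hσ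
    · rw [accepts_iff, rep_foldl]
      have : S.rep (Matrix.vecCons (S.encode ⟨q, hq⟩) (ι ∘ z)) = S.map ι (S.map z q) := by
        rw [S.map_map]
        simp [rep]
      rw [this, ← hmap hπ, hmem]
      exact hacc

/-- If a cache is represented by a symmetric cache, the analysis problems are decidable. -/
theorem decidable (hn : 0 < n) (c : Cache (Fin k × ℕ)) (enc : c.State → S.State ℕ)
    (haccess : ∀ σ b, enc (c.access σ b) = S.access (enc σ) b.1 b.2)
    (hmem : ∀ σ b, b ∈ c.contents σ ↔ S.Mem (enc σ) b.1 b.2)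
    (hinit : ∀ i τ, S.IsInitial i τ ↔ ∃ σ, c.IsInitial i σ ∧ enc σ = τ) (i : InitialCache) :
    (∃ (p : Program) (C : ℕ), p.DecidesWithin (ExistHit c i) fun I => C * I.size ^ (n + 1)) ∧
    ∃ (p : Program) (C : ℕ), p.DecidesWithin (ExistMiss c i) fun I => C * I.size ^ (n + 1) := by
  have hrun : ∀ {v : ℕ} (π : List (Edge (Fin k × ℕ) v)) σ,
      enc (c.run σ π) = π.foldl (S.edgeStep id) (enc σ) := by
    intro v π
    induction π with
    | nil => intro σ; rfl
    | cons e π ih =>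
      intro σ
      rw [List.foldl_cons, Cache.run, List.foldl_cons]
      refine (ih _).trans ?_
      congr 1
      unfold Cache.step edgeStep
      cases e.label with
      | none => rfl
      | some b => exact haccess σ b
  have hhit : (S.toRegAut hn i true).Solves = ExistHit c i := by
    funext I
    rw [solves_iff, eq_iff_iff]
    constructor
    · rintro ⟨τ, hτ, π, hπ, h⟩
      obtain ⟨σ, hσ, rfl⟩ := (hinit i τ).1 hτ
      exact ⟨σ, hσ, π, hπ, by rw [hmem, hrun]; exact h.2 rfl⟩
    · rintro ⟨σ, hσ, π, hπ, h⟩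
      rw [hmem, hrun] at h
      exact ⟨enc σ, (hinit i _).2 ⟨σ, hσ, rfl⟩, π, hπ, fun _ => rfl, fun _ => h⟩
  have hmiss : (S.toRegAut hn i false).Solves = ExistMiss c i := by
    funext I
    rw [solves_iff, eq_iff_iff]
    constructor
    · rintro ⟨τ, hτ, π, hπ, h⟩
      obtain ⟨σ, hσ, rfl⟩ := (hinit i τ).1 hτ
      refine ⟨σ, hσ, π, hπ, ?_⟩
      rw [hmem, hrun]
      exact fun h' => Bool.false_ne_true (h.1 h')
    · rintro ⟨σ, hσ, π, hπ, h⟩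
      rw [hmem, hrun] at h
      exact ⟨enc σ, (hinit i _).2 ⟨σ, hσ, rfl⟩, π, hπ, fun h' => absurd h' h,
        fun h' => absurd h' Bool.false_ne_true⟩
  exact ⟨hhit ▸ (S.toRegAut hn i true).decidable k hn, hmiss ▸ (S.toRegAut hn i false).decidable k hn⟩

/-- The cache with a single cache set that belongs to a symmetric cache. -/
def toCache {n : ℕ} (S : SymCache 1 n) : Cache (Fin 1 × ℕ) where
  State := S.State (Fin 1 × ℕ)
  empty := S.empty
  Legal := S.Legal
  access σ b := S.access σ 0 b
  contents σ := {b | S.Mem σ 0 b}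

/-- With a single set, dropping the set number is a bijection of blocks with names. Renaming along
it identifies the two caches. -/
theorem decidable_toCache {n : ℕ} (S : SymCache 1 n) (hn : 0 < n) (i : InitialCache) :
    (∃ (p : Program) (C : ℕ),
      p.DecidesWithin (ExistHit S.toCache i) fun I => C * I.size ^ (n + 1)) ∧
    ∃ (p : Program) (C : ℕ),
      p.DecidesWithin (ExistMiss S.toCache i) fun I => C * I.size ^ (n + 1) := by
  have hsnd : (Prod.snd : Fin 1 × ℕ → ℕ).Injective := fun a b h =>
    Prod.ext (Subsingleton.elim _ _) h
  have hini : ∀ i (σ : S.State (Fin 1 × ℕ)), S.toCache.IsInitial i σ ↔ S.IsInitial i σ := by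
    rintro (_ | _) σ <;> rfl
  refine S.decidable hn S.toCache (S.map Prod.snd) (fun σ b => ?_) (fun σ b => ?_) (fun i τ => ?_) i
  · rw [Subsingleton.elim b.1 0]
    exact (S.access_map Prod.snd σ 0 b fun c _ h => hsnd h).symm
  · rw [Subsingleton.elim b.1 0]
    exact (S.mem_map Prod.snd σ 0 b fun c _ h => hsnd h).symm
  · constructor
    · intro h
      refine ⟨S.map (fun a => (0, a)) τ, (hini i _).2 ((S.isInitial_map fun a b h => ?_).2 h), ?_⟩
      · exact (Prod.ext_iff.1 h).2
      · rw [S.map_map]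
        exact S.map_id τ
    · rintro ⟨σ, hσ, rfl⟩
      exact (S.isInitial_map hsnd).2 ((hini i σ).1 hσ)

end SymCache

/-! ### The replacement policies -/

/-! ### Accesses in LRU, FIFO and NMRU caches commute with renaming. -/

section Lists

variable {α γ : Type} {f : α → γ} {a : α}

theorem mem_map_iff_of_injAt {w : List α} (h : ∀ b ∈ w, f b = f a → b = a) :
    f a ∈ w.map f ↔ a ∈ w := by
  refine ⟨fun ha => ?_, List.mem_map_of_mem⟩
  obtain ⟨b, hb, hba⟩ := List.mem_map.1 ha
  exact h b hb hba ▸ hb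

/-- The choice of the victim depends on the MRU-bits alone, so any renaming is allowed. -/
theorem nmruVictim_map (w : List (α × Bool)) :
    nmruVictim (w.map (Prod.map f id)) = nmruVictim w := by
  unfold nmruVictim
  rw [List.findIdx?_map]
  rfl

variable [DecidableEq α] [DecidableEq γ]

theorem erase_map_of_injAt {w : List α} (h : ∀ b ∈ w, f b = f a → b = a) :
    (w.map f).erase (f a) = (w.erase a).map f := by
  induction w with
  | nil => rfl
  | cons b w ih =>
    rw [List.map_cons, List.erase_cons, List.erase_cons,
      ih fun b hb => h b (List.mem_cons_of_mem _ hb)]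
    by_cases hb : b = a
    · simp [hb]
    · have : f b ≠ f a := fun h' => hb (h b List.mem_cons_self h')
      simp [hb, this]

theorem lruAccess_map (N : ℕ) {w : List α} (h : ∀ b ∈ w, f b = f a → b = a) :
    lruAccess N (w.map f) (f a) = (lruAccess N w a).map f := by
  simp only [lruAccess, mem_map_iff_of_injAt h, List.length_map, erase_map_of_injAt h]
  split_ifs <;> simp

theorem fifoAccess_map (N : ℕ) {w : List α} (h : ∀ b ∈ w, f b = f a → b = a) :
    fifoAccess N (w.map f) (f a) = (fifoAccess N w a).map f := by
  simp only [fifoAccess, mem_map_iff_of_injAt h, List.length_map]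
  split_ifs <;> simp

/-- Positivity of `N` matters: with no lines at all, a miss would still store a block. -/
theorem length_lruAccess_le {N : ℕ} (hN : 1 ≤ N) {w : List α} (a : α) (h : w.length ≤ N) :
    (lruAccess N w a).length ≤ N := by
  unfold lruAccess
  split_ifs with h1 h2
  · have := List.length_pos_of_mem h1
    rw [List.length_append, List.length_erase_of_mem h1, List.length_singleton]
    omega
  · simpa using h2
  · simp; omega

theorem length_fifoAccess_le {N : ℕ} (hN : 1 ≤ N) {w : List α} (a : α) (h : w.length ≤ N) :
    (fifoAccess N w a).length ≤ N := by
  unfold fifoAccess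
  split_ifs with h1 h2
  · exact h
  · simpa using h2
  · simp; omega

theorem nmruMark_map (N : ℕ) {w : List (α × Bool)} (h : ∀ p ∈ w, f p.1 = f a → p.1 = a) :
    nmruMark N (w.map (Prod.map f id)) (f a) = (nmruMark N w a).map (Prod.map f id) := by
  have hiff : ∀ p ∈ w, (f p.1 = f a ↔ p.1 = a) := fun p hp => ⟨h p hp, fun h => by rw [h]⟩
  have hc : (w.map (Prod.map f id)).countP (fun p => p.1 ≠ f a ∧ p.2 = true) =
      w.countP (fun p => p.1 ≠ a ∧ p.2 = true) := by
    rw [List.countP_map]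
    refine List.countP_congr fun p hp => ?_
    simp [hiff p hp]
  unfold nmruMark
  rw [hc]
  split_ifs
  · rw [List.map_map, List.map_map]
    refine List.map_congr_left fun p hp => ?_
    simp [hiff p hp]
  · rw [List.map_map, List.map_map]
    refine List.map_congr_left fun p hp => ?_
    by_cases hpa : p.1 = a <;> simp [hiff p hp, hpa]

theorem nmruAccess_map (N : ℕ) {w : List (α × Bool)} (h : ∀ b ∈ w.map Prod.fst, f b = f a → b = a) :
    nmruAccess N (w.map (Prod.map f id)) (f a) = (nmruAccess N w a).map (Prod.map f id) := by
  have h' : ∀ p ∈ w, f p.1 = f a → p.1 = a := fun p hp => h p.1 (List.mem_map_of_mem hp)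
  have hm : (w.map (Prod.map f id)).map Prod.fst = (w.map Prod.fst).map f := by simp
  simp only [nmruAccess, hm, mem_map_iff_of_injAt h, List.length_map, nmruVictim_map]
  split_ifs
  · exact nmruMark_map N h'
  · rw [← nmruMark_map]
    · simp
    · intro p hp
      rcases List.mem_append.1 hp with hp | hp
      · exact h' p hp
      · rw [List.mem_singleton.1 hp]; exact fun _ => rfl
  · rw [← nmruMark_map]
    · rw [List.map_set]; rfl
    · intro p hp
      rcases List.mem_or_eq_of_mem_set hp with hp | hp
      · exact h' p hp
      · rw [hp]; exact fun _ => rfl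

@[simp] theorem length_nmruMark (N : ℕ) (w : List (α × Bool)) (a : α) :
    (nmruMark N w a).length = w.length := by
  unfold nmruMark
  split_ifs <;> simp

theorem length_nmruAccess_le {N : ℕ} {w : List (α × Bool)} (a : α) (h : w.length ≤ N) :
    (nmruAccess N w a).length ≤ N := by
  unfold nmruAccess
  split_ifs with h1 h2
  · simpa using h
  · simpa using h2
  · simpa using h

end Lists

/-- A cache whose state is a word of at most `N` names. -/
def wordCache (N : ℕ) (acc : {α : Type} → [DecidableEq α] → List α → α → List α)
    (hmap : ∀ {α γ : Type} [DecidableEq α] [DecidableEq γ] (f : α → γ) (w : List α) (a : α),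
      (∀ b ∈ w, f b = f a → b = a) → acc (w.map f) (f a) = (acc w a).map f)
    (hlen : ∀ {α : Type} [DecidableEq α] (w : List α) (a : α), w.length ≤ N →
      (acc w a).length ≤ N) : SymCache 1 (1 * N) where
  State := List
  map := List.map
  names w := w
  WF w := w.length ≤ N
  Legal w := w.Nodup ∧ w.length ≤ N
  empty := []
  access w _ a := acc w a
  Mem w _ a := a ∈ w
  map_id := List.map_id
  map_map f g w := List.map_map
  map_congr f g w h := List.map_congr_left h
  map_empty f := rfl
  names_map f w := rfl
  length_names w h := by simpa using h
  wf_map f w h := by simpa using h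
  wf_access w _ a h := hlen w a h
  wf_empty := Nat.zero_le _
  wf_legal w h := h.2
  legal_map f w hf := by rw [List.nodup_map_iff hf, List.length_map]
  access_map f w _ a h := hmap f w a h
  mem_map f w _ a h := mem_map_iff_of_injAt h
  finite := List.finite_length_le _ N

/-- The NMRU cache, for any type of names. -/
def nmruSymCache (N : ℕ) : SymCache 1 (1 * N) where
  State α := List (α × Bool)
  map f := List.map (Prod.map f id)
  names w := w.map Prod.fst
  WF w := w.length ≤ N
  Legal w := (w.map Prod.fst).Nodup ∧ w.length ≤ N ∧ (w.length = N → ∃ p ∈ w, p.2 = false)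
  empty := []
  access w _ a := nmruAccess N w a
  Mem w _ a := a ∈ w.map Prod.fst
  map_id w := by simp
  map_map f g w := by rw [List.map_map]; rfl
  map_congr f g w h := List.map_congr_left fun p hp =>
    Prod.ext (h p.1 (List.mem_map_of_mem hp)) rfl
  map_empty f := rfl
  names_map f w := by simp
  length_names w h := by simpa using h
  wf_map f w h := by simpa using h
  wf_access w _ a h := length_nmruAccess_le a h
  wf_empty := Nat.zero_le _
  wf_legal w h := h.2.1
  legal_map f w hf := by
    have : (w.map (Prod.map f id)).map Prod.fst = (w.map Prod.fst).map f := by simp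
    rw [this, List.nodup_map_iff hf, List.length_map]
    simp
  access_map f w _ a h := nmruAccess_map N h
  mem_map f w _ a h := by
    have : (w.map (Prod.map f id)).map Prod.fst = (w.map Prod.fst).map f := by simp
    rw [this]
    exact mem_map_iff_of_injAt h
  finite := List.finite_length_le _ N

/-! ### Renaming in PLRU trees. -/

namespace PLRUTree

variable {α γ δ : Type}

/-- Rename the cached blocks. -/
def map (f : α → γ) : {h : ℕ} → PLRUTree α h → PLRUTree γ h
  | _, line b => line (b.map f)
  | _, node t l r => node t (l.map f) (r.map f)

theorem map_id {h : ℕ} (t : PLRUTree α h) : t.map id = t := by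
  induction t with
  | line b => simp [map]
  | node t l r ihl ihr => rw [map, ihl, ihr]

theorem map_map (f : α → γ) (g : γ → δ) {h : ℕ} (t : PLRUTree α h) :
    (t.map f).map g = t.map (g ∘ f) := by
  induction t with
  | line b => simp [map]
  | node t l r ihl ihr => simp only [map, ihl, ihr]

theorem map_congr (f g : α → γ) {h : ℕ} (t : PLRUTree α h) (hfg : ∀ b ∈ t.blocks, f b = g b) :
    t.map f = t.map g := by
  induction t with
  | line b =>
    cases b with
    | none => rfl
    | some b => simpa [map, blocks] using hfg
  | node t l r ihl ihr =>
    simp only [blocks, List.mem_append] at hfg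
    rw [map, map, ihl fun b hb => hfg b (.inl hb), ihr fun b hb => hfg b (.inr hb)]

theorem blocks_map (f : α → γ) {h : ℕ} (t : PLRUTree α h) :
    (t.map f).blocks = t.blocks.map f := by
  induction t with
  | line b => cases b <;> rfl
  | node t l r ihl ihr => simp [map, blocks, ihl, ihr]

theorem map_emptyTree (f : α → γ) (h : ℕ) : (emptyTree α h).map f = emptyTree γ h := by
  induction h with
  | zero => rfl
  | succ h ih => simp [emptyTree, map, ih]

theorem length_blocks {h : ℕ} (t : PLRUTree α h) : t.blocks.length ≤ 2 ^ h := by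
  induction t with
  | line b => cases b <;> simp [blocks]
  | node t l r ihl ihr =>
    rw [blocks, List.length_append, pow_succ]
    omega

theorem hasEmpty_map (f : α → γ) {h : ℕ} (t : PLRUTree α h) :
    (t.map f).hasEmpty = t.hasEmpty := by
  induction t with
  | line b => cases b <;> rfl
  | node t l r ihl ihr => simp [map, hasEmpty, ihl, ihr]

theorem fill_map (f : α → γ) (a : α) {h : ℕ} (t : PLRUTree α h) :
    (t.map f).fill (f a) = (t.fill a).map f := by
  induction t with
  | line b => rfl
  | node t l r ihl ihr =>
    simp only [map, fill, hasEmpty_map]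
    split_ifs <;> simp [map, ihl, ihr]

theorem replace_map (f : α → γ) (a : α) {h : ℕ} (t : PLRUTree α h) :
    (t.map f).replace (f a) = (t.replace a).map f := by
  induction t with
  | line b => rfl
  | node t l r ihl ihr => cases t <;> simp [map, replace, ihl, ihr]

/-- Only `touch` searches the tree for a name, so it alone needs the renaming to be injective at
`a`; `fill` and `replace` are steered by empty lines and by tags. -/
theorem touch_map [DecidableEq α] [DecidableEq γ] (f : α → γ) (a : α) {h : ℕ} (t : PLRUTree α h)
    (hf : ∀ b ∈ t.blocks, f b = f a → b = a) : (t.map f).touch (f a) = (t.touch a).map f := by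
  induction t with
  | line b => rfl
  | node t l r ihl ihr =>
    simp only [blocks, List.mem_append] at hf
    have hl := mem_map_iff_of_injAt fun b hb => hf b (.inl hb)
    simp only [map, touch, blocks_map, hl]
    split_ifs
    · rw [map, ihl fun b hb => hf b (.inl hb)]
    · rw [map, ihr fun b hb => hf b (.inr hb)]

theorem access_map [DecidableEq α] [DecidableEq γ] (f : α → γ) (a : α) {h : ℕ} (t : PLRUTree α h)
    (hf : ∀ b ∈ t.blocks, f b = f a → b = a) : (t.map f).access (f a) = (t.access a).map f := by
  simp only [access, blocks_map, mem_map_iff_of_injAt hf, hasEmpty_map]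
  split_ifs
  · exact touch_map f a t hf
  · exact fill_map f a t
  · exact replace_map f a t

instance finite [Finite α] : (h : ℕ) → Finite (PLRUTree α h)
  | 0 => Finite.of_surjective (line : Option α → _) fun t => by
      cases t with | line b => exact ⟨b, rfl⟩
  | h + 1 => by
      have := finite h
      refine Finite.of_surjective
        (fun p : Bool × PLRUTree α h × PLRUTree α h => node p.1 p.2.1 p.2.2) fun t => ?_
      cases t with | node t l r => exact ⟨(t, l, r), rfl⟩

end PLRUTree

/-- The PLRU cache, for any type of names. -/
def plruSymCache (h : ℕ) : SymCache 1 (1 * 2 ^ h) where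
  State α := PLRUTree α h
  map f t := t.map f
  names := PLRUTree.blocks
  WF _ := True
  Legal t := t.blocks.Nodup
  empty := PLRUTree.emptyTree _ h
  access t _ a := t.access a
  Mem t _ a := a ∈ t.blocks
  map_id := PLRUTree.map_id
  map_map f g t := t.map_map f g
  map_congr f g t h := t.map_congr f g h
  map_empty f := PLRUTree.map_emptyTree f h
  names_map f t := t.blocks_map f
  length_names t _ := by simpa using t.length_blocks
  wf_map _ _ _ := trivial
  wf_access _ _ _ _ := trivial
  wf_empty := trivial
  wf_legal _ _ := trivial
  legal_map f t hf := by rw [PLRUTree.blocks_map, List.nodup_map_iff hf]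
  access_map f t _ a h := t.access_map f a h
  mem_map f t _ a h := by rw [PLRUTree.blocks_map]; exact mem_map_iff_of_injAt h
  finite := inferInstance

/-! ### Pseudo-RR caches: several sets coupled by the shared index. -/

section PseudoRR

variable {k : ℕ} {α γ : Type}

theorem some_mem_iff_mem_filterMap {l : List (Option α)} {a : α} :
    some a ∈ l ↔ a ∈ l.filterMap id := by simp

theorem filterMap_id_map (f : α → γ) (l : List (Option α)) :
    (l.map (Option.map f)).filterMap id = (l.filterMap id).map f := by
  induction l with
  | nil => rfl
  | cons b l ih => cases b <;> simp_all

theorem map_map_option_congr {f g : α → γ} {l : List (Option α)}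
    (h : ∀ b ∈ l.filterMap id, f b = g b) :
    l.map (Option.map f) = l.map (Option.map g) := by
  refine List.map_congr_left fun o ho => ?_
  cases o with
  | none => rfl
  | some b => simp [h b (some_mem_iff_mem_filterMap.1 ho)]

/-- The names in a family of arrays of lines. -/
def lineNames (l : Fin k → List (Option α)) : List α :=
  (List.finRange k).flatMap fun s => (l s).filterMap id

theorem mem_lineNames {l : Fin k → List (Option α)} {s : Fin k} {a : α}
    (h : a ∈ (l s).filterMap id) : a ∈ lineNames l :=
  List.mem_flatMap.2 ⟨s, List.mem_finRange s, h⟩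

theorem length_lineNames {N : ℕ} {l : Fin k → List (Option α)} (h : ∀ s, (l s).length = N) :
    (lineNames l).length ≤ k * N := by
  have : ∀ L : List (Fin k),
      (L.flatMap fun s => (l s).filterMap id).length ≤ L.length * N := by
    intro L
    induction L with
    | nil => simp
    | cons s L ih =>
      have := List.length_filterMap_le id (l s)
      rw [h s] at this
      rw [List.flatMap_cons, List.length_append, List.length_cons, Nat.succ_mul]
      omega
  have := this (List.finRange k)
  rwa [List.length_finRange] at this

open Classical in
/-- The pseudo-RR cache, for any type of names. -/
def pseudoRRSymCache (k N : ℕ) (hN : 1 ≤ N) : SymCache k (k * N) where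
  State α := (Fin k → List (Option α)) × ℕ
  map f σ := (fun s => (σ.1 s).map (Option.map f), σ.2)
  names σ := lineNames σ.1
  WF σ := σ.2 < N ∧ ∀ s, (σ.1 s).length = N
  Legal σ := σ.2 < N ∧ ∀ s, (σ.1 s).length = N ∧ ((σ.1 s).filterMap id).Nodup
  empty := (fun _ => List.replicate N none, 0)
  access σ s a := if some a ∈ σ.1 s then σ
    else (Function.update σ.1 s ((σ.1 s).set σ.2 (some a)), (σ.2 + 1) % N)
  Mem σ s a := some a ∈ σ.1 s
  map_id σ := by simp
  map_map f g σ := by simp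
  map_congr f g σ h := by
    refine Prod.ext (funext fun s => ?_) rfl
    exact map_map_option_congr fun b hb => h b (mem_lineNames hb)
  map_empty f := by simp
  names_map f σ := by
    simp only [lineNames, filterMap_id_map, List.map_flatMap]
  length_names σ h := length_lineNames h.2
  wf_map f σ h := ⟨h.1, fun s => by simpa using h.2 s⟩
  wf_access σ s a h := by
    split_ifs
    · exact h
    · refine ⟨Nat.mod_lt _ hN, fun s' => ?_⟩
      by_cases hs : s' = s
      · subst hs; simpa using h.2 s'
      · simpa [hs] using h.2 s'
  wf_empty := ⟨hN, fun s => by simp⟩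
  wf_legal σ h := ⟨h.1, fun s => (h.2 s).1⟩
  legal_map f σ hf := by simp only [filterMap_id_map, List.nodup_map_iff hf, List.length_map]
  access_map f σ s a h := by
    have hm : some (f a) ∈ (σ.1 s).map (Option.map f) ↔ some a ∈ σ.1 s := by
      rw [some_mem_iff_mem_filterMap, filterMap_id_map, some_mem_iff_mem_filterMap]
      exact mem_map_iff_of_injAt fun b hb => h b (mem_lineNames hb)
    simp only [hm]
    split_ifs
    · rfl
    · refine Prod.ext (funext fun s' => ?_) rfl
      by_cases hs : s' = s
      · subst hs; simp [List.map_set]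
      · simp [hs]
  mem_map f σ s a h := by
    rw [some_mem_iff_mem_filterMap, filterMap_id_map, some_mem_iff_mem_filterMap]
    exact mem_map_iff_of_injAt fun b hb => h b (mem_lineNames hb)
  finite := by
    -- There are finitely many lists of length `N` over a finite alphabet, hence finitely many
    -- families of `k` such lists; the shared index is below `N`.
    have h1 : ({l : Fin k → List (Option (Fin (k * N))) | ∀ s, (l s).length = N}).Finite := by
      have := Set.Finite.pi (ι := Fin k) (t := fun _ => {l : List (Option (Fin (k * N))) | l.length = N})
        fun _ => List.finite_length_eq _ N
      refine this.subset fun l hl s _ => hl s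
    refine ((h1.prod (Set.finite_lt_nat N)).subset fun σ hσ => ?_).to_subtype
    exact ⟨hσ.2, hσ.1⟩

/-- All sets advance the same index and cannot be analysed separately. The state has to hold the
names of all k · N lines, whence the exponent. -/
theorem pseudoRR_decidable (k N : ℕ) (hk : 0 < k) (hN : 1 ≤ N) (i : InitialCache) :
    (∃ (p : Program) (C : ℕ),
      p.DecidesWithin (ExistHit (pseudoRRCache k N) i) fun I => C * I.size ^ (k * N + 1)) ∧
    ∃ (p : Program) (C : ℕ),
      p.DecidesWithin (ExistMiss (pseudoRRCache k N) i) fun I => C * I.size ^ (k * N + 1) := by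
  refine (pseudoRRSymCache k N hN).decidable (Nat.mul_pos hk hN) (pseudoRRCache k N)
    (fun σ => (σ.lines, σ.next)) (fun σ b => ?_) (fun σ b => Iff.rfl) (fun i τ => ?_) i
  · by_cases hb : some b.2 ∈ σ.lines b.1
    · simp [pseudoRRSymCache, pseudoRRCache, pseudoRRAccess, hb]
    · simp [pseudoRRSymCache, pseudoRRCache, pseudoRRAccess, hb]
  · constructor
    · intro h
      refine ⟨⟨τ.1, τ.2⟩, ?_, rfl⟩
      cases i with
      | empty => obtain rfl : τ = _ := h; rfl
      | arbitrary => exact h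
    · rintro ⟨σ, hσ, rfl⟩
      cases i with
      | empty => obtain rfl : σ = _ := hσ; rfl
      | arbitrary => exact hσ

end PseudoRR

end CacheAnalysis

open CacheAnalysis in
theorem mainTheorem12 (P : Policy) (N : ℕ) (hN : P.Admissible N) (i : InitialCache) :
    (∃ (p : Program) (C : ℕ),
      p.DecidesWithin (ExistHit (P.cache N) i) (fun I => C * I.size ^ (P.sets * N + 1))) ∧
    (∃ (p : Program) (C : ℕ),
      p.DecidesWithin (ExistMiss (P.cache N) i) (fun I => C * I.size ^ (P.sets * N + 1))) := by
  cases P with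
  | lru =>
    have hN : 1 ≤ N := hN
    -- The single-set cache obtained from the symmetric one is `lruCache` by unfolding, and the
    -- register count `1 * N` matches `P.sets * N`.
    exact (wordCache N (lruAccess N) (fun f w a => lruAccess_map N)
      fun w a => length_lruAccess_le hN a).decidable_toCache (by omega) i
  | fifo =>
    have hN : 1 ≤ N := hN
    exact (wordCache N (fifoAccess N) (fun f w a => fifoAccess_map N)
      fun w a => length_fifoAccess_le hN a).decidable_toCache (by omega) i
  | pseudoRR k =>
    rcases Nat.eq_zero_or_pos k with rfl | hk
    -- Without cache sets there are no blocks, hence no inputs, since an input contains a target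
    -- block.
    · exact ⟨⟨.const 0 0, 0, fun I => I.target.1.elim0⟩, ⟨.const 0 0, 0, fun I => I.target.1.elim0⟩⟩
    · exact pseudoRR_decidable k N hk hN i
  | plru =>
    obtain ⟨h, rfl⟩ := hN
    -- The height of the tree is recovered as the binary logarithm of the number of ways.
    have hc : Policy.plru.cache (2 ^ h) = (plruSymCache h).toCache := by
      change plruCache _ (Nat.log 2 (2 ^ h)) = _
      rw [Nat.log_pow (by omega)]
      rfl
    rw [hc]
    exact (plruSymCache h).decidable_toCache (by positivity) i
  | nmru =>
    have hN : 1 ≤ N := hN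
    exact (nmruSymCache N).decidable_toCache (by omega) i
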